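/- **Setting.** Let $M$ be a countable transitive model of $\mathsf{ZFC}$. A *$\mathsf{GB}$-expansion* of $M$ is a collection $\mathcal X\subseteq\mathcal P(M)$ of classes such that $(M,\mathcal X)\models\mathsf{GB}$, that is: $M\models\mathsf{ZFC}$; $\mathcal X$ satisfies predicative comprehension (comprehension for formulas that quantify only over sets, with set and class parameters); and class replacement holds (if $F\in\mathcal X$ is a class function and $a\in M$, then $F''a\in M$). Global choice is not assumed. Let $\mathfrak A$ be the potentialist system whose worlds are all $(M,\mathcal X)$ with $\mathcal X$ a countable $\mathsf{GB}$-expansion of $M$, ordered by $\mathcal X\subseteq\mathcal Y$. At a world, $\Box\varphi$ means that $\varphi$ holds in every extending world in $\mathfrak A$, and $\Diamond\varphi$ that $\varphi$ holds in some extending world in $\mathfrak A$. A propositional modal formula is *valid* at a world, allowing parameters from a set $P$ of classes of that world, if it is true there under every substitution, for its propositional variables, of formulas of the two-sorted language of class theory (set and class quantifiers allowed) whose only parameters are classes in $P$; *without parameters* means $P=\emptyset$. The $\mathsf{.2}$ axiom is $\Diamond\Box p\Rightarrow\Box\Diamond p$. For $A\subseteq M$, $\mathrm{Tr}(A)\subseteq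 M$ is the truth predicate of $(M,\in,A)$: the class of all pairs $(\ulcorner\varphi\urcorner,a)$ where $\varphi$ is a first-order formula in $\in$ and a unary predicate symbol interpreted as $A$, $a$ is a finite sequence from $M$ interpreting the free variables of $\varphi$, and $(M,\in,A)\models\varphi(a)$. **Corollary.** Let $(M,\mathcal X)$ be a world of $\mathfrak A$ and let $A\in\mathcal X$ be such that $\mathrm{Tr}(A)\notin\mathcal X$, but there is a world $(M,\mathcal Y)$ of $\mathfrak A$ with $\mathcal X\subseteq\mathcal Y$ and $\mathrm{Tr}(A)\in\mathcal Y$. Then the $\mathsf{.2}$ axiom is not valid at $(M,\mathcal X)$, allowing $A$ as a parameter. In particular, if $A$ is definable over $(M,\in)$ by a first-order formula without parameters, then the $\mathsf{.2}$ axiom is not valid at $(M,\mathcal X)$ without parameters. -/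

import Mathlib

universe u

namespace ClassPotentialism

/-- Formulas of the two-sorted language of class theory with free set variables
`x 0, …, x (n - 1)` and free class variables `X 0, …, X (k - 1)`.
The quantifier `all` binds the set variable `x n`, the quantifier `allC` binds the class variable
`X k`. The other connectives and quantifiers are the usual abbreviations, and equality of classes is
expressed by having the same elements (all class theories here contain class extensionality). -/
inductive ClassFormula : ℕ → ℕ → Type
  | mem {n k : ℕ} (i j : Fin n) : ClassFormula n k
  | eq {n k : ℕ} (i j : Fin n) : ClassFormula n k
  | memC {n k : ℕ} (i : Fin n) (j : Fin k) : ClassFormula n k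
  | neg {n k : ℕ} (φ : ClassFormula n k) : ClassFormula n k
  | and {n k : ℕ} (φ ψ : ClassFormula n k) : ClassFormula n k
  | all {n k : ℕ} (φ : ClassFormula (n + 1) k) : ClassFormula n k
  | allC {n k : ℕ} (φ : ClassFormula n (k + 1)) : ClassFormula n k

namespace ClassFormula

/-- A formula is elementary if it quantifies only over sets. The elementary formulas without class
variables are the formulas of the first-order language of set theory `{∈}`; those with one
class variable are the first-order formulas of `{∈}` expanded by one unary predicate symbol. -/
def IsElementary : {n k : ℕ} → ClassFormula n k → Prop
  | _, _, mem _ _ => True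
  | _, _, eq _ _ => True
  | _, _, memC _ _ => True
  | _, _, neg φ => φ.IsElementary
  | _, _, and φ ψ => φ.IsElementary ∧ ψ.IsElementary
  | _, _, all φ => φ.IsElementary
  | _, _, allC _ => False

/-- Tarskian satisfaction in the structure `(M, 𝒳)`, whose membership relations are the true ones:
the set quantifiers range over the elements of `M`, the class quantifiers over `𝒳`. -/
def Realize (M : ZFSet.{u}) (𝒳 : Set (Set ZFSet.{u})) :
    {n k : ℕ} → ClassFormula n k → (Fin n → ZFSet.{u}) → (Fin k → Set ZFSet.{u}) → Prop
  | _, _, mem i j, a, _ => a i ∈ a j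
  | _, _, eq i j, a, _ => a i = a j
  | _, _, memC i j, a, S => a i ∈ S j
  | _, _, neg φ, a, S => ¬ Realize M 𝒳 φ a S
  | _, _, and φ ψ, a, S => Realize M 𝒳 φ a S ∧ Realize M 𝒳 ψ a S
  | _, _, all φ, a, S => ∀ x ∈ M, Realize M 𝒳 φ (Fin.snoc (α := fun _ => ZFSet.{u}) a x) S
  | _, _, allC φ, a, S => ∀ X ∈ 𝒳, Realize M 𝒳 φ a (Fin.snoc (α := fun _ => Set ZFSet.{u}) S X)

end ClassFormula

/-- First-order satisfaction in `(M, ∈, A)`, for elementary formulas with at most the class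
variables that are interpreted by `A`. (The class domain is irrelevant for elementary formulas.) -/
def SatSet (M : ZFSet.{u}) {n k : ℕ} (φ : ClassFormula n k) (a : Fin n → ZFSet.{u})
    (A : Fin k → Set ZFSet.{u}) : Prop :=
  φ.Realize M ∅ a A

/-- `(M, ∈)` is a model of `ZFC`: the axioms, with all quantifiers relativised to `M`. -/
structure ModelsZFC (M : ZFSet.{u}) : Prop where
  extensionality : ∀ x ∈ M, ∀ y ∈ M, (∀ z ∈ M, z ∈ x ↔ z ∈ y) → x = y
  foundation : ∀ x ∈ M, (∃ y ∈ M, y ∈ x) → ∃ y ∈ M, y ∈ x ∧ ∀ z ∈ M, z ∈ y → z ∉ x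
  pairing : ∀ x ∈ M, ∀ y ∈ M, ∃ p ∈ M, ∀ z ∈ M, z ∈ p ↔ z = x ∨ z = y
  union : ∀ x ∈ M, ∃ w ∈ M, ∀ z ∈ M, z ∈ w ↔ ∃ y ∈ M, y ∈ x ∧ z ∈ y
  powerset : ∀ x ∈ M, ∃ p ∈ M, ∀ z ∈ M, z ∈ p ↔ ∀ y ∈ M, y ∈ z → y ∈ x
  infinity : ∃ w ∈ M, (∃ e ∈ M, e ∈ w ∧ ∀ y ∈ M, y ∉ e) ∧
    ∀ x ∈ M, x ∈ w → ∃ y ∈ M, y ∈ w ∧ ∀ z ∈ M, z ∈ y ↔ z ∈ x ∨ z = x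
  choice : ∀ x ∈ M, (∀ y ∈ M, y ∈ x → ∃ z ∈ M, z ∈ y) →
    (∀ y ∈ M, y ∈ x → ∀ y' ∈ M, y' ∈ x → y ≠ y' → ∀ z ∈ M, z ∈ y → z ∉ y') →
    ∃ c ∈ M, ∀ y ∈ M, y ∈ x → ∃ z ∈ M, (z ∈ y ∧ z ∈ c) ∧ ∀ z' ∈ M, z' ∈ y → z' ∈ c → z' = z
  separation : ∀ (n : ℕ) (φ : ClassFormula (n + 1) 0), φ.IsElementary →
    ∀ p : Fin n → ZFSet.{u}, (∀ i, p i ∈ M) → ∀ x ∈ M,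
      ∃ y ∈ M, ∀ z ∈ M, z ∈ y ↔
        z ∈ x ∧ SatSet M φ (Fin.snoc (α := fun _ => ZFSet.{u}) p z) Fin.elim0
  replacement : ∀ (n : ℕ) (φ : ClassFormula (n + 2) 0), φ.IsElementary →
    ∀ p : Fin n → ZFSet.{u}, (∀ i, p i ∈ M) →
      let R : ZFSet.{u} → ZFSet.{u} → Prop := fun x y =>
        SatSet M φ (Fin.snoc (α := fun _ => ZFSet.{u})
          (Fin.snoc (α := fun _ => ZFSet.{u}) p x) y) Fin.elim0
      ∀ x ∈ M,
        (∀ z ∈ M, z ∈ x → ∀ y ∈ M, ∀ y' ∈ M, R z y → R z y' → y = y') →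
        ∃ w ∈ M, ∀ y ∈ M, y ∈ w ↔ ∃ z ∈ M, z ∈ x ∧ R z y

/-- `F` is a class function: a class of ordered pairs that is single-valued. -/
def IsClassFunction (F : Set ZFSet.{u}) : Prop :=
  (∀ z ∈ F, ∃ x y, z = ZFSet.pair x y) ∧
    ∀ x y y', ZFSet.pair x y ∈ F → ZFSet.pair x y' ∈ F → y = y'

/-- For transitive `M`, the structure `(M, 𝒳)` is a model of Gödel–Bernays class theory `GB`
(without global choice). Classes are subsets of `M`, so that class extensionality is automatic. -/
structure ModelsGB (M : ZFSet.{u}) (𝒳 : Set (Set ZFSet.{u})) : Prop where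
  zfc : ModelsZFC M
  classes_subset : ∀ A ∈ 𝒳, ∀ z ∈ A, z ∈ M
  /-- Predicative comprehension, with set and class parameters. -/
  comprehension : ∀ (n k : ℕ) (φ : ClassFormula (n + 1) k), φ.IsElementary →
    ∀ p : Fin n → ZFSet.{u}, (∀ i, p i ∈ M) → ∀ S : Fin k → Set ZFSet.{u}, (∀ i, S i ∈ 𝒳) →
      {z | z ∈ M ∧ φ.Realize M 𝒳 (Fin.snoc (α := fun _ => ZFSet.{u}) p z) S} ∈ 𝒳
  /-- Class replacement: if `F` is a class function and `a` is a set, then `F '' a` is a set. -/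
  class_replacement : ∀ F ∈ 𝒳, IsClassFunction F → ∀ a ∈ M,
    ∃ b ∈ M, ∀ y, y ∈ b ↔ ∃ x, x ∈ a ∧ ZFSet.pair x y ∈ F

/-- The top-down class potentialist system of all countable `GB`-expansions for `M`. A world
`(M, 𝒳)` is given by its collection `𝒳` of classes, and worlds are ordered by inclusion. -/
def topDown (M : ZFSet.{u}) : Set (Set (Set ZFSet.{u})) :=
  {𝒳 | 𝒳.Countable ∧ ModelsGB M 𝒳}

/-! ### Truth predicates -/

/-- The von Neumann natural number `n`. -/
def natCode : ℕ → ZFSet.{u}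
  | 0 => ∅
  | n + 1 => insert (natCode n) (natCode n)

/-- The code of a formula, a hereditarily finite set. -/
def ClassFormula.code : {n k : ℕ} → ClassFormula n k → ZFSet.{u}
  | _, _, .mem i j => ZFSet.pair (natCode 0) (ZFSet.pair (natCode i) (natCode j))
  | _, _, .eq i j => ZFSet.pair (natCode 1) (ZFSet.pair (natCode i) (natCode j))
  | _, _, .memC i j => ZFSet.pair (natCode 2) (ZFSet.pair (natCode i) (natCode j))
  | _, _, .neg φ => ZFSet.pair (natCode 3) φ.code
  | _, _, .and φ ψ => ZFSet.pair (natCode 4) (ZFSet.pair φ.code ψ.code)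
  | _, _, .all φ => ZFSet.pair (natCode 5) φ.code
  | _, _, .allC φ => ZFSet.pair (natCode 6) φ.code

/-- The finite sequence `(a 0, …, a (n - 1))` as a set: the function `i ↦ a i` on the von Neumann
natural number `n`. -/
noncomputable def seqCode {n : ℕ} (a : Fin n → ZFSet.{u}) : ZFSet.{u} :=
  ZFSet.range fun i : Fin n => ZFSet.pair (natCode i) (a i)

/-- `Tr(A)`, the truth predicate of `(M, ∈, A)`: the class of all pairs `(⌜φ⌝, a)` such that `φ` is
a first-order formula in `∈` and one unary predicate symbol, `a` is a finite sequence of elements of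
`M` interpreting the free variables of `φ`, and `(M, ∈, A) ⊨ φ(a)`. -/
def truthPredicate (M : ZFSet.{u}) (A : Set ZFSet.{u}) : Set ZFSet.{u} :=
  {z | ∃ (n : ℕ) (φ : ClassFormula n 1) (a : Fin n → ZFSet.{u}), φ.IsElementary ∧
    (∀ i, a i ∈ M) ∧ z = ZFSet.pair φ.code (seqCode a) ∧ SatSet M φ a (fun _ => A)}

/-- `A` is definable over `(M, ∈)` by a first-order formula without parameters. -/
def IsParameterFreeDefinable (M : ZFSet.{u}) (A : Set ZFSet.{u}) : Prop :=
  ∃ φ : ClassFormula 1 0, φ.IsElementary ∧ A = {z | z ∈ M ∧ SatSet M φ (fun _ => z) Fin.elim0}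

/-! ### Modal logic of potentialist systems -/

/-- Propositional modal formulas. -/
inductive ModalFormula : Type
  | var (p : ℕ) : ModalFormula
  | neg (φ : ModalFormula) : ModalFormula
  | imp (φ ψ : ModalFormula) : ModalFormula
  | box (φ : ModalFormula) : ModalFormula

namespace ModalFormula

def dia (φ : ModalFormula) : ModalFormula := neg (box (neg φ))

/-- The `.2` axiom `◇□p → □◇p`. -/
def dotTwo : ModalFormula := imp (dia (box (var 0))) (box (dia (var 0)))

end ModalFormula

/-- An assertion of class theory (with arbitrary set and class quantifiers) about parameters from
`P`: a formula without free set variables whose free class variables are interpreted by classes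
in `P`. If `P` is empty, this is a sentence of class theory. -/
structure Assertion (P : Set (Set ZFSet.{u})) where
  arity : ℕ
  formula : ClassFormula 0 arity
  param : Fin arity → Set ZFSet.{u}
  param_mem : ∀ i, param i ∈ P

/-- Truth of a propositional modal formula at a world `𝒳` of the class potentialist system `𝔄`
over `M`, where the assertions `σ p` are substituted for the propositional variables `p`. -/
def ModalFormula.HoldsAt (M : ZFSet.{u}) (𝔄 : Set (Set (Set ZFSet.{u})))
    {P : Set (Set ZFSet.{u})} (σ : ℕ → Assertion P) :
    ModalFormula → Set (Set ZFSet.{u}) → Prop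
  | .var p, 𝒳 => (σ p).formula.Realize M 𝒳 Fin.elim0 (σ p).param
  | .neg φ, 𝒳 => ¬ φ.HoldsAt M 𝔄 σ 𝒳
  | .imp φ ψ, 𝒳 => φ.HoldsAt M 𝔄 σ 𝒳 → ψ.HoldsAt M 𝔄 σ 𝒳
  | .box φ, 𝒳 => ∀ 𝒴 ∈ 𝔄, 𝒳 ⊆ 𝒴 → φ.HoldsAt M 𝔄 σ 𝒴

/-- Validity at the world `𝒳`, allowing the classes in `P` as parameters: truth under every
substitution of class-theoretic assertions for the propositional variables. -/
def ModalFormula.ValidAt (M : ZFSet.{u}) (𝔄 : Set (Set (Set ZFSet.{u})))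
    (P : Set (Set ZFSet.{u})) (𝒳 : Set (Set ZFSet.{u})) (φ : ModalFormula) : Prop :=
  ∀ σ : ℕ → Assertion P, φ.HoldsAt M 𝔄 σ 𝒳

end ClassPotentialism

/-! Write `T` for Tr(A), and let p be the assertion that a truth predicate relative to A exists. A
class satisfying the Tarskian clauses is unique (`isTruth_iff`), so p holds exactly in the worlds
that contain `T`. It persists upwards, and 𝒴 witnesses ◇□p at 𝒳. The work lies in finding a world 𝒵
above 𝒳 none of whose extensions contains `T`.

Let F(y) be the least rank of a counterexample to the universal statement, with its parameters, that
is coded by y (`witnessRank`). No class function G of 𝒳 bounds F everywhere. Otherwise, by the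
Tarski–Vaught test, every closure point β of G would give an elementary submodel V_β of (M, ∈, A).
Its truth predicate is a set of M, because `T` belongs to 𝒴 and so meets sets in sets. Gluing these
sets together would define `T` from A and G inside 𝒳 (`truthPredicate_mem_of_bound`).

Now force over 𝒳 with the functions in M from an ordinal to M. Given a condition p and a dense open
class D, map y to the least length of an extension in D of p followed by the entry y. This is a
function of 𝒳, so at some y it lies below F(y). Extend into D accordingly and pad the result to
length exactly F(y) (`IsCond.exists_coding`). Treating the countably many dense open classes in turn
yields a generic class C and lengths α₀ = 0, α₍ₙ₊₁₎ = F(C(αₙ)) that are cofinal in the ordinals of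
M. A world containing C and `T` would contain the map α ↦ F(C(α)), and a closure point of that map
would bound all αₙ (`IsGenericSeq.not_mem_world`).

It remains to see that the classes definable from C and 𝒳 form a world. Forcing adds no sets, so no
names are needed, and replacement follows from distributivity (`isDense_forall`). Without global
choice, descending sequences of conditions cannot simply be chosen. Ranks are used to confine the
candidates to one set, a choice function of M picks among them, and the construction stops at an
ordinal too long for any strictly increasing chain of subsets of the index set.

All appeals to comprehension require elementary formulas. The classes `Df`, `Tm` and `Cl` are closed
under the usual constructions, so that instance search produces these formulas. -/

namespace ClassPotentialism

open ZFSet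

/-! ### Definable relations -/

/-- Satisfaction of elementary formulas does not depend on the domain of classes. -/
theorem ClassFormula.IsElementary.realize_iff_satSet {M : ZFSet.{u}} {𝒳 : Set (Set ZFSet.{u})} :
    ∀ {n k : ℕ} {φ : ClassFormula n k}, φ.IsElementary →
      ∀ (a : Fin n → ZFSet.{u}) (A : Fin k → Set ZFSet.{u}),
        φ.Realize M 𝒳 a A ↔ SatSet M φ a A
  | _, _, .mem _ _, _, _, _ => Iff.rfl
  | _, _, .eq _ _, _, _, _ => Iff.rfl
  | _, _, .memC _ _, _, _, _ => Iff.rfl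
  | _, _, .neg φ, h, a, A => not_congr (realize_iff_satSet (φ := φ) h a A)
  | _, _, .and φ ψ, h, a, A =>
    and_congr (realize_iff_satSet (φ := φ) h.1 a A) (realize_iff_satSet (φ := ψ) h.2 a A)
  | _, _, .all φ, h, _, A =>
    forall₂_congr fun _ _ => realize_iff_satSet (φ := φ) h _ A
  | _, _, .allC _, h, _, _ => h.elim

/-- The environment `e` with `x` pushed in front. -/
def envCons (x : ZFSet.{u}) (e : ℕ → ZFSet.{u}) : ℕ → ZFSet.{u}
  | 0 => x
  | i + 1 => e i

theorem envCons_mem {M x : ZFSet.{u}} {e : ℕ → ZFSet.{u}} (hx : x ∈ M) (he : ∀ i, e i ∈ M) :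
    ∀ i, envCons x e i ∈ M
  | 0 => hx
  | i + 1 => he i

/-- A relation on environments of set variables (de Bruijn indexed) and class variables is
definable over `M`, uniformly for the class environments in `𝒮`, if it is expressed by an
elementary formula. -/
class Df (M : ZFSet.{u}) (𝒮 : Set (ℕ → Set ZFSet.{u}))
    (R : (ℕ → Set ZFSet.{u}) → (ℕ → ZFSet.{u}) → Prop) : Prop where
  -- Quantifiers bind the last variable, so de Bruijn index `i` is the variable `n - 1 - i`. A
  -- formula in every large context is demanded so that relations with different bounds can be
  -- combined and a quantifier can pass from `n` to `n + 1`.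
  out : ∃ N, ∀ n ≥ N, ∀ k ≥ N, ∃ φ : ClassFormula n k, φ.IsElementary ∧
    ∀ S ∈ 𝒮, ∀ e : ℕ → ZFSet.{u}, (∀ i, e i ∈ M) →
      (R S e ↔ SatSet M φ (fun i => e (n - 1 - i)) fun j => S j)

/-- A definable function of the environment, with values in `M`. -/
class Tm (M : ZFSet.{u}) (𝒮 : Set (ℕ → Set ZFSet.{u}))
    (f : (ℕ → Set ZFSet.{u}) → (ℕ → ZFSet.{u}) → ZFSet.{u}) : Prop where
  mem : ∀ S ∈ 𝒮, ∀ e : ℕ → ZFSet.{u}, (∀ i, e i ∈ M) → f S e ∈ M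
  graph : Df M 𝒮 fun S e => e 0 = f S fun i => e (i + 1)

/-- A class that is definable from the environment. -/
class Cl (M : ZFSet.{u}) (𝒮 : Set (ℕ → Set ZFSet.{u}))
    (B : (ℕ → Set ZFSet.{u}) → (ℕ → ZFSet.{u}) → Set ZFSet.{u}) : Prop where
  out : Df M 𝒮 fun S e => e 0 ∈ B S fun i => e (i + 1)

/-- `M` is a transitive model of `ZFC`. -/
class TransModel (M : ZFSet.{u}) : Prop where
  trans : M.IsTransitive
  zfc : ModelsZFC M

section Framework

variable {M : ZFSet.{u}} {𝒮 : Set (ℕ → Set ZFSet.{u})}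

/-- Equivalence is required only for environments in `M`. This allows an external notion to be
replaced by its description relativised to `M`. -/
theorem Df.congr {R R' : (ℕ → Set ZFSet.{u}) → (ℕ → ZFSet.{u}) → Prop} (h : Df M 𝒮 R)
    (hR : ∀ S ∈ 𝒮, ∀ e : ℕ → ZFSet.{u}, (∀ i, e i ∈ M) → (R' S e ↔ R S e)) : Df M 𝒮 R' := by
  obtain ⟨N, h⟩ := h
  refine ⟨N, fun n hn k hk => ?_⟩
  obtain ⟨φ, h1, h2⟩ := h n hn k hk
  exact ⟨φ, h1, fun S hS e he => (hR S hS e he).trans (h2 S hS e he)⟩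

theorem Df.var_mem (i j : ℕ) : Df M 𝒮 fun _ e => e i ∈ e j := by
  refine ⟨i + j + 1, fun n hn k _ =>
    ⟨.mem ⟨n - 1 - i, by omega⟩ ⟨n - 1 - j, by omega⟩, by simp [ClassFormula.IsElementary],
      fun S _ e _ => ?_⟩⟩
  simp only [SatSet, ClassFormula.Realize]
  rw [show n - 1 - (n - 1 - i) = i by omega, show n - 1 - (n - 1 - j) = j by omega]

theorem Df.var_eq (i j : ℕ) : Df M 𝒮 fun _ e => e i = e j := by
  refine ⟨i + j + 1, fun n hn k _ =>
    ⟨.eq ⟨n - 1 - i, by omega⟩ ⟨n - 1 - j, by omega⟩, by simp [ClassFormula.IsElementary],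
      fun S _ e _ => ?_⟩⟩
  simp only [SatSet, ClassFormula.Realize]
  rw [show n - 1 - (n - 1 - i) = i by omega, show n - 1 - (n - 1 - j) = j by omega]

theorem Df.var_memC (i j : ℕ) : Df M 𝒮 fun S e => e i ∈ S j := by
  refine ⟨i + j + 1, fun n hn k hk =>
    ⟨.memC ⟨n - 1 - i, by omega⟩ ⟨j, by omega⟩, by simp [ClassFormula.IsElementary],
      fun S _ e _ => ?_⟩⟩
  simp only [SatSet, ClassFormula.Realize]
  rw [show n - 1 - (n - 1 - i) = i by omega]

variable {P Q : (ℕ → Set ZFSet.{u}) → (ℕ → ZFSet.{u}) → Prop}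
  {R : (ℕ → Set ZFSet.{u}) → (ℕ → ZFSet.{u}) → ZFSet.{u} → Prop}

instance Df.not [h : Df M 𝒮 P] : Df M 𝒮 fun S e => ¬ P S e := by
  obtain ⟨N, h⟩ := h
  refine ⟨N, fun n hn k hk => ?_⟩
  obtain ⟨φ, h1, h2⟩ := h n hn k hk
  exact ⟨.neg φ, h1, fun S hS e he => not_congr (h2 S hS e he)⟩

instance Df.and [h : Df M 𝒮 P] [h' : Df M 𝒮 Q] : Df M 𝒮 fun S e => P S e ∧ Q S e := by
  obtain ⟨N, h⟩ := h
  obtain ⟨N', h'⟩ := h'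
  refine ⟨max N N', fun n hn k hk => ?_⟩
  obtain ⟨φ, h1, h2⟩ := h n (le_of_max_le_left hn) k (le_of_max_le_left hk)
  obtain ⟨ψ, h1', h2'⟩ := h' n (le_of_max_le_right hn) k (le_of_max_le_right hk)
  exact ⟨.and φ ψ, ⟨h1, h1'⟩, fun S hS e he => and_congr (h2 S hS e he) (h2' S hS e he)⟩

instance Df.or [h : Df M 𝒮 P] [h' : Df M 𝒮 Q] : Df M 𝒮 fun S e => P S e ∨ Q S e :=
  (inferInstance : Df M 𝒮 fun S e => ¬ (¬ P S e ∧ ¬ Q S e)).congr fun _ _ _ _ => by tauto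

instance Df.imp [h : Df M 𝒮 P] [h' : Df M 𝒮 Q] : Df M 𝒮 fun S e => P S e → Q S e :=
  (inferInstance : Df M 𝒮 fun S e => ¬ (P S e ∧ ¬ Q S e)).congr fun _ _ _ _ => by tauto

instance Df.iff [h : Df M 𝒮 P] [h' : Df M 𝒮 Q] : Df M 𝒮 fun S e => P S e ↔ Q S e :=
  (inferInstance : Df M 𝒮 fun S e => (P S e → Q S e) ∧ (Q S e → P S e)).congr
    fun _ _ _ _ => by tauto

instance Df.const (p : Prop) : Df M 𝒮 fun _ _ => p := by
  by_cases hp : p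
  · exact (Df.var_eq 0 0).congr fun _ _ _ _ => by simp [hp]
  · have := Df.var_eq (M := M) (𝒮 := 𝒮) 0 0
    exact (inferInstance : Df M 𝒮 fun _ e => ¬ e 0 = e 0).congr fun _ _ _ _ => by simp [hp]

instance Df.all [h : Df M 𝒮 fun S e => R S (fun i => e (i + 1)) (e 0)] :
    Df M 𝒮 fun S e => ∀ x ∈ M, R S e x := by
  obtain ⟨N, h⟩ := h
  refine ⟨N, fun n hn k hk => ?_⟩
  obtain ⟨φ, h1, h2⟩ := h (n + 1) (by omega) k hk
  refine ⟨.all φ, h1, fun S hS e he => forall₂_congr fun x hx => ?_⟩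
  refine (h2 S hS (envCons x e) (envCons_mem hx he)).trans ?_
  refine iff_of_eq (congrArg (SatSet M φ · _) (funext fun i => ?_))
  refine Fin.lastCases ?_ (fun i => ?_) i
  · simp [envCons]
  · have hi := i.2
    simp only [Fin.snoc_castSucc, Fin.val_castSucc]
    rw [show n + 1 - 1 - (i : ℕ) = (n - 1 - i) + 1 by omega]
    rfl

instance Df.ex [h : Df M 𝒮 fun S e => R S (fun i => e (i + 1)) (e 0)] :
    Df M 𝒮 fun S e => ∃ x ∈ M, R S e x :=
  (inferInstance : Df M 𝒮 fun S e => ¬ ∀ x ∈ M, ¬ R S e x).congr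
    fun _ _ _ _ => by push Not; rfl

/-- A formula under a renaming of its variables is definable. -/
theorem Df.satSet_rename : ∀ {n k : ℕ} {φ : ClassFormula n k}, φ.IsElementary → ∀ ρ : Fin n → ℕ,
    Df M 𝒮 fun S e => SatSet M φ (fun i => e (ρ i)) fun j => S j
  | _, _, .mem i j, _, ρ => Df.var_mem (ρ i) (ρ j)
  | _, _, .eq i j, _, ρ => Df.var_eq (ρ i) (ρ j)
  | _, _, .memC i j, _, ρ => Df.var_memC (ρ i) j
  | _, _, .neg φ, h, ρ => @Df.not _ _ _ (satSet_rename (φ := φ) h ρ)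
  | _, _, .and φ ψ, h, ρ =>
    @Df.and _ _ _ _ (satSet_rename (φ := φ) h.1 ρ) (satSet_rename (φ := ψ) h.2 ρ)
  | n, _, .all φ, h, ρ => by
    refine @Df.all _ _ (fun S e x => SatSet M φ (Fin.snoc (α := fun _ => ZFSet.{u})
      (fun i => e (ρ i)) x) fun j => S j) ?_
    refine (satSet_rename (φ := φ) h
      (Fin.snoc (α := fun _ => ℕ) (fun i => ρ i + 1) 0)).congr fun S _ e _ => ?_
    refine iff_of_eq (congrArg (SatSet M φ · _) (funext fun i => ?_))
    refine Fin.lastCases ?_ (fun i => ?_) i <;> simp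
  | _, _, .allC _, h, _ => h.elim

/-- A formula in the smallest context mentions only finitely many indices, and renaming them may
duplicate, permute or shift variables freely. -/
theorem Df.rename (h : Df M 𝒮 P) (ρ : ℕ → ℕ) : Df M 𝒮 fun S e => P S fun i => e (ρ i) := by
  obtain ⟨N, h⟩ := h
  obtain ⟨φ, h1, h2⟩ := h N le_rfl N le_rfl
  exact (Df.satSet_rename h1 fun i => ρ (N - 1 - i)).congr
    fun S hS e he => h2 S hS (fun i => e (ρ i)) fun i => he _

end Framework

/-! ### Definable functions and classes, and their substitution -/

section Framework

variable {M : ZFSet.{u}} {𝒮 : Set (ℕ → Set ZFSet.{u})}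
  {P : (ℕ → Set ZFSet.{u}) → (ℕ → ZFSet.{u}) → Prop}
  {R : (ℕ → Set ZFSet.{u}) → (ℕ → ZFSet.{u}) → ZFSet.{u} → Prop}
  {f g h : (ℕ → Set ZFSet.{u}) → (ℕ → ZFSet.{u}) → ZFSet.{u}}
  {B : (ℕ → Set ZFSet.{u}) → (ℕ → ZFSet.{u}) → Set ZFSet.{u}}

instance Tm.var (i : ℕ) : Tm M 𝒮 fun _ e => e i :=
  ⟨fun _ _ _ he => he i, Df.var_eq 0 (i + 1)⟩

theorem Tm.rename (hf : Tm M 𝒮 f) (ρ : ℕ → ℕ) : Tm M 𝒮 fun S e => f S fun i => e (ρ i) :=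
  ⟨fun S hS e he => hf.mem S hS (fun i => e (ρ i)) fun _ => he _,
    hf.graph.rename fun i => Nat.casesOn i 0 fun i => ρ i + 1⟩

theorem Cl.rename (hB : Cl M 𝒮 B) (ρ : ℕ → ℕ) : Cl M 𝒮 fun S e => B S fun i => e (ρ i) :=
  ⟨hB.out.rename fun i => Nat.casesOn i 0 fun i => ρ i + 1⟩

/-- The value is introduced by an existential quantifier over `M`, which is why a `Tm` must take its
values in `M` and have a definable graph. -/
theorem Df.subst (hf : Tm M 𝒮 f) (hR : Df M 𝒮 fun S e => R S (fun i => e (i + 1)) (e 0)) :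
    Df M 𝒮 fun S e => R S e (f S e) := by
  have := hf.graph
  refine (Df.ex (R := fun S e x => x = f S e ∧ R S e x)).congr fun S hS e he => ?_
  constructor
  · exact fun h => ⟨_, hf.mem S hS e he, rfl, h⟩
  · rintro ⟨_, _, rfl, h⟩
    exact h

theorem Df.subst₁ {Q : (ℕ → Set ZFSet.{u}) → ZFSet.{u} → Prop}
    (hQ : Df M 𝒮 fun S e => Q S (e 0)) (hf : Tm M 𝒮 f) : Df M 𝒮 fun S e => Q S (f S e) :=
  Df.subst (R := fun S _ x => Q S x) hf hQ

theorem Df.subst₂ {Q : (ℕ → Set ZFSet.{u}) → ZFSet.{u} → ZFSet.{u} → Prop}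
    (hQ : Df M 𝒮 fun S e => Q S (e 0) (e 1)) (hf : Tm M 𝒮 f) (hg : Tm M 𝒮 g) :
    Df M 𝒮 fun S e => Q S (f S e) (g S e) :=
  Df.subst (R := fun S e x => Q S x (g S e)) hf <|
    Df.subst (R := fun S e x => Q S (e 0) x) (hg.rename _)
      (hQ.rename fun i => Nat.casesOn i 1 fun _ => 0)

theorem Df.subst₃ {Q : (ℕ → Set ZFSet.{u}) → ZFSet.{u} → ZFSet.{u} → ZFSet.{u} → Prop}
    (hQ : Df M 𝒮 fun S e => Q S (e 0) (e 1) (e 2)) (hf : Tm M 𝒮 f) (hg : Tm M 𝒮 g)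
    (hh : Tm M 𝒮 h) : Df M 𝒮 fun S e => Q S (f S e) (g S e) (h S e) :=
  Df.subst (R := fun S e x => Q S x (g S e) (h S e)) hf <|
    Df.subst (R := fun S e x => Q S (e 0) x (h S fun i => e (i + 1))) (hg.rename _) <|
      Df.subst (R := fun S e x => Q S (e 1) (e 0) x) ((hh.rename _).rename _)
      (hQ.rename fun i => Nat.casesOn i 2 fun i => Nat.casesOn i 1 fun _ => 0)

theorem Tm.subst₁ {t : ZFSet.{u} → ZFSet.{u}} (ht : Tm M 𝒮 fun _ e => t (e 0)) (hf : Tm M 𝒮 f) :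
    Tm M 𝒮 fun S e => t (f S e) :=
  ⟨fun S hS e he => ht.mem S hS (fun _ => f S e) fun _ => hf.mem S hS e he,
    Df.subst₂ (Q := fun _ x y => x = t y) ht.graph (Tm.var 0) (hf.rename _)⟩

theorem Tm.subst₂ {t : ZFSet.{u} → ZFSet.{u} → ZFSet.{u}}
    (ht : Tm M 𝒮 fun _ e => t (e 0) (e 1)) (hf : Tm M 𝒮 f) (hg : Tm M 𝒮 g) :
    Tm M 𝒮 fun S e => t (f S e) (g S e) :=
  ⟨fun S hS e he => ht.mem S hS (fun i => Nat.casesOn i (f S e) fun _ => g S e)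
      (by rintro (_ | i); exacts [hf.mem S hS e he, hg.mem S hS e he]),
    Df.subst₃ (Q := fun _ x y z => x = t y z) ht.graph (Tm.var 0) (hf.rename _) (hg.rename _)⟩

instance Df.mem [hf : Tm M 𝒮 f] [hg : Tm M 𝒮 g] : Df M 𝒮 fun S e => f S e ∈ g S e :=
  Df.subst₂ (Q := fun _ x y => x ∈ y) (Df.var_mem 0 1) hf hg

instance Df.eq [hf : Tm M 𝒮 f] [hg : Tm M 𝒮 g] : Df M 𝒮 fun S e => f S e = g S e :=
  Df.subst₂ (Q := fun _ x y => x = y) (Df.var_eq 0 1) hf hg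

instance Df.memC [hf : Tm M 𝒮 f] [hB : Cl M 𝒮 B] : Df M 𝒮 fun S e => f S e ∈ B S e :=
  Df.subst (R := fun S e x => x ∈ B S e) hf hB.out

instance Cl.var (j : ℕ) : Cl M 𝒮 fun S _ => S j := ⟨Df.var_memC 0 j⟩

instance Cl.setOf [hR : Df M 𝒮 fun S e => R S (fun i => e (i + 1)) (e 0)] :
    Cl M 𝒮 fun S e => {x | R S e x} := ⟨hR⟩

instance Cl.coe [hf : Tm M 𝒮 f] : Cl M 𝒮 fun S e => (f S e : Set ZFSet.{u}) :=
  ⟨@Df.mem _ _ _ _ (Tm.var 0) (hf.rename _)⟩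

instance Cl.univ : Cl M 𝒮 fun _ _ => (M : Set ZFSet.{u}) :=
  ⟨(Df.const True).congr fun _ _ _ he => by simpa using he 0⟩

instance Df.mem_univ [hf : Tm M 𝒮 f] : Df M 𝒮 fun S e => f S e ∈ M :=
  (Df.const True).congr fun S hS e he => by simpa using hf.mem S hS e he

/-- Substituting definable functions and definable classes for the variables of a formula. -/
theorem Df.satSet_subst :
    ∀ {n k : ℕ} {φ : ClassFormula n k}, φ.IsElementary →
      ∀ {t : Fin n → (ℕ → Set ZFSet.{u}) → (ℕ → ZFSet.{u}) → ZFSet.{u}}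
        {C : Fin k → (ℕ → Set ZFSet.{u}) → (ℕ → ZFSet.{u}) → Set ZFSet.{u}},
        (∀ i, Tm M 𝒮 (t i)) → (∀ j, Cl M 𝒮 (C j)) →
        Df M 𝒮 fun S e => SatSet M φ (fun i => t i S e) fun j => C j S e
  | _, _, .mem i j, _, _, _, ht, _ => @Df.mem _ _ _ _ (ht i) (ht j)
  | _, _, .eq i j, _, _, _, ht, _ => @Df.eq _ _ _ _ (ht i) (ht j)
  | _, _, .memC i j, _, _, _, ht, hC => @Df.memC _ _ _ _ (ht i) (hC j)
  | _, _, .neg φ, h, _, _, ht, hC => @Df.not _ _ _ (satSet_subst (φ := φ) h ht hC)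
  | _, _, .and φ ψ, h, _, _, ht, hC =>
    @Df.and _ _ _ _ (satSet_subst (φ := φ) h.1 ht hC) (satSet_subst (φ := ψ) h.2 ht hC)
  | n, _, .all φ, h, t, C, ht, hC => by
    refine @Df.all _ _ (fun S e x => SatSet M φ (Fin.snoc (α := fun _ => ZFSet.{u})
      (fun i => t i S e) x) fun j => C j S e) ?_
    refine (satSet_subst (φ := φ) h (t := Fin.snoc
      (α := fun _ => (ℕ → Set ZFSet.{u}) → (ℕ → ZFSet.{u}) → ZFSet.{u})
      (fun i S e => t i S fun i => e (i + 1)) fun _ e => e 0)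
      (C := fun j S e => C j S fun i => e (i + 1)) ?_ fun j => (hC j).rename _).congr
      fun S _ e _ => ?_
    · refine Fin.lastCases ?_ fun i => ?_
      · simpa using Tm.var 0
      · simpa using (ht i).rename _
    · refine iff_of_eq (congrArg (SatSet M φ · _) (funext fun i => ?_))
      refine Fin.lastCases ?_ (fun i => ?_) i <;> simp
  | _, _, .allC _, h, _, _, _, _ => h.elim

/-- Substituting definable classes for the class variables of a definable relation. -/
theorem Df.substC {C : ℕ → (ℕ → Set ZFSet.{u}) → (ℕ → ZFSet.{u}) → Set ZFSet.{u}}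
    (hP : Df M Set.univ P) (hC : ∀ j, Cl M 𝒮 (C j)) : Df M 𝒮 fun S e => P (fun j => C j S e) e := by
  obtain ⟨N, h⟩ := hP
  obtain ⟨φ, h1, h2⟩ := h N le_rfl N le_rfl
  exact (Df.satSet_subst h1 (t := fun i _ e => e (N - 1 - i)) (C := fun j => C j)
    (fun _ => Tm.var _) fun j => hC j).congr fun S _ e he => h2 _ trivial _ he

end Framework

/-! ### Elementary closure properties of transitive models -/

section TransModel

variable {M : ZFSet.{u}} [hM : TransModel M] {x y z : ZFSet.{u}}

theorem mem_of_mem_model (hx : x ∈ y) (hy : y ∈ M) : x ∈ M := hM.trans.mem_trans hx hy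

theorem empty_mem_model : ∅ ∈ M := by
  obtain ⟨w, _, ⟨e, he, _, h⟩, _⟩ := hM.zfc.infinity
  convert! he
  ext z
  simpa using fun hz => h z (mem_of_mem_model hz he) hz

theorem upair_mem_model (hx : x ∈ M) (hy : y ∈ M) : ({x, y} : ZFSet) ∈ M := by
  obtain ⟨p, hp, h⟩ := hM.zfc.pairing x hx y hy
  convert! hp
  ext z
  rw [ZFSet.mem_pair]
  constructor
  · intro hz
    exact (h z (by rcases hz with rfl | rfl <;> assumption)).2 hz
  · exact fun hz => (h z (mem_of_mem_model hz hp)).1 hz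

theorem singleton_mem_model (hx : x ∈ M) : ({x} : ZFSet) ∈ M := by
  simpa using upair_mem_model hx hx

theorem sUnion_mem_model (hx : x ∈ M) : (⋃₀ x : ZFSet) ∈ M := by
  obtain ⟨w, hw, h⟩ := hM.zfc.union x hx
  convert! hw
  ext z
  rw [mem_sUnion]
  constructor
  · rintro ⟨y, hy, hz⟩
    have hyM := mem_of_mem_model hy hx
    exact (h z (mem_of_mem_model hz hyM)).2 ⟨y, hyM, hy, hz⟩
  · intro hz
    obtain ⟨y, _, hy⟩ := (h z (mem_of_mem_model hz hw)).1 hz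
    exact ⟨y, hy⟩

theorem union_mem_model (hx : x ∈ M) (hy : y ∈ M) : x ∪ y ∈ M := by
  rw [← sUnion_pair]
  exact sUnion_mem_model (upair_mem_model hx hy)

theorem insert_mem_model (hx : x ∈ M) (hy : y ∈ M) : insert x y ∈ M := by
  rw [insert_eq]
  exact union_mem_model (singleton_mem_model hx) hy

theorem pair_mem_model (hx : x ∈ M) (hy : y ∈ M) : pair x y ∈ M :=
  upair_mem_model (singleton_mem_model hx) (upair_mem_model hx hy)

theorem of_pair_mem_model (h : pair x y ∈ M) : x ∈ M ∧ y ∈ M := by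
  have h1 : ({x, y} : ZFSet) ∈ M := mem_of_mem_model (y := pair x y) (by simp [pair]) h
  exact ⟨mem_of_mem_model (by simp) h1, mem_of_mem_model (y := {x, y}) (by simp) h1⟩

theorem natCode_mem_model : ∀ n, natCode n ∈ M
  | 0 => empty_mem_model
  | n + 1 => insert_mem_model (natCode_mem_model n) (natCode_mem_model n)

/-- The power set as computed in `M` consists only of the subsets that belong to `M`, hence the
intersection. -/
theorem exists_powerset_mem_model (hx : x ∈ M) : x.powerset ∩ M ∈ M := by
  obtain ⟨p, hp, h⟩ := hM.zfc.powerset x hx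
  convert! hp
  ext z
  rw [ZFSet.mem_inter, mem_powerset]
  constructor
  · exact fun ⟨hz, hzM⟩ => (h z hzM).2 fun y _ hy => hz hy
  · intro hz
    have hzM := mem_of_mem_model hz hp
    exact ⟨fun y hy => (h z hzM).1 hz y (mem_of_mem_model hy hzM) hy, hzM⟩

variable {𝒮 : Set (ℕ → Set ZFSet.{u})} {f g : (ℕ → Set ZFSet.{u}) → (ℕ → ZFSet.{u}) → ZFSet.{u}}
  {R : (ℕ → Set ZFSet.{u}) → (ℕ → ZFSet.{u}) → ZFSet.{u} → Prop}

instance Df.ball [hf : Tm M 𝒮 f] [hR : Df M 𝒮 fun S e => R S (fun i => e (i + 1)) (e 0)] :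
    Df M 𝒮 fun S e => ∀ x ∈ f S e, R S e x := by
  have := @Df.mem M 𝒮 (fun _ e => e 0) _ _ (hf.rename fun i => i + 1)
  exact (inferInstance : Df M 𝒮 fun S e => ∀ x ∈ M, x ∈ f S e → R S e x).congr
    fun S hS e he => ⟨fun h x _ hx => h x hx, fun h x hx =>
      h x (mem_of_mem_model hx (hf.mem S hS e he)) hx⟩

instance Df.bex [hf : Tm M 𝒮 f] [hR : Df M 𝒮 fun S e => R S (fun i => e (i + 1)) (e 0)] :
    Df M 𝒮 fun S e => ∃ x ∈ f S e, R S e x := by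
  have := @Df.mem M 𝒮 (fun _ e => e 0) _ _ (hf.rename fun i => i + 1)
  exact (inferInstance : Df M 𝒮 fun S e => ∃ x ∈ M, x ∈ f S e ∧ R S e x).congr
    fun S hS e he => ⟨fun ⟨x, hx, h⟩ => ⟨x, mem_of_mem_model hx (hf.mem S hS e he), hx, h⟩,
      fun ⟨x, _, h⟩ => ⟨x, h⟩⟩

/-- A function is definable if membership in its values is. -/
theorem Tm.of_mem_iff (h1 : ∀ S ∈ 𝒮, ∀ e : ℕ → ZFSet.{u}, (∀ i, e i ∈ M) → f S e ∈ M)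
    (h2 : Df M 𝒮 fun S e => R S (fun i => e (i + 1)) (e 0))
    (hR : ∀ S ∈ 𝒮, ∀ e : ℕ → ZFSet.{u}, (∀ i, e i ∈ M) → ∀ x ∈ M, x ∈ f S e ↔ R S e x) :
    Tm M 𝒮 f where
  mem := h1
  graph := by
    have : Df M 𝒮 fun S e => R S (fun i => e (i + 1 + 1)) (e 0) :=
      h2.rename fun i => Nat.casesOn i 0 fun i => i + 2
    refine (inferInstance : Df M 𝒮 fun S e => ∀ x ∈ M, x ∈ e 0 ↔
      R S (fun i => e (i + 1)) x).congr fun S hS e he => ?_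
    have hR' := hR S hS (fun i => e (i + 1)) fun _ => he _
    constructor
    · intro h x hx
      rw [h, hR' x hx]
    · intro h
      ext x
      constructor
      · intro hx
        have hxM := mem_of_mem_model hx (he 0)
        exact (hR' x hxM).2 ((h x hxM).1 hx)
      · intro hx
        have hxM := mem_of_mem_model hx (h1 S hS (fun i => e (i + 1)) fun _ => he _)
        exact (h x hxM).2 ((hR' x hxM).1 hx)

instance Tm.empty : Tm M 𝒮 fun _ _ => (∅ : ZFSet.{u}) :=
  Tm.of_mem_iff (R := fun _ _ _ => False) (fun _ _ _ _ => empty_mem_model) inferInstance (by simp)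

theorem Tm.insert_var : Tm M 𝒮 fun _ e => insert (e 0) (e 1) :=
  Tm.of_mem_iff (R := fun _ e x => x = e 0 ∨ x ∈ e 1)
    (fun _ _ _ he => insert_mem_model (he 0) (he 1)) inferInstance (by simp)

instance Tm.insert [hf : Tm M 𝒮 f] [hg : Tm M 𝒮 g] : Tm M 𝒮 fun S e => insert (f S e) (g S e) :=
  Tm.subst₂ Tm.insert_var hf hg

theorem Tm.singleton_var : Tm M 𝒮 fun _ e => ({e 0} : ZFSet.{u}) :=
  Tm.of_mem_iff (R := fun _ e x => x = e 0)
    (fun _ _ _ he => singleton_mem_model (he 0)) inferInstance (by simp)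

instance Tm.singleton [hf : Tm M 𝒮 f] : Tm M 𝒮 fun S e => ({f S e} : ZFSet.{u}) :=
  Tm.subst₁ (t := fun x => {x}) Tm.singleton_var hf

instance Tm.pair [Tm M 𝒮 f] [Tm M 𝒮 g] : Tm M 𝒮 fun S e => pair (f S e) (g S e) :=
  (inferInstance : Tm M 𝒮 fun S e => ({{f S e}, {f S e, g S e}} : ZFSet.{u}))

theorem Tm.sUnion_var : Tm M 𝒮 fun _ e => (⋃₀ (e 0) : ZFSet.{u}) :=
  Tm.of_mem_iff (R := fun _ e x => ∃ y ∈ e 0, x ∈ y)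
    (fun _ _ _ he => sUnion_mem_model (he 0)) inferInstance (by simp)

instance Tm.sUnion [hf : Tm M 𝒮 f] : Tm M 𝒮 fun S e => (⋃₀ (f S e) : ZFSet.{u}) :=
  Tm.subst₁ (t := fun x => ⋃₀ x) Tm.sUnion_var hf

instance Tm.union [Tm M 𝒮 f] [Tm M 𝒮 g] : Tm M 𝒮 fun S e => f S e ∪ g S e := by
  simp_rw [← sUnion_pair]
  infer_instance

theorem Tm.powerset_var : Tm M 𝒮 fun _ e => (e 0).powerset ∩ M :=
  Tm.of_mem_iff (R := fun _ e x => ∀ y ∈ x, y ∈ e 0)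
    (fun _ _ _ he => exists_powerset_mem_model (he 0)) inferInstance
    (fun S hS e he x hx => by simp [hx, mem_powerset]; rfl)

instance Tm.powerset [hf : Tm M 𝒮 f] : Tm M 𝒮 fun S e => (f S e).powerset ∩ M :=
  Tm.subst₁ (t := fun x => x.powerset ∩ M) Tm.powerset_var hf

instance Tm.natCode (n : ℕ) : Tm M 𝒮 fun _ _ => natCode n := by
  induction n with
  | zero => exact Tm.empty
  | succ n ih => exact Tm.insert

instance Df.subset [Tm M 𝒮 f] [Tm M 𝒮 g] : Df M 𝒮 fun S e => f S e ⊆ g S e :=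
  Df.subst₂ (Q := fun _ x y => x ⊆ y)
    (inferInstance : Df M 𝒮 fun _ e => ∀ z ∈ e 0, z ∈ e 1) ‹_› ‹_›

instance Df.isOrdinal [Tm M 𝒮 f] : Df M 𝒮 fun S e => (f S e).IsOrdinal :=
  Df.subst₁ (Q := fun _ x => x.IsOrdinal)
    ((inferInstance : Df M 𝒮 fun _ e =>
      (∀ x ∈ e 0, x ⊆ e 0) ∧ ∀ x ∈ e 0, ∀ y ∈ x, y ⊆ x).congr
      fun _ _ _ _ => isOrdinal_iff_forall_mem_isTransitive) ‹_›

end TransModel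

/-! ### Codes of formulas and of finite sequences -/

theorem mem_natCode {x : ZFSet.{u}} : ∀ {n : ℕ}, x ∈ natCode n ↔ ∃ m < n, x = natCode m
  | 0 => by simp [natCode]
  | n + 1 => by
    rw [natCode, mem_insert_iff, mem_natCode]
    constructor
    · rintro (rfl | ⟨m, hm, rfl⟩)
      exacts [⟨n, by omega, rfl⟩, ⟨m, by omega, rfl⟩]
    · rintro ⟨m, hm, rfl⟩
      rcases Nat.lt_succ_iff_lt_or_eq.1 hm with h | rfl
      exacts [Or.inr ⟨m, h, rfl⟩, Or.inl rfl]

theorem natCode_injective : Function.Injective natCode.{u} := by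
  intro m n h
  rcases lt_trichotomy m n with h1 | h1 | h1
  · exact (mem_irrefl (natCode.{u} n) (h ▸ mem_natCode.2 ⟨m, h1, rfl⟩ :)).elim
  · exact h1
  · exact (mem_irrefl (natCode.{u} m) (h.symm ▸ mem_natCode.2 ⟨n, h1, rfl⟩ :)).elim

@[simp] theorem natCode_inj {m n : ℕ} : natCode.{u} m = natCode n ↔ m = n :=
  natCode_injective.eq_iff

/-- Being a natural number is a bounded property. -/
theorem exists_eq_natCode_iff {x : ZFSet.{u}} : (∃ n, x = natCode n) ↔
    (x = ∅ ∨ ∃ y ∈ x, x = insert y y) ∧ ∀ z ∈ x, z = ∅ ∨ ∃ y ∈ z, z = insert y y := by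
  have key : ∀ n, natCode.{u} n = ∅ ∨ ∃ y ∈ natCode n, natCode n = insert y y := by
    rintro (_ | n)
    exacts [Or.inl rfl, Or.inr ⟨natCode n, by simp [natCode], rfl⟩]
  constructor
  · rintro ⟨n, rfl⟩
    refine ⟨key n, fun z hz => ?_⟩
    obtain ⟨m, _, rfl⟩ := mem_natCode.1 hz
    exact key m
  · induction x using ZFSet.inductionOn with
    | h x ih =>
      rintro ⟨rfl | ⟨y, hy, hx⟩, h⟩
      · exact ⟨0, rfl⟩
      · obtain ⟨n, hn⟩ := ih y hy ⟨h y hy, fun z hz => h z (by rw [hx]; simp [hz])⟩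
        exact ⟨n + 1, by rw [hx, hn]; rfl⟩

/-- Both contexts are fixed because a code does not record them: one code may come from formulas
with different numbers of free variables. The length of the assignment later supplies the missing
number. -/
theorem ClassFormula.code_injective {n k : ℕ} {φ ψ : ClassFormula n k}
    (h : φ.code = ψ.code) : φ = ψ := by
  induction φ with
  | mem i j | eq i j | memC i j =>
    cases ψ <;> simp [code, pair_inj, Fin.ext_iff] at h ⊢
    exact h
  | neg φ ih | all φ ih | allC φ ih =>
    cases ψ <;> simp [code, pair_inj] at h ⊢
    exact ih h
  | and φ φ' ih ih' =>
    cases ψ <;> simp [code, pair_inj] at h ⊢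
    exact ⟨ih h.1, ih' h.2⟩

theorem pair_mem_seqCode {n m : ℕ} {a : Fin n → ZFSet.{u}} {x : ZFSet.{u}} :
    pair (natCode m) x ∈ seqCode a ↔ ∃ h : m < n, a ⟨m, h⟩ = x := by
  simp only [seqCode, mem_range, pair_inj, natCode_inj]
  constructor
  · rintro ⟨i, rfl, rfl⟩
    exact ⟨i.2, rfl⟩
  · rintro ⟨h, rfl⟩
    exact ⟨⟨m, h⟩, rfl, rfl⟩

theorem pair_fin_mem_seqCode {n : ℕ} {a : Fin n → ZFSet.{u}} {i : Fin n} {x : ZFSet.{u}} :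
    pair (natCode i) x ∈ seqCode a ↔ a i = x := by
  simp [pair_mem_seqCode]

/-- The length can be read off from the natural numbers that occur as first components. -/
theorem seqCode_length {n m : ℕ} {a : Fin n → ZFSet.{u}} {b : Fin m → ZFSet.{u}}
    (h : seqCode a = seqCode b) : n = m := by
  refine eq_of_forall_lt_iff fun i => ?_
  constructor
  · intro hi
    have := pair_mem_seqCode.2 ⟨hi, (rfl : a ⟨i, hi⟩ = _)⟩
    rw [h] at this
    exact (pair_mem_seqCode.1 this).1
  · intro hi
    have := pair_mem_seqCode.2 ⟨hi, (rfl : b ⟨i, hi⟩ = _)⟩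
    rw [← h] at this
    exact (pair_mem_seqCode.1 this).1

theorem seqCode_injective {n : ℕ} {a b : Fin n → ZFSet.{u}} (h : seqCode a = seqCode b) :
    a = b := by
  funext i
  have := pair_fin_mem_seqCode.2 (rfl : b i = _)
  rw [← h] at this
  exact pair_fin_mem_seqCode.1 this

/-- This matches the way the quantifier clause of `TruthStep` extends an assignment. -/
theorem seqCode_snoc {n : ℕ} (a : Fin n → ZFSet.{u}) (x : ZFSet.{u}) :
    seqCode (Fin.snoc (α := fun _ => ZFSet.{u}) a x) =
      insert (pair (natCode n) x) (seqCode a) := by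
  ext z
  simp only [seqCode, mem_range, mem_insert_iff]
  constructor
  · rintro ⟨i, rfl⟩
    refine Fin.lastCases ?_ (fun i => ?_) i
    · simp
    · right
      exact ⟨i, by simp⟩
  · rintro (rfl | ⟨i, rfl⟩)
    · exact ⟨Fin.last n, by simp⟩
    · exact ⟨i.castSucc, by simp⟩

/-- `s` is a sequence of length `n` of elements of `U`. -/
def IsSeq (U : Set ZFSet.{u}) (n s : ZFSet.{u}) : Prop :=
  ∃ (k : ℕ) (a : Fin k → ZFSet.{u}), n = natCode k ∧ (∀ i, a i ∈ U) ∧ s = seqCode a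

/-- `d` is the code of an elementary formula with `n` free set variables and one class variable. -/
def IsForm (d n : ZFSet.{u}) : Prop :=
  ∃ (k : ℕ) (φ : ClassFormula k 1), n = natCode k ∧ φ.IsElementary ∧ d = φ.code

theorem isForm_natCode {d : ZFSet.{u}} {n : ℕ} :
    IsForm d (natCode n) ↔ ∃ φ : ClassFormula n 1, φ.IsElementary ∧ d = φ.code := by
  constructor
  · rintro ⟨k, φ, h, hφ⟩
    obtain rfl := natCode_injective h
    exact ⟨φ, hφ⟩
  · rintro ⟨φ, hφ⟩
    exact ⟨n, φ, rfl, hφ⟩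

/-- Apart from the clause on natural numbers, the right side quantifies only over `M` and elements
of the given sets, so it makes `IsSeq` definable. -/
theorem isSeq_iff {U : Set ZFSet.{u}} {n s : ZFSet.{u}} {M : ZFSet.{u}} (hU : ∀ x ∈ U, x ∈ M) :
    IsSeq U n s ↔
    (∃ k, n = natCode k) ∧ (∀ t ∈ s, ∃ i ∈ n, ∃ x ∈ M, x ∈ U ∧ t = pair i x) ∧
      (∀ i ∈ n, ∃ x ∈ M, pair i x ∈ s) ∧
        ∀ i ∈ n, ∀ x ∈ M, ∀ y ∈ M, pair i x ∈ s → pair i y ∈ s → x = y := by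
  constructor
  · rintro ⟨k, a, rfl, ha, rfl⟩
    refine ⟨⟨k, rfl⟩, fun t ht => ?_, fun i hi => ?_, fun i hi x _ y _ hx hy => ?_⟩
    · obtain ⟨i, rfl⟩ := mem_range.1 ht
      exact ⟨_, mem_natCode.2 ⟨i, i.2, rfl⟩, a i, hU _ (ha i), ha i, rfl⟩
    · obtain ⟨m, hm, rfl⟩ := mem_natCode.1 hi
      exact ⟨_, hU _ (ha ⟨m, hm⟩), pair_mem_seqCode.2 ⟨hm, rfl⟩⟩
    · obtain ⟨m, hm, rfl⟩ := mem_natCode.1 hi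
      obtain ⟨_, rfl⟩ := pair_mem_seqCode.1 hx
      obtain ⟨_, rfl⟩ := pair_mem_seqCode.1 hy
      rfl
  · rintro ⟨⟨k, rfl⟩, h1, h2, h3⟩
    choose! a haM ha using h2
    have hk : ∀ i : Fin k, natCode.{u} i ∈ natCode k := fun i => mem_natCode.2 ⟨i, i.2, rfl⟩
    have hU' : ∀ i ∈ natCode k, ∀ x, pair i x ∈ s → x ∈ U ∧ x = a i := by
      intro i hi x hx
      obtain ⟨j, _, y, hyM, hy, e⟩ := h1 _ hx
      obtain ⟨rfl, rfl⟩ := pair_inj.1 e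
      exact ⟨hy, h3 i hi _ hyM _ (haM i hi) hx (ha i hi)⟩
    refine ⟨k, fun i => a (natCode i), rfl, fun i => (hU' _ (hk i) _ (ha _ (hk i))).1, ?_⟩
    ext t
    rw [seqCode, mem_range]
    constructor
    · intro ht
      obtain ⟨i, hi, x, _, _, rfl⟩ := h1 t ht
      obtain ⟨m, hm, rfl⟩ := mem_natCode.1 hi
      exact ⟨⟨m, hm⟩, by rw [(hU' _ hi _ ht).2]⟩
    · rintro ⟨i, rfl⟩
      exact ha _ (hk i)

/-- The formation rules for codes `c` of formulas with `n` free set variables, where `w` is the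
set of all pairs `(c, n)` that were obtained before. -/
def FormStep (M w c n : ZFSet.{u}) : Prop :=
  (∃ i ∈ n, ∃ j ∈ n, c = pair (natCode 0) (pair i j)) ∨
  (∃ i ∈ n, ∃ j ∈ n, c = pair (natCode 1) (pair i j)) ∨
  (∃ i ∈ n, c = pair (natCode 2) (pair i (natCode 0))) ∨
  (∃ d ∈ M, c = pair (natCode 3) d ∧ pair d n ∈ w) ∨
  (∃ d ∈ M, ∃ d' ∈ M, c = pair (natCode 4) (pair d d') ∧ pair d n ∈ w ∧ pair d' n ∈ w) ∨
  (∃ d ∈ M, c = pair (natCode 5) d ∧ pair d (insert n n) ∈ w)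

/-- The pairs `(c, n)` in `w` are justified by the formation rules for formulas. -/
def FormClosed (M w : ZFSet.{u}) : Prop :=
  ∀ z ∈ w, ∃ c ∈ M, ∃ n ∈ M, z = pair c n ∧ (∃ k, n = natCode k) ∧ FormStep M w c n

theorem FormStep.mono {M w w' c n : ZFSet.{u}} (hw : w ⊆ w') :
    FormStep M w c n → FormStep M w' c n :=
  Or.imp id <| Or.imp id <| Or.imp id <|
    Or.imp (fun ⟨d, h1, h2, h3⟩ => ⟨d, h1, h2, hw h3⟩) <|
    Or.imp (fun ⟨d, h1, d', h1', h2, h3, h4⟩ => ⟨d, h1, d', h1', h2, hw h3, hw h4⟩)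
      fun ⟨d, h1, h2, h3⟩ => ⟨d, h1, h2, hw h3⟩

theorem FormClosed.insert {M w c n : ZFSet.{u}} (hw : FormClosed M w) (hc : c ∈ M) (hn : n ∈ M)
    (k : ℕ) (hk : n = natCode k) (h : FormStep M w c n) :
    FormClosed M (insert (pair c n) w) := by
  have hsub : w ⊆ Insert.insert (pair c n) w := fun z hz => by simp [hz]
  intro z hz
  rcases mem_insert_iff.1 hz with rfl | hz
  · exact ⟨c, hc, n, hn, rfl, ⟨k, hk⟩, h.mono hsub⟩
  · obtain ⟨c', hc, n', hn, e, hk, h⟩ := hw z hz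
    exact ⟨c', hc, n', hn, e, hk, h.mono hsub⟩

theorem FormClosed.union {M w w' : ZFSet.{u}} (hw : FormClosed M w) (hw' : FormClosed M w') :
    FormClosed M (w ∪ w') := by
  intro z hz
  rcases mem_union.1 hz with hz | hz
  · obtain ⟨c', hc, n', hn, e, hk, h⟩ := hw z hz
    exact ⟨c', hc, n', hn, e, hk, h.mono fun z hz => mem_union.2 (.inl hz)⟩
  · obtain ⟨c', hc, n', hn, e, hk, h⟩ := hw' z hz
    exact ⟨c', hc, n', hn, e, hk, h.mono fun z hz => mem_union.2 (.inr hz)⟩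

theorem rank_lt_rank_pair_left (x y : ZFSet.{u}) : rank x < rank (pair x y) :=
  (rank_lt_of_mem (by simp : x ∈ ({x} : ZFSet))).trans (rank_lt_of_mem (by simp [pair]))

theorem rank_lt_rank_pair_right (x y : ZFSet.{u}) : rank y < rank (pair x y) :=
  (rank_lt_of_mem (by simp : y ∈ ({x, y} : ZFSet))).trans (rank_lt_of_mem (by simp [pair]))

/-- Immediate subformulas have codes of smaller rank, so induction on rank decodes every entry of
`w`. Well-foundedness alone suffices; `w` need not be finite. -/
theorem FormClosed.isForm {M w : ZFSet.{u}} (hw : FormClosed M w) (c : ZFSet.{u}) :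
    ∀ n, pair c n ∈ w → IsForm c n := by
  induction h : rank c using WellFoundedLT.induction generalizing c with
  | ind r ih =>
    subst h
    intro n hcn
    obtain ⟨_, _, _, _, e, ⟨k, hk⟩, hc⟩ := hw _ hcn
    obtain ⟨rfl, rfl⟩ := pair_inj.1 e
    subst hk
    rw [isForm_natCode]
    rcases hc with ⟨i, hi, j, hj, rfl⟩ | ⟨i, hi, j, hj, rfl⟩ | ⟨i, hi, rfl⟩ | ⟨d, -, rfl, hd⟩ |
      ⟨d, -, d', -, rfl, hd, hd'⟩ | ⟨d, -, rfl, hd⟩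
    · obtain ⟨i, hi', rfl⟩ := mem_natCode.1 hi
      obtain ⟨j, hj', rfl⟩ := mem_natCode.1 hj
      exact ⟨.mem ⟨i, hi'⟩ ⟨j, hj'⟩, by simp [ClassFormula.IsElementary], rfl⟩
    · obtain ⟨i, hi', rfl⟩ := mem_natCode.1 hi
      obtain ⟨j, hj', rfl⟩ := mem_natCode.1 hj
      exact ⟨.eq ⟨i, hi'⟩ ⟨j, hj'⟩, by simp [ClassFormula.IsElementary], rfl⟩
    · obtain ⟨i, hi', rfl⟩ := mem_natCode.1 hi
      exact ⟨.memC ⟨i, hi'⟩ 0, by simp [ClassFormula.IsElementary], rfl⟩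
    · obtain ⟨φ, hφ, rfl⟩ := isForm_natCode.1 (ih _ (rank_lt_rank_pair_right _ _) d rfl _ hd)
      exact ⟨.neg φ, hφ, rfl⟩
    · obtain ⟨φ, hφ, rfl⟩ := isForm_natCode.1
        (ih _ ((rank_lt_rank_pair_left _ _).trans (rank_lt_rank_pair_right _ _)) d rfl _ hd)
      obtain ⟨ψ, hψ, rfl⟩ := isForm_natCode.1
        (ih _ ((rank_lt_rank_pair_right _ _).trans (rank_lt_rank_pair_right _ _)) d' rfl _ hd')
      exact ⟨.and φ ψ, ⟨hφ, hψ⟩, rfl⟩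
    · obtain ⟨φ, hφ, rfl⟩ := (isForm_natCode (n := k + 1)).1
        (ih _ (rank_lt_rank_pair_right _ _) d rfl _ hd)
      exact ⟨.all φ, hφ, rfl⟩

/-! ### Codes and formation sequences inside `M` -/

section TransModel

variable {M : ZFSet.{u}} [hM : TransModel M] {𝒮 : Set (ℕ → Set ZFSet.{u})}
  {f g h : (ℕ → Set ZFSet.{u}) → (ℕ → ZFSet.{u}) → ZFSet.{u}}

theorem seqCode_mem_model : ∀ {n : ℕ} {a : Fin n → ZFSet.{u}}, (∀ i, a i ∈ M) → seqCode a ∈ M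
  | 0, a, _ => by
    convert! empty_mem_model (M := M)
    ext z
    simp [seqCode]
  | n + 1, a, h => by
    rw [← Fin.snoc_init_self a, seqCode_snoc]
    exact insert_mem_model (pair_mem_model (natCode_mem_model n) (h _))
      (seqCode_mem_model fun i => h _)

theorem ClassFormula.code_mem_model : ∀ {n k : ℕ} (φ : ClassFormula n k), φ.code ∈ M
  | _, _, .mem _ _ | _, _, .eq _ _ | _, _, .memC _ _ => pair_mem_model (natCode_mem_model _)
      (pair_mem_model (natCode_mem_model _) (natCode_mem_model _))
  | _, _, .neg φ | _, _, .all φ | _, _, .allC φ =>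
      pair_mem_model (natCode_mem_model _) φ.code_mem_model
  | _, _, .and φ ψ => pair_mem_model (natCode_mem_model _)
      (pair_mem_model φ.code_mem_model ψ.code_mem_model)

instance Df.isNat [Tm M 𝒮 f] : Df M 𝒮 fun S e => ∃ n, f S e = natCode n := by
  refine Df.subst₁ (Q := fun _ x => ∃ n, x = natCode n) ?_ ‹_›
  simp_rw [exists_eq_natCode_iff]
  infer_instance

theorem exists_formClosed {n : ℕ} (φ : ClassFormula n 1) : φ.IsElementary →
    ∃ w ∈ M, FormClosed M w ∧ pair φ.code (natCode n) ∈ w := by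
  -- The index 1 is generalised to `k` so that induction on the indexed family of formulas applies.
  suffices H : ∀ {n k : ℕ} (φ : ClassFormula n k), k = 1 → φ.IsElementary →
    ∃ w ∈ M, FormClosed M w ∧ pair φ.code (natCode n) ∈ w from H φ rfl
  have h0 : FormClosed M (∅ : ZFSet.{u}) := by simp [FormClosed]
  have hn : ∀ n, natCode n ∈ M := natCode_mem_model
  have hf : ∀ {n : ℕ} (i : Fin n), natCode i ∈ natCode n := fun i => mem_natCode.2 ⟨i, i.2, rfl⟩
  intro n k φ
  induction φ with
  | @mem n k i j =>
    refine fun _ _ => ⟨_, ?_, h0.insert (ClassFormula.code_mem_model (.mem (k := k) i j)) (hn n) n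
      rfl (.inl ⟨_, hf i, _, hf j, rfl⟩), by simp⟩
    exact insert_mem_model (pair_mem_model (ClassFormula.code_mem_model _) (hn n)) empty_mem_model
  | @eq n k i j =>
    refine fun _ _ => ⟨_, ?_, h0.insert (ClassFormula.code_mem_model (.eq (k := k) i j)) (hn n) n
      rfl (.inr <| .inl ⟨_, hf i, _, hf j, rfl⟩), by simp⟩
    exact insert_mem_model (pair_mem_model (ClassFormula.code_mem_model _) (hn n)) empty_mem_model
  | @memC n k i j =>
    rintro rfl _
    refine ⟨_, ?_, h0.insert (ClassFormula.code_mem_model (.memC i j)) (hn n) n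
      rfl (.inr <| .inr <| .inl ⟨_, hf i, by simp [ClassFormula.code]⟩), by simp⟩
    exact insert_mem_model (pair_mem_model (ClassFormula.code_mem_model _) (hn n)) empty_mem_model
  | @neg n k φ ih =>
    intro hk hφ
    obtain ⟨w, hwM, hw, hm⟩ := ih hk hφ
    refine ⟨_, ?_, hw.insert φ.neg.code_mem_model (hn n) n
      rfl (.inr <| .inr <| .inr <| .inl ⟨_, φ.code_mem_model, rfl, hm⟩), by simp⟩
    exact insert_mem_model (pair_mem_model (ClassFormula.code_mem_model _) (hn n)) hwM
  | @and n k φ ψ ih ih' =>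
    intro hk hφ
    obtain ⟨w, hwM, hw, hm⟩ := ih hk hφ.1
    obtain ⟨w', hwM', hw', hm'⟩ := ih' hk hφ.2
    refine ⟨_, ?_, (hw.union hw').insert (φ.and ψ).code_mem_model (hn n) n
      rfl (.inr <| .inr <| .inr <| .inr <| .inl ⟨_, φ.code_mem_model, _, ψ.code_mem_model, rfl,
        mem_union.2 (.inl hm), mem_union.2 (.inr hm')⟩), by simp⟩
    exact insert_mem_model (pair_mem_model (ClassFormula.code_mem_model _) (hn n))
      (union_mem_model hwM hwM')
  | @all n k φ ih =>
    intro hk hφ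
    obtain ⟨w, hwM, hw, hm⟩ := ih hk hφ
    refine ⟨_, ?_, hw.insert φ.all.code_mem_model (hn n) n
      rfl (.inr <| .inr <| .inr <| .inr <| .inr ⟨_, φ.code_mem_model, rfl, hm⟩), by simp⟩
    exact insert_mem_model (pair_mem_model (ClassFormula.code_mem_model _) (hn n)) hwM
  | allC => exact fun _ h => h.elim

/-- The external quantifier over formulas becomes a quantifier over formation witnesses in `M`; this
is what lets formulas of set theory speak about codes. -/
theorem isForm_iff {d n : ZFSet.{u}} : IsForm d n ↔ ∃ w ∈ M, FormClosed M w ∧ pair d n ∈ w := by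
  constructor
  · rintro ⟨k, φ, rfl, hφ, rfl⟩
    exact exists_formClosed φ hφ
  · rintro ⟨w, _, hw, h⟩
    exact hw.isForm d n h

set_option synthInstance.maxSize 1000 in
set_option synthInstance.maxHeartbeats 400000 in
instance Df.isForm [Tm M 𝒮 f] [Tm M 𝒮 g] : Df M 𝒮 fun S e => IsForm (f S e) (g S e) := by
  refine Df.subst₂ (Q := fun _ x y => IsForm x y) ?_ ‹_› ‹_›
  simp_rw [isForm_iff (M := M), FormClosed, FormStep]
  infer_instance

end TransModel

/-! ### Definability of truth predicates -/

/-- The Tarskian truth conditions for `(c, s)`, where `c` is the code of a formula and `s` is a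
sequence of length `n`. -/
def TruthStep (M : ZFSet.{u}) (U A T : Set ZFSet.{u}) (c n s : ZFSet.{u}) : Prop :=
  (∃ i ∈ n, ∃ j ∈ n, c = pair (natCode 0) (pair i j) ∧
    ∃ x ∈ M, ∃ y ∈ M, pair i x ∈ s ∧ pair j y ∈ s ∧ x ∈ y) ∨
  (∃ i ∈ n, ∃ j ∈ n, c = pair (natCode 1) (pair i j) ∧ ∃ x ∈ M, pair i x ∈ s ∧ pair j x ∈ s) ∨
  (∃ i ∈ n, c = pair (natCode 2) (pair i (natCode 0)) ∧ ∃ x ∈ M, pair i x ∈ s ∧ x ∈ A) ∨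
  -- Only negation must demand that `d` is a code: in the other compound clauses this follows from
  -- membership in `T`, whereas a non-code also lies outside `T`.
  (∃ d ∈ M, c = pair (natCode 3) d ∧ IsForm d n ∧ pair d s ∉ T) ∨
  (∃ d ∈ M, ∃ d' ∈ M, c = pair (natCode 4) (pair d d') ∧ pair d s ∈ T ∧ pair d' s ∈ T) ∨
  (∃ d ∈ M, c = pair (natCode 5) d ∧ ∀ x ∈ M, x ∈ U → pair d (insert (pair n x) s) ∈ T)

/-- `T` satisfies the definition of the truth predicate of `(U, ∈, A)`. -/
def IsTruth (M : ZFSet.{u}) (U A T : Set ZFSet.{u}) : Prop :=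
  (∀ z ∈ M, z ∈ T → ∃ c ∈ M, ∃ n ∈ M, ∃ s ∈ M, z = pair c s ∧ IsSeq {x | x ∈ M ∧ x ∈ U} n s) ∧
    ∀ c ∈ M, ∀ n ∈ M, ∀ s ∈ M, IsSeq {x | x ∈ M ∧ x ∈ U} n s →
      (pair c s ∈ T ↔ TruthStep M U A T c n s)

/-- `T` is correct about formulas with code `c`. -/
def TruthSpec (u : ZFSet.{u}) (A T : Set ZFSet.{u}) (c : ZFSet.{u}) : Prop :=
  ∀ (n : ℕ) (a : Fin n → ZFSet.{u}), (∀ i, a i ∈ u) → (pair c (seqCode a) ∈ T ↔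
    ∃ φ : ClassFormula n 1, φ.IsElementary ∧ c = φ.code ∧ SatSet u φ a fun _ => A)

theorem pair_mem_truthPredicate {u : ZFSet.{u}} {A : Set ZFSet.{u}} {n : ℕ}
    {a : Fin n → ZFSet.{u}} {c : ZFSet.{u}} (ha : ∀ i, a i ∈ u) :
    pair c (seqCode a) ∈ truthPredicate u A ↔
      ∃ φ : ClassFormula n 1, φ.IsElementary ∧ c = φ.code ∧ SatSet u φ a fun _ => A := by
  constructor
  · rintro ⟨m, φ, b, hφ, hb, e, h⟩
    obtain ⟨rfl, e'⟩ := pair_inj.1 e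
    obtain rfl := seqCode_length e'
    obtain rfl := seqCode_injective e'
    exact ⟨φ, hφ, rfl, h⟩
  · rintro ⟨φ, hφ, rfl, h⟩
    exact ⟨n, φ, a, hφ, ha, rfl, h⟩

theorem truthSpec_truthPredicate {u : ZFSet.{u}} {A : Set ZFSet.{u}} (c : ZFSet.{u}) :
    TruthSpec u A (truthPredicate u A) c :=
  fun _ _ ha => pair_mem_truthPredicate ha

/-! ### The Tarskian clauses characterise the truth predicate -/

section TransModel

variable {M : ZFSet.{u}} [hM : TransModel M]

/-- This is the inductive step for both directions of `isTruth_iff`. Nonemptiness matters in the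
quantifier clause: over an empty domain the clause would hold vacuously for every `d`, whether or
not it is a code. -/
theorem truthStep_iff {u c : ZFSet.{u}} {A T : Set ZFSet.{u}} (hne : u.Nonempty) (huM : u ⊆ M)
    (ih : ∀ d ∈ M, rank d < rank c → TruthSpec u A T d) {n : ℕ} {a : Fin n → ZFSet.{u}}
    (ha : ∀ i, a i ∈ u) : TruthStep M u A T c (natCode n) (seqCode a) ↔
      ∃ φ : ClassFormula n 1, φ.IsElementary ∧ c = φ.code ∧ SatSet u φ a fun _ => A := by
  have hf : ∀ {n : ℕ} (i : Fin n), natCode i ∈ natCode n := fun i => mem_natCode.2 ⟨i, i.2, rfl⟩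
  have haM : ∀ i, a i ∈ M := fun i => huM (ha i)
  constructor
  · rintro (⟨i, hi, j, hj, rfl, x, -, y, -, hx, hy, hxy⟩ | ⟨i, hi, j, hj, rfl, x, -, hx, hy⟩ |
      ⟨i, hi, rfl, x, -, hx, hA⟩ | ⟨d, hdM, rfl, hd, hT⟩ |
      ⟨d, hdM, d', hdM', rfl, hd, hd'⟩ | ⟨d, hdM, rfl, hd⟩)
    · obtain ⟨i, hi', rfl⟩ := mem_natCode.1 hi
      obtain ⟨j, hj', rfl⟩ := mem_natCode.1 hj
      obtain ⟨_, rfl⟩ := pair_mem_seqCode.1 hx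
      obtain ⟨_, rfl⟩ := pair_mem_seqCode.1 hy
      exact ⟨.mem ⟨i, hi'⟩ ⟨j, hj'⟩, by simp [ClassFormula.IsElementary], rfl, hxy⟩
    · obtain ⟨i, hi', rfl⟩ := mem_natCode.1 hi
      obtain ⟨j, hj', rfl⟩ := mem_natCode.1 hj
      obtain ⟨_, rfl⟩ := pair_mem_seqCode.1 hx
      obtain ⟨_, h⟩ := pair_mem_seqCode.1 hy
      exact ⟨.eq ⟨i, hi'⟩ ⟨j, hj'⟩, by simp [ClassFormula.IsElementary], rfl, h.symm⟩
    · obtain ⟨i, hi', rfl⟩ := mem_natCode.1 hi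
      obtain ⟨_, rfl⟩ := pair_mem_seqCode.1 hx
      exact ⟨.memC ⟨i, hi'⟩ 0, by simp [ClassFormula.IsElementary], rfl, hA⟩
    · obtain ⟨φ, hφ, rfl⟩ := isForm_natCode.1 hd
      refine ⟨.neg φ, hφ, rfl, fun hs => hT ?_⟩
      exact (ih _ hdM (rank_lt_rank_pair_right _ _) n a ha).2 ⟨φ, hφ, rfl, hs⟩
    · obtain ⟨φ, hφ, rfl, h⟩ := (ih _ hdM ((rank_lt_rank_pair_left _ _).trans
        (rank_lt_rank_pair_right _ _)) n a ha).1 hd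
      obtain ⟨ψ, hψ, rfl, h'⟩ := (ih _ hdM' ((rank_lt_rank_pair_right _ _).trans
        (rank_lt_rank_pair_right _ _)) n a ha).1 hd'
      exact ⟨.and φ ψ, ⟨hφ, hψ⟩, rfl, h, h'⟩
    · have key : ∀ x ∈ u, ∃ φ : ClassFormula (n + 1) 1, φ.IsElementary ∧ d = φ.code ∧
          SatSet u φ (Fin.snoc (α := fun _ => ZFSet.{u}) a x) fun _ => A := by
        intro x hx
        have := hd x (huM hx) hx
        rw [← seqCode_snoc] at this
        refine (ih _ hdM (rank_lt_rank_pair_right _ _) (n + 1) _ fun i => ?_).1 this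
        refine Fin.lastCases ?_ (fun i => ?_) i <;> simp [hx, ha]
      -- One element of the domain reveals the formula coded by `d`; injectivity of codes shows that
      -- the other elements yield the same formula.
      obtain ⟨x, hx⟩ := hne
      obtain ⟨φ, hφ, rfl, -⟩ := key x hx
      refine ⟨.all φ, hφ, rfl, fun y hy => ?_⟩
      obtain ⟨ψ, -, e, h⟩ := key y hy
      obtain rfl := ClassFormula.code_injective e
      exact h
  · rintro ⟨φ, hφ, rfl, h⟩
    cases φ with
    | mem i j =>
      exact .inl ⟨_, hf i, _, hf j, rfl, _, haM i, _, haM j, pair_fin_mem_seqCode.2 rfl,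
        pair_fin_mem_seqCode.2 rfl, h⟩
    | eq i j =>
      exact .inr <| .inl ⟨_, hf i, _, hf j, rfl, _, haM i, pair_fin_mem_seqCode.2 rfl,
        pair_fin_mem_seqCode.2 h.symm⟩
    | memC i j =>
      exact .inr <| .inr <| .inl ⟨_, hf i, by simp [ClassFormula.code], _, haM i,
        pair_fin_mem_seqCode.2 rfl, h⟩
    | neg φ =>
      refine .inr <| .inr <| .inr <| .inl ⟨_, φ.code_mem_model, rfl,
        isForm_natCode.2 ⟨φ, hφ, rfl⟩, fun hT => ?_⟩
      obtain ⟨ψ, -, e, hs⟩ := (ih _ φ.code_mem_model (rank_lt_rank_pair_right _ _) n a ha).1 hT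
      obtain rfl := ClassFormula.code_injective e
      exact h hs
    | and φ ψ =>
      exact .inr <| .inr <| .inr <| .inr <| .inl ⟨_, φ.code_mem_model, _, ψ.code_mem_model, rfl,
        (ih _ φ.code_mem_model ((rank_lt_rank_pair_left _ _).trans (rank_lt_rank_pair_right _ _)) n a ha).2
          ⟨φ, hφ.1, rfl, h.1⟩,
        (ih _ ψ.code_mem_model ((rank_lt_rank_pair_right _ _).trans (rank_lt_rank_pair_right _ _)) n a ha).2
          ⟨ψ, hφ.2, rfl, h.2⟩⟩
    | all φ =>
      refine .inr <| .inr <| .inr <| .inr <| .inr ⟨_, φ.code_mem_model, rfl, fun x _ hx => ?_⟩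
      rw [← seqCode_snoc]
      refine (ih _ φ.code_mem_model (rank_lt_rank_pair_right _ _) (n + 1) _ fun i => ?_).2 ⟨φ, hφ, rfl, h x hx⟩
      refine Fin.lastCases ?_ (fun i => ?_) i
      · simpa using hx
      · simpa using ha i
    | allC φ => exact hφ.elim

theorem truthPredicate_subset {u : ZFSet.{u}} (huM : u ⊆ M) {A : Set ZFSet.{u}} :
    ∀ z ∈ truthPredicate u A, z ∈ M := by
  rintro _ ⟨n, φ, a, -, ha, rfl, -⟩
  exact pair_mem_model φ.code_mem_model (seqCode_mem_model fun i => huM (ha i))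

/-- Uniqueness is proved by induction on the rank of the code, since each clause refers only to
codes of smaller rank. The first half of `IsTruth` excludes elements of `T` that are not pairs of
the right kind. -/
theorem isTruth_iff {u : ZFSet.{u}} {A T : Set ZFSet.{u}} (hne : u.Nonempty) (huM : u ⊆ M)
    (hT : ∀ z ∈ T, z ∈ M) : IsTruth M u A T ↔ T = truthPredicate u A := by
  have hu : {x | x ∈ M ∧ x ∈ (u : Set ZFSet.{u})} = u := by
    ext x
    exact ⟨fun h => h.2, fun h => ⟨huM h, h⟩⟩
  rw [IsTruth, hu]
  constructor
  · rintro ⟨h1, h2⟩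
    have key : ∀ c ∈ M, TruthSpec u A T c := by
      intro c
      induction h : rank c using WellFoundedLT.induction generalizing c with
      | ind r ih =>
        subst h
        intro hc n a ha
        have hs : seqCode a ∈ M := seqCode_mem_model fun i => huM (ha i)
        rw [h2 c hc _ (natCode_mem_model n) _ hs ⟨n, a, rfl, ha, rfl⟩]
        exact truthStep_iff hne huM (fun d hdM hd => ih _ hd d rfl hdM) ha
    ext z
    constructor
    · intro hz
      obtain ⟨c, hc, _, -, _, -, rfl, n, a, rfl, ha, rfl⟩ := h1 z (hT z hz) hz
      exact (pair_mem_truthPredicate ha).2 ((key c hc n a ha).1 hz)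
    · rintro ⟨n, φ, a, hφ, ha, rfl, h⟩
      exact (key _ φ.code_mem_model n a ha).2 ⟨φ, hφ, rfl, h⟩
  · rintro rfl
    refine ⟨?_, ?_⟩
    · rintro _ - ⟨n, φ, a, -, ha, rfl, -⟩
      exact ⟨_, φ.code_mem_model, _, natCode_mem_model n, _,
        seqCode_mem_model fun i => huM (ha i), rfl, n, a, rfl, ha, rfl⟩
    · rintro c hc _ - _ - ⟨n, a, rfl, ha, rfl⟩
      rw [pair_mem_truthPredicate ha]
      exact (truthStep_iff hne huM (fun d _ _ => truthSpec_truthPredicate d) ha).symm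

variable {𝒮 : Set (ℕ → Set ZFSet.{u})}
  {f g h : (ℕ → Set ZFSet.{u}) → (ℕ → ZFSet.{u}) → ZFSet.{u}}
  {U A T : (ℕ → Set ZFSet.{u}) → (ℕ → ZFSet.{u}) → Set ZFSet.{u}}

instance Df.isSeq_var (j : ℕ) [Tm M 𝒮 f] [Tm M 𝒮 g] :
    Df M 𝒮 fun S e => IsSeq {x | x ∈ M ∧ x ∈ S j} (f S e) (g S e) := by
  refine Df.subst₂ (Q := fun S x y => IsSeq {x | x ∈ M ∧ x ∈ S j} x y) ?_ ‹_› ‹_›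
  refine (inferInstance : Df M 𝒮 fun S e => (∃ k, e 0 = natCode k) ∧
      (∀ t ∈ e 1, ∃ i ∈ e 0, ∃ x ∈ M, x ∈ S j ∧ t = pair i x) ∧
      (∀ i ∈ e 0, ∃ x ∈ M, pair i x ∈ e 1) ∧
        ∀ i ∈ e 0, ∀ x ∈ M, ∀ y ∈ M, pair i x ∈ e 1 → pair i y ∈ e 1 → x = y).congr ?_
  intro S _ e _
  rw [isSeq_iff (M := M) fun x hx => hx.1]
  refine and_congr_right fun _ => and_congr_left fun _ => forall₂_congr fun t _ =>
    exists_congr fun i => and_congr_right fun _ => exists_congr fun x => ?_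
  exact ⟨fun ⟨_, h, h'⟩ => ⟨h.1, h.2, h'⟩, fun ⟨h, h1, h'⟩ => ⟨h, ⟨h, h1⟩, h'⟩⟩

set_option synthInstance.maxSize 2000 in
set_option synthInstance.maxHeartbeats 400000 in
instance Df.truthStep_var (i j k : ℕ) :
    Df M 𝒮 fun S e => TruthStep M (S 0) (S 1) (S 2) (e i) (e j) (e k) := by
  unfold TruthStep
  infer_instance

/-- The truth predicate is defined by an elementary formula. -/
instance Df.isTruth [hU : Cl M 𝒮 U] [hA : Cl M 𝒮 A] [hT : Cl M 𝒮 T] :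
    Df M 𝒮 fun S e => IsTruth M (U S e) (A S e) (T S e) := by
  refine Df.substC (P := fun S _ => IsTruth M (S 0) (S 1) (S 2))
    (C := fun j => Nat.casesOn j U fun j => Nat.casesOn j A fun _ => T) ?_ ?_
  · unfold IsTruth
    infer_instance
  · rintro (_ | _ | j)
    exacts [hU, hA, hT]

end TransModel

/-! ### Models of `GB`: comprehension, replacement and recursion -/

/-- The classes enumerated by `S₀` expand `M` to a model of `GB`. -/
class GBWorld (M : ZFSet.{u}) (S₀ : ℕ → Set ZFSet.{u}) : Prop where
  gb : ModelsGB M (Set.range S₀)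

/-- The image of the set `a` under `h`. -/
noncomputable def img (h : ZFSet.{u} → ZFSet.{u}) (a : ZFSet.{u}) : ZFSet.{u} :=
  ZFSet.range fun y : a => h y

@[simp] theorem mem_img {h : ZFSet.{u} → ZFSet.{u}} {a z : ZFSet.{u}} :
    z ∈ img h a ↔ ∃ y ∈ a, h y = z := by
  simp [img]

/-- The graph of `g` on `a`. -/
noncomputable def gr (g : ZFSet.{u} → ZFSet.{u}) (a : ZFSet.{u}) : ZFSet.{u} :=
  img (fun y => pair y (g y)) a

theorem mem_gr {g : ZFSet.{u} → ZFSet.{u}} {a z : ZFSet.{u}} :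
    z ∈ gr g a ↔ ∃ y ∈ a, pair y (g y) = z := mem_img

theorem pair_mem_gr {g : ZFSet.{u} → ZFSet.{u}} {a y w : ZFSet.{u}} :
    pair y w ∈ gr g a ↔ y ∈ a ∧ w = g y := by
  simp only [mem_gr, pair_inj]
  constructor
  · rintro ⟨y, hy, rfl, rfl⟩
    exact ⟨hy, rfl⟩
  · rintro ⟨hy, rfl⟩
    exact ⟨y, hy, rfl, rfl⟩

/-- Recursion on the ordinals. -/
noncomputable def ordRec (H : ZFSet.{u} → ZFSet.{u}) : ZFSet.{u} → ZFSet.{u} :=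
  open Classical in
  mem_wf.fix fun x rec => if x.IsOrdinal then
    H (ZFSet.range fun y : x => pair y (rec y y.2)) else ∅

theorem ordRec_of_isOrdinal (H : ZFSet.{u} → ZFSet.{u}) {x : ZFSet.{u}} (hx : x.IsOrdinal) :
    ordRec H x = H (gr (ordRec H) x) := by
  rw [ordRec, WellFounded.fix_eq, if_pos hx]
  rfl

theorem ordRec_of_not_isOrdinal (H : ZFSet.{u} → ZFSet.{u}) {x : ZFSet.{u}} (hx : ¬ x.IsOrdinal) :
    ordRec H x = ∅ := by
  rw [ordRec, WellFounded.fix_eq, if_neg hx]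

/-! ### Separation, replacement and ordinal recursion in a world -/

section World

variable {M : ZFSet.{u}} [hM : TransModel M] {S₀ : ℕ → Set ZFSet.{u}} [hW : GBWorld M S₀]

/-- Relative to the single class environment `S₀`, the free class variables of a formula already
denote classes of the world. The surplus set variables are dummies and receive the value `∅`. -/
theorem comprehension {R : ZFSet.{u} → Prop} (hR : Df M {S₀} fun _ e => R (e 0)) :
    {z | z ∈ M ∧ R z} ∈ Set.range S₀ := by
  obtain ⟨N, h⟩ := hR
  obtain ⟨φ, h1, h2⟩ := h (N + 1) (by omega) N le_rfl
  convert! hW.gb.comprehension N N φ h1 (fun _ => ∅) (fun _ => empty_mem_model)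
    (fun j => S₀ j) fun j => ⟨j, rfl⟩ using 1
  ext z
  refine and_congr_right fun hz => ?_
  rw [h1.realize_iff_satSet]
  refine (h2 S₀ rfl (envCons z fun _ => ∅) (envCons_mem hz fun _ => empty_mem_model)).trans ?_
  refine iff_of_eq (congrArg (SatSet M φ · _) (funext fun i => ?_))
  refine Fin.lastCases ?_ (fun i => ?_) i
  · simp [envCons]
  · have hi := i.2
    simp only [Fin.snoc_castSucc, Fin.val_castSucc]
    rw [show N + 1 - 1 - (i : ℕ) = (N - 1 - i) + 1 by omega]
    rfl

omit hM hW in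
-- Since `S₀` enumerates the world and is the only class environment allowed, every class of the
-- world may be used as a constant.
theorem Cl.of_mem {B : Set ZFSet.{u}} (hB : B ∈ Set.range S₀) : Cl M {S₀} fun _ _ => B := by
  obtain ⟨j, rfl⟩ := hB
  exact ⟨(Df.var_memC 0 j).congr fun S hS e _ => by rw [Set.mem_singleton_iff.1 hS]⟩

theorem coe_mem_world {c : ZFSet.{u}} (hc : c ∈ M) : (c : Set ZFSet.{u}) ∈ Set.range S₀ := by
  have := hW.gb.comprehension 1 0 (.mem 1 0) (by simp [ClassFormula.IsElementary])
    (fun _ => c) (fun _ => hc) Fin.elim0 fun i => i.elim0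
  convert! this using 1
  ext z
  simp only [ClassFormula.Realize, Set.mem_ofPred_eq]
  exact ⟨fun hz => ⟨mem_of_mem_model hz hc, hz⟩, fun hz => hz.2⟩

/-- Sets are classes of the world, so set parameters need no variables of their own. -/
theorem Tm.const {c : ZFSet.{u}} (hc : c ∈ M) : Tm M {S₀} fun _ _ => c := by
  have := Cl.of_mem (M := M) (coe_mem_world (S₀ := S₀) hc)
  exact Tm.of_mem_iff (R := fun _ _ x => x ∈ (c : Set ZFSet.{u})) (fun _ _ _ _ => hc)
    inferInstance fun _ _ _ _ _ _ => Iff.rfl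

variable (S₀) in
-- The class function is cut down to arguments in `a`, so that `Q` has to be functional only there.
theorem replacement_rel {Q : ZFSet.{u} → ZFSet.{u} → Prop} {a : ZFSet.{u}} (ha : a ∈ M)
    (hQ : Df M {S₀} fun _ e => Q (e 0) (e 1))
    (h : ∀ x ∈ a, ∀ y ∈ M, ∀ y' ∈ M, Q x y → Q x y' → y = y') :
    ∃ b ∈ M, ∀ y, y ∈ b ↔ y ∈ M ∧ ∃ x ∈ a, Q x y := by
  have := Tm.const (S₀ := S₀) ha
  have h0 : Df M {S₀} fun _ e => Q (e 1) (e 0) := hQ.rename fun i => Nat.casesOn i 1 fun _ => 0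
  have hF := comprehension (M := M) (S₀ := S₀) (R := fun z => ∃ x ∈ a, ∃ y ∈ M, z = pair x y ∧ Q x y)
    inferInstance
  have hfun : IsClassFunction {z | z ∈ M ∧ ∃ x ∈ a, ∃ y ∈ M, z = pair x y ∧ Q x y} := by
    refine ⟨?_, ?_⟩
    · rintro z ⟨-, x, -, y, -, rfl, -⟩
      exact ⟨x, y, rfl⟩
    · rintro x y y' ⟨-, x1, hx1, y1, hy1, e1, hQ1⟩ ⟨-, x2, hx2, y2, hy2, e2, hQ2⟩
      obtain ⟨rfl, rfl⟩ := pair_inj.1 e1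
      obtain ⟨rfl, rfl⟩ := pair_inj.1 e2
      exact h _ hx1 _ hy1 _ hy2 hQ1 hQ2
  obtain ⟨b, hb, hb'⟩ := hW.gb.class_replacement _ hF hfun a ha
  refine ⟨b, hb, fun y => (hb' y).trans ?_⟩
  constructor
  · rintro ⟨x, hx, -, x', hx', y', hy', e, hQ⟩
    obtain ⟨rfl, rfl⟩ := pair_inj.1 e
    exact ⟨hy', x, hx, hQ⟩
  · rintro ⟨hy, x, hx, hQ⟩
    exact ⟨x, hx, pair_mem_model (mem_of_mem_model hx ha) hy, x, hx, y, hy, rfl, hQ⟩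

variable (S₀) in
theorem separation {R : ZFSet.{u} → Prop} {a : ZFSet.{u}} (ha : a ∈ M)
    (hR : Df M {S₀} fun _ e => R (e 0)) : a.sep R ∈ M := by
  obtain ⟨b, hb, h⟩ := replacement_rel S₀ (Q := fun x y => x = y ∧ R x) ha inferInstance
    fun x _ y _ y' _ h h' => h.1.symm.trans h'.1
  convert! hb
  ext y
  rw [h, ZFSet.mem_sep]
  constructor
  · exact fun hy => ⟨mem_of_mem_model hy.1 ha, y, hy.1, rfl, hy.2⟩
  · rintro ⟨-, _, hx, rfl, hR⟩
    exact ⟨hx, hR⟩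

variable (S₀) in
theorem img_mem_model {Q : ZFSet.{u} → ZFSet.{u} → Prop} {a : ZFSet.{u}} {t : ZFSet.{u} → ZFSet.{u}}
    (ha : a ∈ M) (hQ : Df M {S₀} fun _ e => Q (e 0) (e 1)) (ht : ∀ x ∈ a, t x ∈ M)
    (h : ∀ x ∈ a, ∀ y ∈ M, Q x y ↔ y = t x) : img t a ∈ M := by
  obtain ⟨b, hb, hb'⟩ := replacement_rel S₀ ha hQ fun x hx y hy y' hy' hQ hQ' =>
    ((h x hx y hy).1 hQ).trans ((h x hx y' hy').1 hQ').symm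
  convert! hb
  ext y
  rw [hb', mem_img]
  constructor
  · rintro ⟨x, hx, rfl⟩
    exact ⟨ht x hx, x, hx, (h x hx _ (ht x hx)).2 rfl⟩
  · rintro ⟨hy, x, hx, hQ⟩
    exact ⟨x, hx, ((h x hx y hy).1 hQ).symm⟩

variable {t : ZFSet.{u} → ZFSet.{u}} {f : (ℕ → Set ZFSet.{u}) → (ℕ → ZFSet.{u}) → ZFSet.{u}}

omit hM hW in
theorem Tm.apply_mem (ht : Tm M {S₀} fun _ e => t (e 0)) {x : ZFSet.{u}} (hx : x ∈ M) : t x ∈ M :=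
  ht.mem S₀ rfl (fun _ => x) fun _ => hx

theorem tm_img (ht : Tm M {S₀} fun _ e => t (e 0)) (hf : Tm M {S₀} f) :
    Tm M {S₀} fun S e => img t (f S e) := by
  have ht' : ∀ f [Tm M {S₀} f], Tm M {S₀} fun S e => t (f S e) := fun f hf => ht.subst₁ hf
  refine Tm.subst₁ (t := fun x => img t x) (Tm.of_mem_iff
    (R := fun _ e x => ∃ y ∈ e 0, t y = x) ?_ inferInstance (by simp)) hf
  intro S hS e he
  exact img_mem_model S₀ (Q := fun x y => y = t x) (he 0) inferInstance
    (fun x hx => ht.apply_mem (mem_of_mem_model hx (he 0))) fun _ _ _ _ => Iff.rfl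

theorem tm_gr (ht : Tm M {S₀} fun _ e => t (e 0)) (hf : Tm M {S₀} f) :
    Tm M {S₀} fun S e => gr t (f S e) :=
  have _ht' : ∀ f [Tm M {S₀} f], Tm M {S₀} fun S e => t (f S e) := fun _ hf => ht.subst₁ hf
  tm_img inferInstance hf

/-- `f` is the graph on `y` of the function given by the recursion `H`. -/
def IsAttempt (M : ZFSet.{u}) (H : ZFSet.{u} → ZFSet.{u}) (f y : ZFSet.{u}) : Prop :=
  (∀ t ∈ f, ∃ z ∈ y, ∃ w ∈ M, t = pair z w) ∧
    ∀ z ∈ y, ∀ w ∈ M, pair z w ∈ f ↔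
      ∃ h ∈ M, (∀ t ∈ M, t ∈ h ↔ t ∈ f ∧ ∃ s ∈ z, ∃ w ∈ M, t = pair s w) ∧ w = H h

omit hW in
-- By ∈-induction along `y`, an attempt must agree with `g`: its restriction to each `z ∈ y` is the
-- graph of `g` on `z`, and `H` of that graph is `g z`. The graphs are assumed to be in `M` so that
-- quantifying over restrictions in `M` finds them.
theorem isAttempt_iff {H g : ZFSet.{u} → ZFSet.{u}} {f y : ZFSet.{u}} (hf : f ∈ M)
    (hy : y.IsOrdinal) (hgr : ∀ z ∈ y, gr g z ∈ M) (hgy : gr g y ∈ M)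
    (hg : ∀ z ∈ y, g z = H (gr g z)) : IsAttempt M H f y ↔ f = gr g y := by
  have hgM : ∀ z ∈ y, g z ∈ M := fun z hz =>
    (of_pair_mem_model (mem_of_mem_model (pair_mem_gr.2 ⟨hz, rfl⟩) hgy)).2
  have hres : ∀ z ∈ y, (∀ s ∈ z, ∀ w ∈ M, pair s w ∈ f ↔ w = g s) →
      ∀ h ∈ M, (∀ t ∈ M, t ∈ h ↔ t ∈ f ∧ ∃ s ∈ z, ∃ w ∈ M, t = pair s w) ↔ h = gr g z := by
    intro z hz hzf h hh
    have hsub := hy.subset_of_mem hz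
    have : ∀ t ∈ M, (t ∈ f ∧ ∃ s ∈ z, ∃ w ∈ M, t = pair s w) ↔ t ∈ gr g z := by
      intro t _
      rw [mem_gr]
      constructor
      · rintro ⟨ht, s, hs, w, hw, rfl⟩
        exact ⟨s, hs, by rw [(hzf s hs w hw).1 ht]⟩
      · rintro ⟨s, hs, rfl⟩
        exact ⟨(hzf s hs _ (hgM s (hsub hs))).2 rfl, s, hs, _, hgM s (hsub hs), rfl⟩
    constructor
    · intro H
      ext t
      constructor
      · intro ht
        have htM := mem_of_mem_model ht hh
        exact (this t htM).1 ((H t htM).1 ht)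
      · intro ht
        have htM := mem_of_mem_model ht (hgr z hz)
        exact (H t htM).2 ((this t htM).2 ht)
    · rintro rfl t ht
      exact (this t ht).symm
  constructor
  · rintro ⟨h1, h2⟩
    have key : ∀ z, z ∈ y → ∀ w ∈ M, pair z w ∈ f ↔ w = g z := by
      intro z
      induction z using ZFSet.inductionOn with
      | h z ih =>
        intro hz w hw
        have ih' := fun s hs => ih s hs (hy.mem_trans hs hz)
        rw [h2 z hz w hw, hg z hz]
        constructor
        · rintro ⟨h, hh, h3, rfl⟩
          rw [(hres z hz ih' h hh).1 h3]
        · rintro rfl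
          exact ⟨_, hgr z hz, (hres z hz ih' _ (hgr z hz)).2 rfl, rfl⟩
    ext t
    constructor
    · intro ht
      obtain ⟨z, hz, w, hw, rfl⟩ := h1 t ht
      exact pair_mem_gr.2 ⟨hz, (key z hz w hw).1 ht⟩
    · intro ht
      obtain ⟨z, hz, rfl⟩ := mem_gr.1 ht
      exact (key z hz _ (hgM z hz)).2 rfl
  · rintro rfl
    refine ⟨fun t ht => ?_, fun z hz w hw => ?_⟩
    · obtain ⟨z, hz, rfl⟩ := mem_gr.1 ht
      exact ⟨z, hz, _, hgM z hz, rfl⟩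
    · have hzf : ∀ s ∈ z, ∀ w ∈ M, pair s w ∈ gr g y ↔ w = g s := fun s hs w _ =>
        pair_mem_gr.trans (and_iff_right (hy.mem_trans hs hz))
      rw [pair_mem_gr, and_iff_right hz, hg z hz]
      constructor
      · rintro rfl
        exact ⟨_, hgr z hz, (hres z hz hzf _ (hgr z hz)).2 rfl, rfl⟩
      · rintro ⟨h, hh, h3, rfl⟩
        rw [(hres z hz hzf h hh).1 h3]

/-- Functions defined by recursion on the ordinals are definable. -/
theorem tm_ordRec_var {H : ZFSet.{u} → ZFSet.{u}} (hH : Tm M {S₀} fun _ e => H (e 0)) :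
    Tm M {S₀} fun _ e => ordRec H (e 0) := by
  have hH' : ∀ f [Tm M {S₀} f], Tm M {S₀} fun S e => H (f S e) := fun f hf => hH.subst₁ hf
  have hA : Df M {S₀} fun _ e => IsAttempt M H (e 0) (e 1) := by
    unfold IsAttempt
    infer_instance
  have hA' : ∀ f g [Tm M {S₀} f] [Tm M {S₀} g],
    Df M {S₀} fun S e => IsAttempt M H (f S e) (g S e) := fun f g hf hg =>
      Df.subst₂ (Q := fun _ x y => IsAttempt M H x y) hA hf hg
  -- The graph on `α` is collected by replacement: for `β ∈ α` the value is `H` of the unique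
  -- attempt on `β`, which lies in `M` by the induction hypothesis.
  have key : ∀ α : ZFSet.{u}, α ∈ M → α.IsOrdinal → gr (ordRec H) α ∈ M := by
    intro α
    induction α using ZFSet.inductionOn with
    | h α ih =>
      intro hα ho
      have ih' : ∀ β ∈ α, gr (ordRec H) β ∈ M := fun β hβ =>
        ih β hβ (mem_of_mem_model hβ hα) (ho.mem hβ)
      have hrec : ∀ β ∈ α, ordRec H β = H (gr (ordRec H) β) := fun β hβ =>
        ordRec_of_isOrdinal H (ho.mem hβ)
      refine img_mem_model S₀ (Q := fun β w => ∃ f ∈ M, IsAttempt M H f β ∧ w = pair β (H f)) hα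
        inferInstance (fun β hβ => ?_) fun β hβ w hw => ?_
      · rw [hrec β hβ]
        exact pair_mem_model (mem_of_mem_model hβ hα) (hH.apply_mem (ih' β hβ))
      · have hi : ∀ f ∈ M, IsAttempt M H f β ↔ f = gr (ordRec H) β := fun f hf =>
          isAttempt_iff hf (ho.mem hβ) (fun z hz => ih' z (ho.mem_trans hz hβ)) (ih' β hβ)
            fun z hz => hrec z (ho.mem_trans hz hβ)
        rw [hrec β hβ]
        constructor
        · rintro ⟨f, hf, h1, rfl⟩
          rw [(hi f hf).1 h1]
        · rintro rfl
          exact ⟨_, ih' β hβ, (hi _ (ih' β hβ)).2 rfl, rfl⟩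
  have hmem : ∀ x ∈ M, ordRec H x ∈ M := by
    intro x hx
    by_cases ho : x.IsOrdinal
    · rw [ordRec_of_isOrdinal H ho]
      exact hH.apply_mem (key x hx ho)
    · rw [ordRec_of_not_isOrdinal H ho]
      exact empty_mem_model
  refine ⟨fun S hS e he => hmem _ (he 0), ?_⟩
  refine (inferInstance : Df M {S₀} fun _ e =>
    ((e 1).IsOrdinal ∧ ∃ f ∈ M, IsAttempt M H f (e 1) ∧ e 0 = H f) ∨
      (¬ (e 1).IsOrdinal ∧ e 0 = ∅)).congr fun S hS e he => ?_
  by_cases ho : (e 1).IsOrdinal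
  · have hi : ∀ f ∈ M, IsAttempt M H f (e 1) ↔ f = gr (ordRec H) (e 1) := fun f hf =>
      isAttempt_iff hf ho
        (fun z hz => key z (mem_of_mem_model hz (he 1)) (ho.mem hz)) (key _ (he 1) ho)
        fun z hz => ordRec_of_isOrdinal H (ho.mem hz)
    simp only [ho, true_and, not_true, false_and, or_false, ordRec_of_isOrdinal]
    constructor
    · intro h
      exact ⟨_, key _ (he 1) ho, (hi _ (key _ (he 1) ho)).2 rfl, h⟩
    · rintro ⟨f, hf, h1, h2⟩
      rw [h2, (hi f hf).1 h1]
  · simp [ho, ordRec_of_not_isOrdinal]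

theorem tm_ordRec {H : ZFSet.{u} → ZFSet.{u}} (hH : Tm M {S₀} fun _ e => H (e 0))
    (hf : Tm M {S₀} f) : Tm M {S₀} fun S e => ordRec H (f S e) :=
  (tm_ordRec_var hH).subst₁ hf

end World

/-! ### Ranks, the cumulative hierarchy and closure points -/

open Classical in
/-- The second component of an ordered pair. -/
noncomputable def snd (t : ZFSet.{u}) : ZFSet.{u} :=
  if h : ∃ w, ∃ s, t = pair s w then h.choose else ∅

@[simp] theorem snd_pair (s w : ZFSet.{u}) : snd (pair s w) = w := by
  have h : ∃ w', ∃ s', pair s w = pair s' w' := ⟨w, s, rfl⟩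
  rw [snd, dif_pos h]
  exact (pair_inj.1 h.choose_spec.choose_spec).2.symm

/-- The union of `c` and all `k y` for the values `y` of the function at smaller ordinals. -/
noncomputable def unionRec (c : ZFSet.{u}) (k : ZFSet.{u} → ZFSet.{u}) : ZFSet.{u} → ZFSet.{u} :=
  ordRec fun f => c ∪ ⋃₀ img (fun t => k (snd t)) f

theorem mem_unionRec {c : ZFSet.{u}} {k : ZFSet.{u} → ZFSet.{u}} {α z : ZFSet.{u}}
    (hα : α.IsOrdinal) : z ∈ unionRec c k α ↔ z ∈ c ∨ ∃ β ∈ α, z ∈ k (unionRec c k β) := by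
  rw [unionRec, ordRec_of_isOrdinal _ hα]
  simp [mem_gr]

theorem isOrdinal_sUnion {x : ZFSet.{u}} (h : ∀ y ∈ x, y.IsOrdinal) :
    (⋃₀ x : ZFSet).IsOrdinal := by
  rw [isOrdinal_iff_forall_mem_isOrdinal]
  refine ⟨IsTransitive.sUnion' fun y hy => (h y hy).isTransitive, fun z hz => ?_⟩
  obtain ⟨y, hy, hz⟩ := mem_sUnion.1 hz
  exact (h y hy).mem hz

theorem isOrdinal_union {x y : ZFSet.{u}} (hx : x.IsOrdinal) (hy : y.IsOrdinal) :
    (x ∪ y).IsOrdinal := by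
  rw [← sUnion_pair]
  refine isOrdinal_sUnion fun z hz => ?_
  rcases ZFSet.mem_pair.1 hz with rfl | rfl <;> assumption

theorem natCode_eq_toZFSet : ∀ n : ℕ, natCode.{u} n = (n : Ordinal.{u}).toZFSet
  | 0 => by simp [natCode]
  | n + 1 => by rw [natCode, natCode_eq_toZFSet n, Nat.cast_succ, Ordinal.toZFSet_add_one]

/-- The rank of a set, as a von Neumann ordinal. -/
noncomputable def rk (x : ZFSet.{u}) : ZFSet.{u} := (rank x).toZFSet

theorem isOrdinal_rk (x : ZFSet.{u}) : (rk x).IsOrdinal := isOrdinal_toZFSet _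

@[simp] theorem rank_rk (x : ZFSet.{u}) : rank (rk x) = rank x := Ordinal.rank_toZFSet _

theorem mem_rk {x α : ZFSet.{u}} (hα : α.IsOrdinal) : α ∈ rk x ↔ rank α < rank x := by
  rw [← IsOrdinal.rank_lt_iff_mem hα (isOrdinal_rk x), rank_rk]

theorem eq_rk_iff {x α : ZFSet.{u}} : α = rk x ↔ α.IsOrdinal ∧ rank α = rank x := by
  constructor
  · rintro rfl
    exact ⟨isOrdinal_rk x, rank_rk x⟩
  · rintro ⟨h1, h2⟩
    rw [← IsOrdinal.rank_inj h1 (isOrdinal_rk x), h2, rank_rk]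

/-- The stages of the cumulative hierarchy of `M`. -/
noncomputable def vM (M : ZFSet.{u}) : ZFSet.{u} → ZFSet.{u} :=
  unionRec ∅ fun w => w.powerset ∩ M

theorem mem_vM {M α : ZFSet.{u}} (hM : M.IsTransitive) (hα : α.IsOrdinal) {x : ZFSet.{u}} :
    x ∈ vM M α ↔ x ∈ M ∧ rank x < rank α := by
  induction α using ZFSet.inductionOn generalizing x with
  | h α ih =>
    rw [vM, mem_unionRec hα]
    simp only [notMem_empty, false_or, ZFSet.mem_inter, mem_powerset]
    rw [lt_rank_iff]
    constructor
    · rintro ⟨β, hβ, hx, hxM⟩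
      refine ⟨hxM, β, hβ, rank_le_iff.2 fun y hy => ?_⟩
      exact ((ih β hβ (hα.mem hβ)).1 (hx hy)).2
    · rintro ⟨hxM, β, hβ, hx⟩
      refine ⟨β, hβ, fun y hy => ?_, hxM⟩
      exact (ih β hβ (hα.mem hβ)).2 ⟨hM.mem_trans hy hxM, rank_le_iff.1 hx hy⟩

/-! ### Ranks and closure points computed in `M` -/

section World

variable {M : ZFSet.{u}} [hM : TransModel M] {S₀ : ℕ → Set ZFSet.{u}} [hW : GBWorld M S₀]
  {f g : (ℕ → Set ZFSet.{u}) → (ℕ → ZFSet.{u}) → ZFSet.{u}} {𝒮 : Set (ℕ → Set ZFSet.{u})}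

instance tm_snd [hf : Tm M 𝒮 f] : Tm M 𝒮 fun S e => snd (f S e) := by
  refine Tm.subst₁ (t := snd) ⟨fun S hS e he => ?_, ?_⟩ hf
  · by_cases h : ∃ w, ∃ s, e 0 = pair s w
    · obtain ⟨w, s, h⟩ := h
      rw [h, snd_pair]
      exact (of_pair_mem_model (h ▸ he 0)).2
    · rw [snd, dif_neg h]
      exact empty_mem_model
  · refine (inferInstance : Df M 𝒮 fun _ e => (∃ w ∈ M, ∃ s ∈ M, e 1 = pair s w ∧ e 0 = w) ∨
      ((¬ ∃ w ∈ M, ∃ s ∈ M, e 1 = pair s w) ∧ e 0 = ∅)).congr fun S hS e he => ?_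
    by_cases h : ∃ w, ∃ s, e 1 = pair s w
    · obtain ⟨w, s, h⟩ := h
      have hm : pair s w ∈ M := h ▸ he 1
      have := of_pair_mem_model hm
      simp only [h, snd_pair, pair_inj]
      constructor
      · intro h
        exact .inl ⟨w, this.2, s, this.1, ⟨rfl, rfl⟩, h⟩
      · rintro (⟨w, -, s, -, ⟨rfl, rfl⟩, h⟩ | ⟨h, -⟩)
        · exact h
        · exact (h ⟨w, this.2, s, this.1, rfl, rfl⟩).elim
    · have h1 : ¬ ∃ w ∈ M, ∃ s ∈ M, e 1 = pair s w := fun ⟨w, _, s, _, h'⟩ => h ⟨w, s, h'⟩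
      rw [snd, dif_neg h, and_iff_right h1, or_iff_right]
      exact fun ⟨w, _, s, _, h', _⟩ => h ⟨w, s, h'⟩

theorem tm_unionRec {c : ZFSet.{u}} {k : ZFSet.{u} → ZFSet.{u}} (hc : c ∈ M)
    (hk : Tm M {S₀} fun _ e => k (e 0)) (hf : Tm M {S₀} f) :
    Tm M {S₀} fun S e => unionRec c k (f S e) := by
  have hk' : ∀ f [Tm M {S₀} f], Tm M {S₀} fun S e => k (f S e) := fun _ hf => hk.subst₁ hf
  have hc' := Tm.const (S₀ := S₀) hc
  have : Tm M {S₀} fun _ e => img (fun t => k (snd t)) (e 0) :=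
    tm_img inferInstance (Tm.var 0)
  exact tm_ordRec inferInstance hf

instance tm_vM [hf : Tm M {S₀} f] : Tm M {S₀} fun S e => vM M (f S e) :=
  tm_unionRec empty_mem_model inferInstance hf

/-- The rank function cannot be used as a definable function before its values are known to lie in
`M`. Replacement is therefore applied to a description of `rk y` as the least ordinal α with `y ⊆ vM
M α`. -/
theorem rk_mem_model (S₀ : ℕ → Set ZFSet.{u}) [GBWorld M S₀] {x : ZFSet.{u}} (hx : x ∈ M) : rk x ∈ M := by
  induction x using ZFSet.inductionOn with
  | h x ih =>
    have ih' : ∀ y ∈ x, rk y ∈ M := fun y hy => ih y hy (mem_of_mem_model hy hx)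
    have : img (fun y => insert (rk y) (rk y)) x ∈ M := by
      refine img_mem_model S₀ (Q := fun y w => ∃ α ∈ M, α.IsOrdinal ∧ y ⊆ vM M α ∧
        (∀ β ∈ α, ¬ y ⊆ vM M β) ∧ w = insert α α) hx inferInstance
        (fun y hy => insert_mem_model (ih' y hy) (ih' y hy)) fun y hy w hw => ?_
      have hyM := mem_of_mem_model hy hx
      have hsub : ∀ {α : ZFSet.{u}}, α.IsOrdinal → (y ⊆ vM M α ↔ rank y ≤ rank α) := by
        intro α hα
        rw [rank_le_iff]
        refine forall₂_congr fun z hz => (mem_vM hM.trans hα).trans ?_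
        exact and_iff_right (mem_of_mem_model hz hyM)
      constructor
      · rintro ⟨α, hα, ho, h1, h2, rfl⟩
        have : α = rk y := by
          refine eq_rk_iff.2 ⟨ho, le_antisymm ?_ ((hsub ho).1 h1)⟩
          refine rank_le_iff.2 fun β hβ => ?_
          have := h2 β hβ
          rwa [hsub (ho.mem hβ), not_le] at this
        rw [this]
      · rintro rfl
        refine ⟨_, ih' y hy, isOrdinal_rk y, ?_, fun β hβ => ?_, rfl⟩
        · rw [hsub (isOrdinal_rk y), rank_rk]
        · have hβo := (isOrdinal_rk y).mem hβ
          rw [hsub hβo, not_le]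
          exact (mem_rk hβo).1 hβ
    suffices h : rk x = ⋃₀ img (fun y => insert (rk y) (rk y)) x from h ▸ sUnion_mem_model this
    ext z
    simp only [rk, Ordinal.mem_toZFSet_iff, mem_sUnion, mem_img, lt_rank_iff]
    constructor
    · rintro ⟨a, ⟨y, hy, hay⟩, rfl⟩
      refine ⟨_, ⟨y, hy, rfl⟩, ?_⟩
      rw [← Ordinal.toZFSet_add_one, Ordinal.toZFSet_mem_toZFSet_iff]
      exact Order.lt_add_one_iff.2 hay
    · rintro ⟨_, ⟨y, hy, rfl⟩, hz⟩
      rw [← Ordinal.toZFSet_add_one, Ordinal.mem_toZFSet_iff] at hz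
      obtain ⟨a, ha, rfl⟩ := hz
      exact ⟨a, ⟨y, hy, Order.lt_add_one_iff.1 ha⟩, rfl⟩

theorem subset_vM_iff {x α : ZFSet.{u}} (hx : x ∈ M) (hα : α.IsOrdinal) :
    x ⊆ vM M α ↔ rank x ≤ rank α := by
  rw [rank_le_iff]
  refine forall₂_congr fun z hz => (mem_vM hM.trans hα).trans ?_
  exact and_iff_right (mem_of_mem_model hz hx)

instance tm_rk [hf : Tm M {S₀} f] : Tm M {S₀} fun S e => rk (f S e) := by
  refine Tm.subst₁ (t := rk) ⟨fun S hS e he => rk_mem_model S₀ (he 0), ?_⟩ hf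
  refine (inferInstance : Df M {S₀} fun _ e => (e 0).IsOrdinal ∧ e 1 ⊆ vM M (e 0) ∧
      ∀ β ∈ e 0, ¬ e 1 ⊆ vM M β).congr fun S hS e he => ?_
  rw [eq_rk_iff]
  refine and_congr_right fun ho => ?_
  rw [subset_vM_iff (he 1) ho, le_antisymm_iff, and_comm]
  refine and_congr_right fun _ => rank_le_iff.trans <| forall₂_congr fun β hβ => ?_
  rw [subset_vM_iff (he 1) (ho.mem hβ), not_le]

instance df_rank_lt [hf : Tm M {S₀} f] [hg : Tm M {S₀} g] :
    Df M {S₀} fun S e => rank (f S e) < rank (g S e) :=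
  (inferInstance : Df M {S₀} fun S e => rk (f S e) ∈ rk (g S e)).congr fun S _ e _ => by
    rw [mem_rk (isOrdinal_rk _), rank_rk]

instance df_rank_le [hf : Tm M {S₀} f] [hg : Tm M {S₀} g] :
    Df M {S₀} fun S e => rank (f S e) ≤ rank (g S e) := by
  simp_rw [← not_lt]
  infer_instance

/-- The axiom of infinity gives an inductive set, from which the natural numbers are separated by
their bounded definition. -/
theorem omega_mem_model (S₀ : ℕ → Set ZFSet.{u}) [GBWorld M S₀] : Ordinal.omega0.toZFSet ∈ M := by
  obtain ⟨w, hw, ⟨e, he, hew, h0⟩, hs⟩ := hM.zfc.infinity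
  have hnat : ∀ n, natCode n ∈ w := by
    intro n
    induction n with
    | zero =>
      convert! hew
      ext z
      simpa [natCode] using fun hz => h0 z (mem_of_mem_model hz he) hz
    | succ n ih =>
      obtain ⟨y, hy, hyw, h⟩ := hs _ (natCode_mem_model n) ih
      convert! hyw
      ext z
      rw [natCode, mem_insert_iff]
      constructor
      · intro hz
        refine (h z ?_).2 hz.symm
        rcases hz with rfl | hz
        exacts [natCode_mem_model n, mem_of_mem_model hz (natCode_mem_model n)]
      · exact fun hz => ((h z (mem_of_mem_model hz hy)).1 hz).symm
  convert! separation S₀ (R := fun x => ∃ n, x = natCode n) hw inferInstance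
  ext z
  simp only [Ordinal.mem_toZFSet_iff, ZFSet.mem_sep, Ordinal.lt_omega0]
  constructor
  · rintro ⟨_, ⟨n, rfl⟩, rfl⟩
    rw [← natCode_eq_toZFSet]
    exact ⟨hnat n, n, rfl⟩
  · rintro ⟨-, n, rfl⟩
    exact ⟨n, ⟨n, rfl⟩, (natCode_eq_toZFSet n).symm⟩

/-- The limit ordinals `β` such that `vM M β` is closed under a given function are unbounded. -/
theorem exists_closed {h : ZFSet.{u} → ZFSet.{u}} (hh : Tm M {S₀} fun _ e => h (e 0))
    {x : ZFSet.{u}} (hx : x ∈ M) : ∃ β ∈ M, β.IsOrdinal ∧ (∀ γ ∈ β, insert γ γ ∈ β) ∧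
      rank x < rank β ∧ ∀ y ∈ M, rank y < rank β → rank (h y) < rank β := by
  have hh' : ∀ f [Tm M {S₀} f], Tm M {S₀} fun S e => h (f S e) := fun _ hf => hh.subst₁ hf
  have hrx := rk_mem_model S₀ hx
  -- One closing-off step: an ordinal above `γ` and above the rank of every `h y` with `y` in the
  -- stage `γ`.
  set step : ZFSet.{u} → ZFSet.{u} := fun γ =>
    ⋃₀ img (fun y => insert (rk (h y)) (rk (h y))) (vM M γ) ∪ insert γ γ with hstep
  have himg : Tm M {S₀} fun _ e => img (fun y => insert (rk (h y)) (rk (h y))) (vM M (e 0)) :=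
    tm_img inferInstance inferInstance
  have hstepTm : Tm M {S₀} fun _ e => step (e 0) := by
    simp only [hstep]
    infer_instance
  -- Iterating from the successor of the rank of `x`, the value at ω is the union of all finite
  -- stages and is the desired closure point.
  set g := unionRec (insert (rk x) (rk x)) step with hg
  have hgTm : Tm M {S₀} fun _ e => g (e 0) :=
    tm_unionRec (insert_mem_model hrx hrx) hstepTm (Tm.var 0)
  set ω : ZFSet.{u} := Ordinal.omega0.toZFSet with hω
  have hωo : ω.IsOrdinal := isOrdinal_toZFSet _
  have hω0 : ∅ ∈ ω := by
    rw [hω, ← Ordinal.toZFSet_zero, Ordinal.toZFSet_mem_toZFSet_iff]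
    exact Ordinal.omega0_pos
  have hωs : ∀ n ∈ ω, insert n n ∈ ω := by
    intro n hn
    obtain ⟨a, ha, rfl⟩ := Ordinal.mem_toZFSet_iff.1 hn
    rw [← Ordinal.toZFSet_add_one, hω, Ordinal.toZFSet_mem_toZFSet_iff]
    exact Ordinal.isSuccLimit_omega0.succ_lt ha
  have hstepo : ∀ γ, γ.IsOrdinal → (step γ).IsOrdinal := by
    intro γ hγ
    refine isOrdinal_union (isOrdinal_sUnion fun z hz => ?_) (isOrdinal_succ hγ)
    obtain ⟨y, _, rfl⟩ := mem_img.1 hz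
    exact isOrdinal_succ (isOrdinal_rk _)
  have hgo : ∀ α, α.IsOrdinal → (g α).IsOrdinal := by
    intro α
    induction α using ZFSet.inductionOn with
    | h α ih =>
      intro hα
      have : g α = insert (rk x) (rk x) ∪ ⋃₀ img (fun β => step (g β)) α := by
        ext z
        rw [hg, mem_unionRec hα]
        simp
      rw [this]
      refine isOrdinal_union (isOrdinal_succ (isOrdinal_rk x)) (isOrdinal_sUnion fun z hz => ?_)
      obtain ⟨β, hβ, rfl⟩ := mem_img.1 hz
      exact hstepo _ (ih β hβ (hα.mem hβ))
  have hsub : ∀ n ∈ ω, step (g n) ⊆ g ω := fun n hn z hz => (mem_unionRec hωo).2 (.inr ⟨n, hn, hz⟩)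
  have hmem : ∀ z ∈ g ω, ∃ n ∈ ω, z ∈ g n := by
    intro z hz
    rcases (mem_unionRec hωo).1 hz with hz | ⟨n, hn, hz⟩
    · exact ⟨∅, hω0, (mem_unionRec isOrdinal_empty).2 (.inl hz)⟩
    · exact ⟨_, hωs n hn, (mem_unionRec (isOrdinal_succ (hωo.mem hn))).2
        (.inr ⟨n, by simp, hz⟩)⟩
  refine ⟨g ω, hgTm.apply_mem (omega_mem_model S₀), hgo ω hωo, fun γ hγ => ?_, ?_, fun y hy hyr => ?_⟩
  · obtain ⟨n, hn, hz⟩ := hmem γ hγ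
    refine hsub n hn ?_
    have hgn := hgo n (hωo.mem hn)
    -- From `γ ∈ g n` the successor of `γ` is at most `g n`, hence an element of the successor of `g
    -- n`, which is contained in `step (g n)`.
    have h1 : insert γ γ ⊆ g n := by
      intro z hz'
      rcases mem_insert_iff.1 hz' with rfl | hz'
      exacts [hz, hgn.mem_trans hz' hz]
    refine mem_union.2 (.inr (mem_insert_iff.2 ?_))
    exact ((isOrdinal_succ (hgn.mem hz)).subset_iff_eq_or_mem hgn).1 h1
  · rw [← rank_rk x]
    exact rank_lt_of_mem ((mem_unionRec hωo).2 (.inl (by simp)))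
  · obtain ⟨z, hz, hyz⟩ := lt_rank_iff.1 hyr
    obtain ⟨n, hn, hzn⟩ := hmem z hz
    rw [← rank_rk (h y)]
    refine rank_lt_of_mem (hsub n hn (mem_union.2 (.inl (mem_sUnion.2
      ⟨_, mem_img.2 ⟨y, ?_, rfl⟩, by simp⟩))))
    exact (mem_vM hM.trans (hgo n (hωo.mem hn))).2 ⟨hy, hyz.trans_lt (rank_lt_of_mem hzn)⟩

end World

theorem Df.subst_all {M : ZFSet.{u}} {𝒮 : Set (ℕ → Set ZFSet.{u})}
    {P : (ℕ → Set ZFSet.{u}) → (ℕ → ZFSet.{u}) → Prop} (hP : Df M 𝒮 P)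
    {t : ℕ → (ℕ → Set ZFSet.{u}) → (ℕ → ZFSet.{u}) → ZFSet.{u}} (ht : ∀ i, Tm M 𝒮 (t i)) :
    Df M 𝒮 fun S e => P S fun i => t i S e := by
  obtain ⟨N, h⟩ := hP
  obtain ⟨φ, h1, h2⟩ := h N le_rfl N le_rfl
  exact (Df.satSet_subst h1 (t := fun i => t (N - 1 - i)) (C := fun j S _ => S j)
    (fun _ => ht _) fun j => Cl.var _).congr
      fun S hS e he => h2 S hS (fun i => t i S e) fun i => (ht i).mem S hS e he

/-! ### Set parameters and least ranks -/

section World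

variable {M : ZFSet.{u}} [hM : TransModel M] {S₀ : ℕ → Set ZFSet.{u}} [hW : GBWorld M S₀]
  {f g : (ℕ → Set ZFSet.{u}) → (ℕ → ZFSet.{u}) → ZFSet.{u}}
  {R : (ℕ → Set ZFSet.{u}) → (ℕ → ZFSet.{u}) → ZFSet.{u} → Prop}
  {t : (ℕ → Set ZFSet.{u}) → (ℕ → ZFSet.{u}) → ZFSet.{u} → ZFSet.{u}}

/-- Fixing set parameters in a definable relation. -/
theorem Df.fix₁ (hR : Df M {S₀} fun S e => R S (fun i => e (i + 1)) (e 0)) {ε : ℕ → ZFSet.{u}}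
    (hε : ∀ i, ε i ∈ M) : Df M {S₀} fun S e => R S ε (e 0) :=
  hR.subst_all (t := fun i => Nat.casesOn i (fun _ e => e 0) fun i _ _ => ε i) <| by
    rintro (_ | i)
    exacts [Tm.var 0, Tm.const (hε i)]

theorem Df.fix₂ {R : (ℕ → Set ZFSet.{u}) → (ℕ → ZFSet.{u}) → ZFSet.{u} → ZFSet.{u} → Prop}
    (hR : Df M {S₀} fun S e => R S (fun i => e (i + 2)) (e 0) (e 1)) {ε : ℕ → ZFSet.{u}}
    (hε : ∀ i, ε i ∈ M) : Df M {S₀} fun S e => R S ε (e 0) (e 1) :=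
  hR.subst_all (t := fun i => Nat.casesOn i (fun _ e => e 0)
    fun i => Nat.casesOn i (fun _ e => e 1) fun i _ _ => ε i) <| by
    rintro (_ | _ | i)
    exacts [Tm.var 0, Tm.var 1, Tm.const (hε i)]

instance tm_sep [hf : Tm M {S₀} f] [hR : Df M {S₀} fun S e => R S (fun i => e (i + 1)) (e 0)] :
    Tm M {S₀} fun S e => (f S e).sep (R S e) := by
  have := hf.rename fun i => i + 1
  refine Tm.of_mem_iff (R := fun S e x => x ∈ f S e ∧ R S e x) ?_ inferInstance (by simp)
  rintro S hS e he
  obtain rfl := Set.mem_singleton_iff.1 hS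
  exact separation S (hf.mem S hS e he) ((hR.fix₁ he).congr
    fun S' hS' _ _ => by rw [Set.mem_singleton_iff.1 hS'])

instance tm_image [hf : Tm M {S₀} f] [ht : Tm M {S₀} fun S e => t S (fun i => e (i + 1)) (e 0)] :
    Tm M {S₀} fun S e => img (t S e) (f S e) := by
  have := hf.rename fun i => i + 1
  have h0 : Tm M {S₀} fun S e => t S (fun i => e (i + 2)) (e 0) :=
    ht.rename fun i => Nat.casesOn i 0 fun i => i + 2
  refine Tm.of_mem_iff (R := fun S e x => ∃ y ∈ f S e, t S e y = x) ?_ inferInstance (by simp)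
  rintro S hS e he
  obtain rfl := Set.mem_singleton_iff.1 hS
  refine img_mem_model S (Q := fun x y => y = t S e x) (hf.mem S hS e he) ?_
    (fun x hx => ?_) fun _ _ _ _ => Iff.rfl
  · have h2 : Df M {S} fun S e => e 1 = t S (fun i => e (i + 2)) (e 0) := inferInstance
    exact (Df.fix₂ (R := fun S e x y => y = t S e x) h2 he).congr
      fun S' hS' _ _ => by rw [Set.mem_singleton_iff.1 hS']
  · exact ht.mem S rfl (envCons x e) (envCons_mem (mem_of_mem_model hx (hf.mem S rfl e he)) he)

/-- The least rank of an element of `M` with a given property (`∅` if there is none). -/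
noncomputable def leastRank (M : ZFSet.{u}) (R : ZFSet.{u} → Prop) : ZFSet.{u} :=
  (sInf {o | ∃ q ∈ M, R q ∧ rank q = o}).toZFSet

omit hM in
theorem leastRank_eq {R : ZFSet.{u} → Prop} {q : ZFSet.{u}} (hq : q ∈ M) (hR : R q)
    (h : ∀ q' ∈ M, R q' → rank q ≤ rank q') : leastRank M R = rk q := by
  have : sInf {o | ∃ q ∈ M, R q ∧ rank q = o} = rank q := by
    refine le_antisymm (csInf_le' ⟨q, hq, hR, rfl⟩) (le_csInf ⟨_, q, hq, hR, rfl⟩ ?_)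
    rintro _ ⟨q', hq', hR', rfl⟩
    exact h q' hq' hR'
  rw [leastRank, this, rk]

omit hM in
theorem exists_leastRank {R : ZFSet.{u} → Prop} (h : ∃ q ∈ M, R q) :
    ∃ q ∈ M, R q ∧ (∀ q' ∈ M, R q' → rank q ≤ rank q') ∧ leastRank M R = rk q := by
  obtain ⟨q0, hq0, hR0⟩ := h
  obtain ⟨q, hq, hR, e⟩ := csInf_mem (s := {o | ∃ q ∈ M, R q ∧ rank q = o}) ⟨_, q0, hq0, hR0, rfl⟩
  have hmin : ∀ q' ∈ M, R q' → rank q ≤ rank q' := fun q' hq' hR' =>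
    e ▸ csInf_le' ⟨q', hq', hR', rfl⟩
  exact ⟨q, hq, hR, hmin, leastRank_eq hq hR hmin⟩

omit hM in
theorem leastRank_of_not {R : ZFSet.{u} → Prop} (h : ¬ ∃ q ∈ M, R q) : leastRank M R = ∅ := by
  have : {o | ∃ q ∈ M, R q ∧ rank q = o} = ∅ :=
    Set.eq_empty_iff_forall_notMem.2 fun _ ⟨q, hq, hR, _⟩ => h ⟨q, hq, hR⟩
  rw [leastRank, this, Ordinal.sInf_empty, Ordinal.toZFSet_zero]

omit hM in
theorem isOrdinal_leastRank (R : ZFSet.{u} → Prop) : (leastRank M R).IsOrdinal :=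
  isOrdinal_toZFSet _

instance tm_leastRank [hR : Df M {S₀} fun S e => R S (fun i => e (i + 1)) (e 0)] :
    Tm M {S₀} fun S e => leastRank M (R S e) := by
  have h1 : Df M {S₀} fun S e => R S (fun i => e (i + 1 + 1)) (e 0) :=
    hR.rename fun i => Nat.casesOn i 0 fun i => i + 2
  have h2 : Df M {S₀} fun S e => R S (fun i => e (i + 1 + 1 + 1)) (e 0) :=
    hR.rename fun i => Nat.casesOn i 0 fun i => i + 3
  refine ⟨fun S hS e he => ?_, ?_⟩
  · by_cases h : ∃ q ∈ M, R S e q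
    · obtain ⟨q, hq, -, -, e⟩ := exists_leastRank h
      rw [e]
      exact rk_mem_model S₀ hq
    · rw [leastRank_of_not h]
      exact empty_mem_model
  · refine (inferInstance : Df M {S₀} fun S e =>
      (∃ q ∈ M, R S (fun i => e (i + 1)) q ∧
        (∀ q' ∈ M, R S (fun i => e (i + 1)) q' → rank q ≤ rank q') ∧ e 0 = rk q) ∨
      (¬ (∃ q ∈ M, R S (fun i => e (i + 1)) q) ∧ e 0 = ∅)).congr fun S hS e he => ?_
    by_cases h : ∃ q ∈ M, R S (fun i => e (i + 1)) q
    · rw [or_iff_left (fun h' => h'.1 h)]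
      constructor
      · intro h0
        obtain ⟨q, hq, hR, hmin, e1⟩ := exists_leastRank h
        exact ⟨q, hq, hR, hmin, h0.trans e1⟩
      · rintro ⟨q, hq, hR, hmin, e1⟩
        rw [e1, leastRank_eq hq hR hmin]
    · rw [leastRank_of_not h, or_iff_right (fun h' => h ⟨_, h'.choose_spec.1, h'.choose_spec.2.1⟩),
        and_iff_right h]

/-! ### Choice functions and long well-ordered sets -/

/-- The axiom of choice is stated for disjoint families, so each nonempty `w ⊆ v` is replaced by the
disjoint copy {w} × w. The function is definable on all of `M` and chooses correctly on nonempty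
subsets of `v` that belong to `M`. -/
theorem exists_choiceFunction (S₀ : ℕ → Set ZFSet.{u}) [GBWorld M S₀] {v : ZFSet.{u}}
    (hv : v ∈ M) : ∃ ch : ZFSet.{u} → ZFSet.{u}, (Tm M {S₀} fun _ e => ch (e 0)) ∧
      ∀ w ∈ M, w ⊆ v → w.Nonempty → ch w ∈ w := by
  have hconst := Tm.const (S₀ := S₀) hv
  set fam := img (fun w => img (fun y => pair w y) w)
    ((v.powerset ∩ M).sep fun w => ∃ y ∈ w, y = y) with hfam
  have hfamM : fam ∈ M :=
    (inferInstance : Tm M {S₀} fun _ _ => img (fun w => img (fun y => pair w y) w)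
      ((v.powerset ∩ M).sep fun w => ∃ y ∈ w, y = y)).mem S₀ rfl
      (fun _ => ∅) fun _ => empty_mem_model
  have hmem : ∀ y, y ∈ fam ↔ ∃ w ∈ M, w ⊆ v ∧ w.Nonempty ∧ img (fun y => pair w y) w = y := by
    intro y
    rw [hfam, mem_img]
    simp only [ZFSet.mem_sep, ZFSet.mem_inter, mem_powerset, and_true]
    constructor
    · rintro ⟨w, ⟨⟨h1, h2⟩, h3⟩, h4⟩
      exact ⟨w, h2, h1, h3, h4⟩
    · rintro ⟨w, h2, h1, h3, h4⟩
      exact ⟨w, ⟨⟨h1, h2⟩, h3⟩, h4⟩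
  have h1 : ∀ y ∈ M, y ∈ fam → ∃ z ∈ M, z ∈ y := by
    intro y hy hyf
    obtain ⟨w, hw, -, ⟨z, hz⟩, rfl⟩ := (hmem y).1 hyf
    exact ⟨_, pair_mem_model hw (mem_of_mem_model hz hw), mem_img.2 ⟨z, hz, rfl⟩⟩
  have h2 : ∀ y ∈ M, y ∈ fam → ∀ y' ∈ M, y' ∈ fam → y ≠ y' → ∀ z ∈ M, z ∈ y → z ∉ y' := by
    intro y hy hyf y' hy' hyf' hne z hz hzy hzy'
    obtain ⟨w, hw, -, -, rfl⟩ := (hmem y).1 hyf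
    obtain ⟨w', hw', -, -, rfl⟩ := (hmem y').1 hyf'
    obtain ⟨x, hx, rfl⟩ := mem_img.1 hzy
    obtain ⟨x', hx', e⟩ := mem_img.1 hzy'
    obtain rfl := (pair_inj.1 e).1
    exact hne rfl
  obtain ⟨c, hc, hcu⟩ := hM.zfc.choice fam hfamM h1 h2
  have hcc := Tm.const (S₀ := S₀) hc
  -- The separated set is a singleton for the relevant `w`, and its union is the chosen element.
  refine ⟨fun w => ⋃₀ (w.sep fun z => pair w z ∈ c), inferInstance, fun w hw hwv hne => ?_⟩
  have hwf : img (fun y => pair w y) w ∈ fam := (hmem _).2 ⟨w, hw, hwv, hne, rfl⟩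
  obtain ⟨z, hz, ⟨hz1, hz2⟩, hzu⟩ := hcu _ (mem_of_mem_model hwf hfamM) hwf
  obtain ⟨y, hy, rfl⟩ := mem_img.1 hz1
  suffices h : (w.sep fun z => pair w z ∈ c) = {y} by
    simpa [h] using hy
  ext x
  rw [ZFSet.mem_sep, ZFSet.mem_singleton]
  constructor
  · rintro ⟨hx, hxc⟩
    exact (pair_inj.1 (hzu (pair w x)
      (pair_mem_model hw (mem_of_mem_model hx hw)) (mem_img.2 ⟨x, hx, rfl⟩) hxc)).2
  · rintro rfl
    exact ⟨hy, hz2⟩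

/-- `f` codes an isomorphism from the ordinal `θ` to `c`, ordered by inclusion. -/
def IsEnum (c θ f : ZFSet.{u}) : Prop :=
  (∀ i ∈ θ, ∃ y ∈ c, pair i y ∈ f) ∧ (∀ y ∈ c, ∃ i ∈ θ, pair i y ∈ f) ∧
    ∀ i ∈ θ, ∀ j ∈ θ, ∀ y ∈ c, ∀ z ∈ c, pair i y ∈ f → pair j z ∈ f → (i ⊆ j ↔ y ⊆ z)

omit hM in
-- Two ordinals enumerating the same inclusion chain assign each member of the chain the same index,
-- by induction on the index. Applied in both directions, this makes the length of a chain unique,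
-- as replacement requires.
theorem IsEnum.subset {c θ θ' f f' : ZFSet.{u}} (hθ : θ.IsOrdinal) (hθ' : θ'.IsOrdinal)
    (h : IsEnum c θ f) (h' : IsEnum c θ' f') : θ ⊆ θ' := by
  have lt_iff : ∀ {α β : ZFSet.{u}}, α.IsOrdinal → β.IsOrdinal → (α ∈ β ↔ ¬ β ⊆ α) :=
    fun hα hβ => (IsOrdinal.not_subset_iff_mem hβ hα).symm
  have key : ∀ i i' y, i ∈ θ → i' ∈ θ' → y ∈ c → pair i y ∈ f → pair i' y ∈ f' → i = i' := by
    intro i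
    induction i using ZFSet.inductionOn with
    | h i ih =>
      intro i' y hi hi' hy hiy hiy'
      ext j
      constructor
      · intro hj
        have hjθ := hθ.mem_trans hj hi
        obtain ⟨z, hz, hjz⟩ := h.1 j hjθ
        obtain ⟨j', hj', hjz'⟩ := h'.2.1 z hz
        obtain rfl := ih j hj j' z hjθ hj' hz hjz hjz'
        rw [lt_iff (hθ.mem hjθ) (hθ'.mem hi'), h'.2.2 _ hi' _ hj' _ hy _ hz hiy' hjz',
          ← h.2.2 _ hi _ hjθ _ hy _ hz hiy hjz, ← lt_iff (hθ.mem hjθ) (hθ.mem hi)]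
        exact hj
      · intro hj
        have hjθ' := hθ'.mem_trans hj hi'
        obtain ⟨z, hz, hjz'⟩ := h'.1 j hjθ'
        obtain ⟨k, hk, hkz⟩ := h.2.1 z hz
        have hki : k ∈ i := by
          rw [lt_iff (hθ.mem hk) (hθ.mem hi), h.2.2 _ hi _ hk _ hy _ hz hiy hkz,
            ← h'.2.2 _ hi' _ hjθ' _ hy _ hz hiy' hjz', ← lt_iff (hθ'.mem hjθ') (hθ'.mem hi')]
          exact hj
        obtain rfl := ih k hki j z hk hjθ' hz hkz hjz'
        exact hki
  intro i hi
  obtain ⟨y, hy, hiy⟩ := h.1 i hi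
  obtain ⟨i', hi', hiy'⟩ := h'.2.1 y hy
  rwa [key i i' y hi hi' hy hiy hiy']

/-- Some ordinal of `M` is too long for a strictly increasing sequence of subsets of `a`. -/
theorem exists_long_ordinal (S₀ : ℕ → Set ZFSet.{u}) [GBWorld M S₀] {a : ZFSet.{u}} (ha : a ∈ M) :
    ∃ θ ∈ M, θ.IsOrdinal ∧ ∀ s : ZFSet.{u} → ZFSet.{u}, (Tm M {S₀} fun _ e => s (e 0)) →
      (∀ i ∈ θ, s i ⊆ a) → ¬ ∀ i ∈ θ, ∀ j ∈ i, s j ⊆ s i ∧ ¬ s i ⊆ s j := by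
  by_contra! hcon
  have hpp : (a.powerset ∩ M).powerset ∩ M ∈ M :=
    exists_powerset_mem_model (exists_powerset_mem_model ha)
  have hQ : Df M {S₀} fun _ e => (e 1).IsOrdinal ∧ ∃ f ∈ M, IsEnum (e 0) (e 1) f := by
    unfold IsEnum
    infer_instance
  -- As in Hartogs' argument, `b` is the set of all ordinals that enumerate, by a set of `M`, a
  -- chain of subsets of `a`.
  obtain ⟨b, hb, hb'⟩ := replacement_rel S₀
    (Q := fun c θ => θ.IsOrdinal ∧ ∃ f ∈ M, IsEnum c θ f) hpp hQ
    fun c _ θ _ θ' _ ⟨h1, f, _, h2⟩ ⟨h1', f', _, h2'⟩ =>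
      subset_antisymm (h2.subset h1 h1' h2') (h2'.subset h1' h1 h2)
  -- A strictly increasing sequence of length `rk b` would put `rk b` into `b`, although both have
  -- the same rank.
  refine (rank_lt_of_mem (x := b) (y := rk b) ?_).ne (rank_rk b)
  have hθ := isOrdinal_rk b
  have hθM := rk_mem_model S₀ hb
  obtain ⟨s, hs, hsa, hmono⟩ := hcon _ hθM hθ
  have hs' : ∀ f [Tm M {S₀} f], Tm M {S₀} fun S e => s (f S e) := fun _ hf => hs.subst₁ hf
  have hθ' := Tm.const (S₀ := S₀) hθM
  have hiff : ∀ i ∈ rk b, ∀ j ∈ rk b, i ⊆ j ↔ s i ⊆ s j := by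
    intro i hi j hj
    constructor
    · intro hij
      rcases ((hθ.mem hi).subset_iff_eq_or_mem (hθ.mem hj)).1 hij with rfl | hij
      exacts [fun _ h => h, (hmono j hj i hij).1]
    · intro hij
      by_contra hn
      exact (hmono i hi j ((IsOrdinal.not_subset_iff_mem (hθ.mem hi) (hθ.mem hj)).1 hn)).2 hij
  have hsM : ∀ i ∈ rk b, s i ∈ M := fun i hi => hs.apply_mem (mem_of_mem_model hi hθM)
  have himg : img s (rk b) ∈ M := (tm_img hs (Tm.const hθM)).mem S₀ rfl (fun _ => ∅)
    fun _ => empty_mem_model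
  have hgr : gr s (rk b) ∈ M := (tm_gr hs (Tm.const hθM)).mem S₀ rfl (fun _ => ∅)
    fun _ => empty_mem_model
  refine (hb' _).2 ⟨hθM, img s (rk b), ?_, hθ, gr s (rk b), hgr, ?_, ?_, ?_⟩
  · rw [ZFSet.mem_inter, mem_powerset]
    refine ⟨fun z hz => ?_, himg⟩
    obtain ⟨i, hi, rfl⟩ := mem_img.1 hz
    rw [ZFSet.mem_inter, mem_powerset]
    exact ⟨hsa i hi, hsM i hi⟩
  · exact fun i hi => ⟨s i, mem_img.2 ⟨i, hi, rfl⟩, pair_mem_gr.2 ⟨hi, rfl⟩⟩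
  · intro y hy
    obtain ⟨i, hi, rfl⟩ := mem_img.1 hy
    exact ⟨i, hi, pair_mem_gr.2 ⟨hi, rfl⟩⟩
  · intro i hi j hj y _ z _ hy hz
    obtain ⟨-, rfl⟩ := pair_mem_gr.1 hy
    obtain ⟨-, rfl⟩ := pair_mem_gr.1 hz
    exact hiff i hi j hj

end World

/-! ### The forcing notion and its distributivity -/

/-- The domain of a relation. -/
noncomputable def dom (p : ZFSet.{u}) : ZFSet.{u} :=
  (⋃₀ (⋃₀ p : ZFSet.{u}) : ZFSet.{u}).sep fun β => ∃ y, pair β y ∈ p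

theorem mem_dom {p β : ZFSet.{u}} : β ∈ dom p ↔ ∃ y, pair β y ∈ p := by
  rw [dom, ZFSet.mem_sep, and_iff_right_iff_imp]
  rintro ⟨y, h⟩
  exact mem_sUnion.2 ⟨{β}, mem_sUnion.2 ⟨_, h, by simp [pair]⟩, by simp⟩

theorem dom_subset {p q : ZFSet.{u}} (h : p ⊆ q) : dom p ⊆ dom q := by
  intro β hβ
  obtain ⟨y, hy⟩ := mem_dom.1 hβ
  exact mem_dom.2 ⟨y, h hy⟩

theorem dom_gr (g : ZFSet.{u} → ZFSet.{u}) (α : ZFSet.{u}) : dom (gr g α) = α := by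
  ext β
  simp [mem_dom, pair_mem_gr]

/-- The conditions: functions in `M` from an ordinal to `M`. They are ordered by inclusion. -/
structure IsCond (M p : ZFSet.{u}) : Prop where
  mem : p ∈ M
  ordinal : (dom p).IsOrdinal
  rel : ∀ t ∈ p, ∃ β y, t = pair β y
  func : ∀ β y y', pair β y ∈ p → pair β y' ∈ p → y = y'

section TransModel

variable {M : ZFSet.{u}} [hM : TransModel M]

theorem isCond_iff {p : ZFSet.{u}} (hp : p ∈ M) : IsCond M p ↔ (dom p).IsOrdinal ∧
    (∀ t ∈ p, ∃ β ∈ M, ∃ y ∈ M, t = pair β y) ∧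
      ∀ β ∈ M, ∀ y ∈ M, ∀ y' ∈ M, pair β y ∈ p → pair β y' ∈ p → y = y' := by
  constructor
  · rintro ⟨-, h1, h2, h3⟩
    refine ⟨h1, fun t ht => ?_, fun β _ y _ y' _ => h3 β y y'⟩
    obtain ⟨β, y, rfl⟩ := h2 t ht
    obtain ⟨hβ, hy⟩ := of_pair_mem_model (mem_of_mem_model ht hp)
    exact ⟨β, hβ, y, hy, rfl⟩
  · rintro ⟨h1, h2, h3⟩
    refine ⟨hp, h1, fun t ht => ?_, fun β y y' h h' => ?_⟩
    · obtain ⟨β, -, y, -, rfl⟩ := h2 t ht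
      exact ⟨β, y, rfl⟩
    · obtain ⟨hβ, hy⟩ := of_pair_mem_model (mem_of_mem_model h hp)
      exact h3 β hβ y hy y' (of_pair_mem_model (mem_of_mem_model h' hp)).2 h h'

theorem isCond_empty : IsCond M ∅ := by
  have : dom (∅ : ZFSet.{u}) = ∅ := by ext; simp [mem_dom]
  exact ⟨empty_mem_model, by rw [this]; exact isOrdinal_empty, by simp, by simp⟩

theorem isCond_sUnion {c : ZFSet.{u}} (hcM : c ∈ M) (hc : ∀ p ∈ c, IsCond M p)
    (hchain : ∀ p ∈ c, ∀ q ∈ c, p ⊆ q ∨ q ⊆ p) : IsCond M (⋃₀ c : ZFSet.{u}) := by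
  have hdom : dom (⋃₀ c : ZFSet.{u}) = ⋃₀ img dom c := by
    ext β
    simp only [mem_dom, mem_sUnion, mem_img]
    constructor
    · rintro ⟨y, p, hp, hy⟩
      exact ⟨_, ⟨p, hp, rfl⟩, mem_dom.2 ⟨y, hy⟩⟩
    · rintro ⟨_, ⟨p, hp, rfl⟩, hβ⟩
      obtain ⟨y, hy⟩ := mem_dom.1 hβ
      exact ⟨y, p, hp, hy⟩
  refine ⟨sUnion_mem_model hcM, ?_, fun t ht => ?_, fun β y y' h h' => ?_⟩
  · rw [hdom]
    refine isOrdinal_sUnion fun z hz => ?_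
    obtain ⟨p, hp, rfl⟩ := mem_img.1 hz
    exact (hc p hp).ordinal
  · obtain ⟨p, hp, ht⟩ := mem_sUnion.1 ht
    exact (hc p hp).rel t ht
  · obtain ⟨p, hp, h⟩ := mem_sUnion.1 h
    obtain ⟨q, hq, h'⟩ := mem_sUnion.1 h'
    rcases hchain p hp q hq with hpq | hpq
    · exact (hc q hq).func β y y' (hpq h) h'
    · exact (hc p hp).func β y y' h (hpq h')

theorem IsCond.dom_mem {p : ZFSet.{u}} (hp : IsCond M p) (S₀ : ℕ → Set ZFSet.{u})
    [GBWorld M S₀] : dom p ∈ M := by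
  have h := Tm.const (S₀ := S₀) hp.mem
  convert! separation S₀ (R := fun β => ∃ y ∈ M, pair β y ∈ p)
    (sUnion_mem_model (sUnion_mem_model hp.mem)) inferInstance using 1
  ext β
  rw [dom, ZFSet.mem_sep, ZFSet.mem_sep]
  refine and_congr_right fun _ => ⟨?_, ?_⟩
  · rintro ⟨y, hy⟩
    exact ⟨y, (of_pair_mem_model (mem_of_mem_model hy hp.mem)).2, hy⟩
  · rintro ⟨y, -, hy⟩
    exact ⟨y, hy⟩

theorem dom_insert (p β y : ZFSet.{u}) : dom (insert (pair β y) p) = insert β (dom p) := by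
  ext γ
  simp only [mem_dom, mem_insert_iff, pair_inj]
  constructor
  · rintro ⟨z, ⟨rfl, rfl⟩ | h⟩
    exacts [.inl rfl, .inr ⟨z, h⟩]
  · rintro (rfl | ⟨z, h⟩)
    exacts [⟨y, .inl ⟨rfl, rfl⟩⟩, ⟨z, .inr h⟩]

/-- Appending a value to a condition. -/
theorem IsCond.snoc {p y : ZFSet.{u}} (hp : IsCond M p) (hd : dom p ∈ M) (hy : y ∈ M) :
    IsCond M (insert (pair (dom p) y) p) := by
  have hnot : ∀ z, pair (dom p) z ∉ p := fun z hz => mem_irrefl _ (mem_dom.2 ⟨z, hz⟩)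
  refine ⟨insert_mem_model (pair_mem_model hd hy) hp.mem, ?_, fun t ht => ?_, fun β z z' h h' => ?_⟩
  · rw [dom_insert]
    exact isOrdinal_succ hp.ordinal
  · rcases mem_insert_iff.1 ht with rfl | ht
    exacts [⟨_, _, rfl⟩, hp.rel t ht]
  · rcases mem_insert_iff.1 h with e | h <;> rcases mem_insert_iff.1 h' with e' | h'
    · rw [(pair_inj.1 e).2, (pair_inj.1 e').2]
    · rw [(pair_inj.1 e).1] at h'
      exact (hnot _ h').elim
    · rw [(pair_inj.1 e').1] at h
      exact (hnot _ h).elim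
    · exact hp.func β z z' h h'

end TransModel

/-! ### Prolongation and distributivity -/

section World

variable {M : ZFSet.{u}} [hM : TransModel M] {S₀ : ℕ → Set ZFSet.{u}} [hW : GBWorld M S₀]
  {f g : (ℕ → Set ZFSet.{u}) → (ℕ → ZFSet.{u}) → ZFSet.{u}}

instance tm_dom [hf : Tm M {S₀} f] : Tm M {S₀} fun S e => dom (f S e) := by
  have h : Tm M {S₀} fun _ e => (⋃₀ (⋃₀ (e 0) : ZFSet.{u}) : ZFSet.{u}).sep
    fun β => ∃ y ∈ M, pair β y ∈ e 0 := inferInstance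
  have hd : ∀ p ∈ M, dom p = (⋃₀ (⋃₀ p : ZFSet.{u}) : ZFSet.{u}).sep
      fun β => ∃ y ∈ M, pair β y ∈ p := by
    intro p hp
    ext β
    rw [dom, ZFSet.mem_sep, ZFSet.mem_sep]
    refine and_congr_right fun _ => ⟨?_, ?_⟩
    · rintro ⟨y, hy⟩
      exact ⟨y, (of_pair_mem_model (mem_of_mem_model hy hp)).2, hy⟩
    · rintro ⟨y, -, hy⟩
      exact ⟨y, hy⟩
  refine Tm.subst₁ (t := dom) ⟨fun S hS e he => ?_, h.graph.congr fun S hS e he => ?_⟩ hf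
  · rw [hd _ (he 0)]
    exact h.mem S hS e he
  · rw [hd _ (he 1)]

instance df_isCond [hf : Tm M {S₀} f] : Df M {S₀} fun S e => IsCond M (f S e) :=
  Df.subst₁ (Q := fun _ x => IsCond M x) ((inferInstance : Df M {S₀} fun _ e =>
    (dom (e 0)).IsOrdinal ∧ (∀ t ∈ e 0, ∃ β ∈ M, ∃ y ∈ M, t = pair β y) ∧
      ∀ β ∈ M, ∀ y ∈ M, ∀ y' ∈ M, pair β y ∈ e 0 → pair β y' ∈ e 0 → y = y').congr
      fun _ _ _ he => isCond_iff (he 0)) hf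

/-- Conditions can be prolonged to any given length. -/
theorem IsCond.exists_dom_eq (S₀ : ℕ → Set ZFSet.{u}) [GBWorld M S₀] {p γ : ZFSet.{u}}
    (hp : IsCond M p) (hγ : γ ∈ M) (hγo : γ.IsOrdinal) (h : dom p ⊆ γ) :
    ∃ q, IsCond M q ∧ p ⊆ q ∧ dom q = γ := by
  have h1 := Tm.const (S₀ := S₀) hγ
  have h2 := Tm.const (S₀ := S₀) hp.mem
  -- The missing places are filled with the value `∅`.
  set z := img (fun β => pair β ∅) (γ.sep fun β => β ∉ dom p) with hz
  have hzM : z ∈ M := (inferInstance : Tm M {S₀} fun _ _ =>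
    img (fun β => pair β ∅) (γ.sep fun β => β ∉ dom p)).mem S₀ rfl (fun _ => ∅)
    fun _ => empty_mem_model
  have hmem : ∀ {β y}, pair β y ∈ z ↔ (β ∈ γ ∧ β ∉ dom p) ∧ y = ∅ := by
    intro β y
    simp only [hz, mem_img, ZFSet.mem_sep, pair_inj]
    constructor
    · rintro ⟨_, h, rfl, rfl⟩
      exact ⟨h, rfl⟩
    · rintro ⟨h, rfl⟩
      exact ⟨β, h, rfl, rfl⟩
  have hdom : dom (p ∪ z) = γ := by
    ext β
    simp only [mem_dom, ZFSet.mem_union, hmem]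
    constructor
    · rintro ⟨y, hy | ⟨⟨hβ, -⟩, -⟩⟩
      exacts [h (mem_dom.2 ⟨y, hy⟩), hβ]
    · intro hβ
      by_cases hd : ∃ y, pair β y ∈ p
      · obtain ⟨y, hy⟩ := hd
        exact ⟨y, .inl hy⟩
      · exact ⟨∅, .inr ⟨⟨hβ, hd⟩, rfl⟩⟩
  refine ⟨p ∪ z, ⟨union_mem_model hp.mem hzM, by rwa [hdom], fun t ht => ?_,
    fun β y y' h h' => ?_⟩, fun t ht => mem_union.2 (.inl ht), hdom⟩
  · rcases mem_union.1 ht with ht | ht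
    · exact hp.rel t ht
    · obtain ⟨β, _, rfl⟩ := mem_img.1 ht
      exact ⟨_, _, rfl⟩
  · rcases mem_union.1 h with h | h <;> rcases mem_union.1 h' with h' | h'
    · exact hp.func β y y' h h'
    · exact ((hmem.1 h').1.2 (mem_dom.2 ⟨y, h⟩)).elim
    · exact ((hmem.1 h).1.2 (mem_dom.2 ⟨y', h'⟩)).elim
    · rw [(hmem.1 h).2, (hmem.1 h').2]

/-- Density in the forcing notion. -/
def IsDense (M : ZFSet.{u}) (D : ZFSet.{u} → Prop) : Prop :=
  ∀ p, IsCond M p → ∃ q, IsCond M q ∧ p ⊆ q ∧ D q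

/-- Openness in the forcing notion. -/
def IsOpenCond (M : ZFSet.{u}) (D : ZFSet.{u} → Prop) : Prop :=
  ∀ p q, IsCond M p → IsCond M q → p ⊆ q → D p → D q

/-- The intersection of set many dense open classes is dense. -/
theorem isDense_forall {a : ZFSet.{u}} (ha : a ∈ M) {D : ZFSet.{u} → ZFSet.{u} → Prop}
    (hD : Df M {S₀} fun _ e => D (e 0) (e 1)) (hopen : ∀ x ∈ a, IsOpenCond M (D x))
    (hdense : ∀ x ∈ a, IsDense M (D x)) : IsDense M fun q => ∀ x ∈ a, D x q := by
  intro p0 hp0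
  by_contra! hno
  have hD' : ∀ f g [Tm M {S₀} f] [Tm M {S₀} g], Df M {S₀} fun S e => D (f S e) (g S e) :=
    fun _ _ hf hg => Df.subst₂ (Q := fun _ x y => D x y) hD hf hg
  have ha' := Tm.const (S₀ := S₀) ha
  have hp0' := Tm.const (S₀ := S₀) hp0.mem
  -- If `p0` has no extension in all the `D x`, then an increasing sequence of conditions can enter
  -- a new `D x` at every step. Continued for θ steps, it gives a strictly increasing sequence of
  -- subsets of `a` that is too long.
  obtain ⟨θ, hθM, hθ, hlong⟩ := exists_long_ordinal S₀ ha
  -- the bounds for the extensions that are needed at each step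
  set k : ZFSet.{u} → ZFSet.{u} := fun w => vM M (⋃₀ img (fun p => ⋃₀ img (fun x =>
    insert (leastRank M fun q => IsCond M q ∧ p ⊆ q ∧ D x q)
      (leastRank M fun q => IsCond M q ∧ p ⊆ q ∧ D x q)) a) ((⋃₀ w : ZFSet.{u}).powerset ∩ M))
    with hk
  have hkTm : Tm M {S₀} fun _ e => k (e 0) := by
    simp only [hk]
    infer_instance
  have hkspec : ∀ w p x, IsCond M p → p ⊆ ⋃₀ w → x ∈ a →
      ∃ q ∈ k w, IsCond M q ∧ p ⊆ q ∧ D x q := by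
    intro w p x hp hpw hx
    obtain ⟨q0, hq0, hpq0, hDq0⟩ := hdense x hx p hp
    obtain ⟨q, hqM, hq, -, e⟩ := exists_leastRank (M := M)
      (R := fun q => IsCond M q ∧ p ⊆ q ∧ D x q) ⟨q0, hq0.mem, hq0, hpq0, hDq0⟩
    refine ⟨q, (mem_vM hM.trans ?_).2 ⟨hqM, ?_⟩, hq⟩
    · refine isOrdinal_sUnion fun z hz => ?_
      obtain ⟨p, -, rfl⟩ := mem_img.1 hz
      refine isOrdinal_sUnion fun z hz => ?_
      obtain ⟨x, -, rfl⟩ := mem_img.1 hz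
      exact isOrdinal_succ (isOrdinal_leastRank _)
    · rw [← rank_rk q, ← e]
      refine rank_lt_of_mem (mem_sUnion.2 ⟨_, mem_img.2 ⟨p, ?_, rfl⟩,
        mem_sUnion.2 ⟨_, mem_img.2 ⟨x, hx, rfl⟩, by simp⟩⟩)
      rw [ZFSet.mem_inter, mem_powerset]
      exact ⟨hpw, hp.mem⟩
  -- No choices are made here: `U i` contains enough conditions for the first `i` steps, whichever
  -- are picked. Hence `U θ` is a set known in advance, and a single choice function for its subsets
  -- suffices.
  set U := unionRec {p0} k with hU
  have hUTm : ∀ f [Tm M {S₀} f], Tm M {S₀} fun S e => U (f S e) := fun _ hf =>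
    tm_unionRec (singleton_mem_model hp0.mem) hkTm hf
  have hkTm' : ∀ f [Tm M {S₀} f], Tm M {S₀} fun S e => k (f S e) := fun _ hf => hkTm.subst₁ hf
  have hUθ : U θ ∈ M := (hUTm (fun _ e => e 0)).mem S₀ rfl (fun _ => θ) fun _ => hθM
  obtain ⟨ch, hch, hchs⟩ := exists_choiceFunction S₀ hUθ
  have hch' : ∀ f [Tm M {S₀} f], Tm M {S₀} fun S e => ch (f S e) := fun _ hf => hch.subst₁ hf
  -- the recursive construction of the sequence of conditions
  set base : ZFSet.{u} → ZFSet.{u} := fun f => p0 ∪ ⋃₀ img snd f with hbase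
  set cand : ZFSet.{u} → ZFSet.{u} := fun f => (k (U (dom f))).sep fun q =>
    IsCond M q ∧ base f ⊆ q ∧ ∃ x ∈ a, ¬ D x (base f) ∧ D x q with hcand
  have hH : Tm M {S₀} fun _ e => ch (cand (e 0)) := by
    simp only [hcand, hbase]
    infer_instance
  set P := ordRec fun f => ch (cand f) with hP
  have hPTm : ∀ f [Tm M {S₀} f], Tm M {S₀} fun S e => P (f S e) := fun _ hf => tm_ordRec hH hf
  have hbaseTm : Tm M {S₀} fun _ e => base (e 0) := by
    simp only [hbase]
    infer_instance
  have mem_base : ∀ i z, z ∈ base (gr P i) ↔ z ∈ p0 ∨ ∃ j ∈ i, z ∈ P j := by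
    intro i z
    simp [hbase, mem_gr]
  have hsub : ∀ i ∈ θ, k (U i) ⊆ U θ := fun i hi z hz => (mem_unionRec hθ).2 (.inr ⟨i, hi, hz⟩)
  have key : ∀ i, i ∈ θ → IsCond M (base (gr P i)) ∧ P i ∈ cand (gr P i) := by
    intro i
    induction i using ZFSet.inductionOn with
    | h i ih =>
      intro hi
      have hio := hθ.mem hi
      have hiM := mem_of_mem_model hi hθM
      have ih' : ∀ j ∈ i, IsCond M (P j) ∧ base (gr P j) ⊆ P j ∧ P j ∈ k (U j) := by
        intro j hj
        have := (ih j hj (hθ.mem_trans hj hi)).2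
        simp only [hcand, ZFSet.mem_sep, dom_gr] at this
        exact ⟨this.2.1, this.2.2.1, this.1⟩
      have hlt : ∀ j ∈ i, ∀ j' ∈ j, P j' ⊆ P j := fun j hj j' hj' z hz =>
        (ih' j hj).2.1 ((mem_base j z).2 (.inr ⟨j', hj', hz⟩))
      have hbeq : base (gr P i) = ⋃₀ insert p0 (img P i) := by
        ext z
        simp [mem_base]
      have himg : img P i ∈ M := (hPTm (fun _ e => e 0) |> fun h => tm_img h (Tm.const hiM)).mem S₀ rfl
        (fun _ => ∅) fun _ => empty_mem_model
      have hcond : IsCond M (base (gr P i)) := by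
        rw [hbeq]
        refine isCond_sUnion (insert_mem_model hp0.mem himg) ?_ ?_
        · intro p hp
          rcases mem_insert_iff.1 hp with rfl | hp
          · exact hp0
          · obtain ⟨j, hj, rfl⟩ := mem_img.1 hp
            exact (ih' j hj).1
        · have h0 : ∀ j ∈ i, p0 ⊆ P j := fun j hj z hz =>
            (ih' j hj).2.1 ((mem_base j z).2 (.inl hz))
          intro p hp q hq
          rcases mem_insert_iff.1 hp with rfl | hp <;> rcases mem_insert_iff.1 hq with rfl | hq
          · exact .inl fun _ h => h
          · obtain ⟨j, hj, rfl⟩ := mem_img.1 hq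
            exact .inl (h0 j hj)
          · obtain ⟨j, hj, rfl⟩ := mem_img.1 hp
            exact .inr (h0 j hj)
          · obtain ⟨j, hj, rfl⟩ := mem_img.1 hp
            obtain ⟨j', hj', rfl⟩ := mem_img.1 hq
            rcases (hio.mem hj).mem_trichotomous (hio.mem hj') with h | rfl | h
            · exact .inl (hlt j' hj' j h)
            · exact .inl fun _ h => h
            · exact .inr (hlt j hj j' h)
      refine ⟨hcond, ?_⟩
      rw [hP, ordRec_of_isOrdinal _ hio, ← hP]
      have hgrM : gr P i ∈ M := (hPTm (fun _ e => e 0) |> fun h => tm_gr h (Tm.const hiM)).mem S₀ rfl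
        (fun _ => ∅) fun _ => empty_mem_model
      refine hchs _ ?_ ?_ ?_
      · have hcTm : Tm M {S₀} fun _ e => cand (e 0) := by
          simp only [hcand, hbase]
          infer_instance
        exact hcTm.apply_mem hgrM
      · intro q hq
        simp only [hcand, ZFSet.mem_sep, dom_gr] at hq
        exact hsub i hi hq.1
      · obtain ⟨x, hx, hxD⟩ := hno _ hcond fun z hz => (mem_base i z).2 (.inl hz)
        have hbU : base (gr P i) ⊆ ⋃₀ U i := by
          intro z hz
          rcases (mem_base i z).1 hz with hz | ⟨j, hj, hz⟩
          · exact mem_sUnion.2 ⟨p0, (mem_unionRec hio).2 (.inl (by simp)), hz⟩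
          · exact mem_sUnion.2 ⟨P j, (mem_unionRec hio).2 (.inr ⟨j, hj, (ih' j hj).2.2⟩), hz⟩
        obtain ⟨q, hq, hqc, hbq, hDq⟩ := hkspec (U i) _ x hcond hbU hx
        have hq' : q ∈ cand (gr P i) := by
          simp only [hcand, ZFSet.mem_sep, dom_gr]
          exact ⟨hq, hqc, hbq, x, hx, hxD, hDq⟩
        exact ⟨q, hq'⟩
  -- Openness makes these sets increase. At step `i` an index `x` is added for which `base (gr P
  -- i)`, and hence every earlier `P j`, is outside `D x`.
  refine hlong (fun i => a.sep fun x => D x (P i)) inferInstance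
    (fun i _ => sep_subset) fun i hi j hj => ?_
  have hjθ := hθ.mem_trans hj hi
  have hi' := key i hi
  have hj' := (key j hjθ).2
  simp only [hcand, ZFSet.mem_sep, dom_gr] at hi' hj'
  obtain ⟨hbc, -, hic, hbi, x, hx, hxb, hxi⟩ := hi'
  have hjb : P j ⊆ base (gr P i) := fun z hz => (mem_base i z).2 (.inr ⟨j, hj, hz⟩)
  constructor
  · intro y hy
    obtain ⟨hya, hyD⟩ := ZFSet.mem_sep.1 hy
    exact ZFSet.mem_sep.2 ⟨hya, hopen y hya _ _ hj'.2.1 hic (fun z hz => hbi (hjb hz)) hyD⟩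
  · intro hss
    have := (ZFSet.mem_sep.1 (hss (ZFSet.mem_sep.2 ⟨hx, hxi⟩))).2
    exact hxb (hopen x hx _ _ hj'.2.1 hbc hjb this)

end World

/-! ### Forcing -/

/-- The class environment `S₀` with the class `C` pushed in front. -/
def classCons (C : Set ZFSet.{u}) (S₀ : ℕ → Set ZFSet.{u}) : ℕ → Set ZFSet.{u}
  | 0 => C
  | j + 1 => S₀ j

/-- The weak forcing relation for elementary formulas, where the first class variable stands for
the generic class and the other ones for the classes `S₀`. -/
def Forces (M : ZFSet.{u}) (S₀ : ℕ → Set ZFSet.{u}) :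
    {n k : ℕ} → ClassFormula n k → (Fin n → ZFSet.{u}) → ZFSet.{u} → Prop
  | _, _, .mem i j, a, _ => a i ∈ a j
  | _, _, .eq i j, a, _ => a i = a j
  -- Membership in the generic class is forced when it holds densely below `p`. No names occur,
  -- since set variables range over `M` itself.
  | _, _, .memC i j, a, p => Nat.casesOn (motive := fun _ => Prop) (j : ℕ)
      (∀ q ∈ M, IsCond M q → p ⊆ q → ∃ r ∈ M, IsCond M r ∧ q ⊆ r ∧ a i ∈ r) fun j => a i ∈ S₀ j
  | _, _, .neg φ, a, p => ∀ q ∈ M, IsCond M q → p ⊆ q → ¬ Forces M S₀ φ a q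
  | _, _, .and φ ψ, a, p => Forces M S₀ φ a p ∧ Forces M S₀ ψ a p
  | _, _, .all φ, a, p => ∀ x ∈ M, Forces M S₀ φ (Fin.snoc (α := fun _ => ZFSet.{u}) a x) p
  | _, _, .allC _, _, _ => False

section Basic

variable {M : ZFSet.{u}} {S₀ : ℕ → Set ZFSet.{u}}

theorem Forces.mono : ∀ {n k : ℕ} {φ : ClassFormula n k} {a : Fin n → ZFSet.{u}}
    {p q : ZFSet.{u}}, p ⊆ q → Forces M S₀ φ a p → Forces M S₀ φ a q
  | _, _, .mem _ _, _, _, _, _, h => h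
  | _, _, .eq _ _, _, _, _, _, h => h
  | _, _, .memC _ ⟨0, _⟩, _, _, _, hpq, h => fun r hr hrc hqr => h r hr hrc fun _ hz => hqr (hpq hz)
  | _, _, .memC _ ⟨_ + 1, _⟩, _, _, _, _, h => h
  | _, _, .neg _, _, _, _, hpq, h => fun r hr hrc hqr => h r hr hrc fun _ hz => hqr (hpq hz)
  | _, _, .and _ _, _, _, _, hpq, h => ⟨h.1.mono hpq, h.2.mono hpq⟩
  | _, _, .all _, _, _, _, hpq, h => fun x hx => (h x hx).mono hpq
  | _, _, .allC _, _, _, _, _, h => h.elim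

/-- This is the characteristic property of weak forcing. In the truth lemma it converts the absence
of an extension ruling out an instance into the forcing of all instances. -/
theorem Forces.of_dense : ∀ {n k : ℕ} {φ : ClassFormula n k}, φ.IsElementary →
    ∀ {a : Fin n → ZFSet.{u}} {p : ZFSet.{u}}, IsCond M p →
    (∀ q ∈ M, IsCond M q → p ⊆ q → ∃ r ∈ M, IsCond M r ∧ q ⊆ r ∧ Forces M S₀ φ a r) →
    Forces M S₀ φ a p
  | _, _, .mem _ _, _, _, p, hp, h => (h p hp.mem hp fun _ hz => hz).elim fun _ h => h.2.2.2
  | _, _, .eq _ _, _, _, p, hp, h => (h p hp.mem hp fun _ hz => hz).elim fun _ h => h.2.2.2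
  | _, _, .memC i ⟨0, _⟩, _, _, p, _, h => fun q hq hqc hpq => by
    obtain ⟨r, hr, hrc, hqr, h⟩ := h q hq hqc hpq
    obtain ⟨s, hs, hsc, hrs, h⟩ := h r hr hrc fun _ hz => hz
    exact ⟨s, hs, hsc, fun _ hz => hrs (hqr hz), h⟩
  | _, _, .memC i ⟨j + 1, _⟩, _, _, p, hp, h => (h p hp.mem hp fun _ hz => hz).elim fun _ h => h.2.2.2
  | _, _, .neg φ, _, _, p, _, h => fun q hq hqc hpq hf => by
    obtain ⟨r, hr, hrc, hqr, h⟩ := h q hq hqc hpq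
    exact h r hr hrc (fun _ hz => hz) (hf.mono hqr)
  | _, _, .and φ ψ, he, _, p, hp, h =>
    ⟨of_dense (φ := φ) he.1 hp fun q hq hqc hpq =>
        (h q hq hqc hpq).imp fun _ h => ⟨h.1, h.2.1, h.2.2.1, h.2.2.2.1⟩,
      of_dense (φ := ψ) he.2 hp fun q hq hqc hpq =>
        (h q hq hqc hpq).imp fun _ h => ⟨h.1, h.2.1, h.2.2.1, h.2.2.2.2⟩⟩
  | _, _, .all φ, he, _, p, hp, h => fun x hx =>
    of_dense (φ := φ) he hp fun q hq hqc hpq =>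
      (h q hq hqc hpq).imp fun _ h => ⟨h.1, h.2.1, h.2.2.1, h.2.2.2 x hx⟩
  | _, _, .allC _, h, _, _, _, _ => h.elim

end Basic

/-! ### Definability of forcing and the truth lemma -/

section World

variable {M : ZFSet.{u}} [hM : TransModel M] {S₀ : ℕ → Set ZFSet.{u}} [hW : GBWorld M S₀]

/-- Each clause quantifies only over conditions and elements of `M`, so for a fixed formula the
definition unfolds by induction on the formula. -/
theorem df_forces_var : ∀ {n k : ℕ} (φ : ClassFormula n k) (ρ : Fin n → ℕ) (i : ℕ),
    Df M {S₀} fun _ e => Forces M S₀ φ (fun j => e (ρ j)) (e i)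
  | _, _, .mem i j, ρ, _ => Df.var_mem (ρ i) (ρ j)
  | _, _, .eq i j, ρ, _ => Df.var_eq (ρ i) (ρ j)
  | _, _, .memC i ⟨0, _⟩, ρ, l => (inferInstance : Df M {S₀} fun _ e =>
    ∀ q ∈ M, IsCond M q → e l ⊆ q → ∃ r ∈ M, IsCond M r ∧ q ⊆ r ∧ e (ρ i) ∈ r)
  | _, _, .memC i ⟨j + 1, _⟩, ρ, _ =>
    have := Cl.of_mem (M := M) (S₀ := S₀) ⟨j, rfl⟩
    (inferInstance : Df M {S₀} fun _ e => e (ρ i) ∈ S₀ j)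
  | _, _, .neg φ, ρ, l => by
    have := df_forces_var φ (fun j => ρ j + 1) 0
    exact (inferInstance : Df M {S₀} fun _ e =>
      ∀ q ∈ M, IsCond M q → e l ⊆ q → ¬ Forces M S₀ φ (fun j => e (ρ j)) q)
  | _, _, .and φ ψ, ρ, l => @Df.and _ _ _ _ (df_forces_var φ ρ l) (df_forces_var ψ ρ l)
  | n, _, .all φ, ρ, l => by
    refine @Df.all _ _ (fun _ e x => Forces M S₀ φ (Fin.snoc (α := fun _ => ZFSet.{u})
      (fun i => e (ρ i)) x) (e l)) ?_
    refine (df_forces_var φ (Fin.snoc (α := fun _ => ℕ) (fun i => ρ i + 1) 0) (l + 1)).congr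
      fun S _ e _ => ?_
    refine iff_of_eq (congrArg (Forces M S₀ φ · _) (funext fun i => ?_))
    refine Fin.lastCases ?_ (fun i => ?_) i <;> simp
  | _, _, .allC _, _, _ => Df.const False

theorem df_forces {n k : ℕ} (φ : ClassFormula n k)
    {t : Fin n → (ℕ → Set ZFSet.{u}) → (ℕ → ZFSet.{u}) → ZFSet.{u}}
    {f : (ℕ → Set ZFSet.{u}) → (ℕ → ZFSet.{u}) → ZFSet.{u}} (ht : ∀ i, Tm M {S₀} (t i))
    (hf : Tm M {S₀} f) : Df M {S₀} fun S e => Forces M S₀ φ (fun j => t j S e) (f S e) := by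
  refine ((df_forces_var φ (fun j => j + 1) 0).subst_all
    (t := fun i => Nat.casesOn i f fun i => if h : i < n then t ⟨i, h⟩ else f) ?_).congr
      fun S _ e _ => ?_
  · rintro (_ | i)
    · exact hf
    · by_cases h : i < n
      · simpa [h] using ht ⟨i, h⟩
      · simpa [h] using hf
  · simp

/-- `P` is an increasing sequence of conditions that meets all dense open classes of the world. -/
structure IsGenericSeq (M : ZFSet.{u}) (S₀ : ℕ → Set ZFSet.{u}) (P : ℕ → ZFSet.{u}) : Prop where
  cond : ∀ n, IsCond M (P n)
  mono : ∀ m n, m ≤ n → P m ⊆ P n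
  generic : ∀ D : ZFSet.{u} → Prop, (Df M {S₀} fun _ e => D (e 0)) → IsDense M D →
    IsOpenCond M D → ∃ n, D (P n)

/-- The generic class. -/
def genericClass (P : ℕ → ZFSet.{u}) : Set ZFSet.{u} := {z | ∃ n, z ∈ P n}

variable {P : ℕ → ZFSet.{u}}

/-- The truth lemma. -/
theorem IsGenericSeq.truth (hP : IsGenericSeq M S₀ P) : ∀ {n k : ℕ} {φ : ClassFormula n k},
    φ.IsElementary → ∀ {a : Fin n → ZFSet.{u}}, (∀ i, a i ∈ M) →
    (SatSet M φ a (fun j => classCons (genericClass P) S₀ j) ↔ ∃ m, Forces M S₀ φ a (P m))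
  | _, _, .mem _ _, _, _, _ => by simp [SatSet, ClassFormula.Realize, Forces]
  | _, _, .eq _ _, _, _, _ => by simp [SatSet, ClassFormula.Realize, Forces]
  | _, _, .memC i ⟨0, _⟩, _, a, ha => by
    have := Tm.const (S₀ := S₀) (ha i)
    constructor
    · rintro ⟨m, hm⟩
      exact ⟨m, fun q hq hqc hpq => ⟨q, hq, hqc, fun _ hz => hz, hpq hm⟩⟩
    · rintro ⟨m, hm⟩
      -- The conditions that contain the element or have no extension containing it form a dense
      -- open class. The second alternative contradicts `hm` at a common later stage.
      obtain ⟨l, hl⟩ := hP.generic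
        (fun q => a i ∈ q ∨ ∀ r ∈ M, IsCond M r → q ⊆ r → a i ∉ r) inferInstance
        (fun p hp => by
          by_cases h : ∃ r ∈ M, IsCond M r ∧ p ⊆ r ∧ a i ∈ r
          · obtain ⟨r, _, hrc, hpr, hr⟩ := h
            exact ⟨r, hrc, hpr, .inl hr⟩
          · push Not at h
            exact ⟨p, hp, fun _ hz => hz, .inr h⟩)
        (fun p q _ _ hpq h => h.imp (fun h => hpq h) fun h r hr hrc hqr =>
          h r hr hrc fun _ hz => hqr (hpq hz))
      rcases hl with hl | hl
      · exact ⟨l, hl⟩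
      · obtain ⟨r, hr, hrc, hlr, h⟩ := hm (P (max l m)) (hP.cond _).mem (hP.cond _)
          (hP.mono _ _ (le_max_right _ _))
        exact (hl r hr hrc (fun _ hz => hlr (hP.mono _ _ (le_max_left _ _) hz)) h).elim
  | _, _, .memC i ⟨j + 1, _⟩, _, a, _ => by
    simp [SatSet, ClassFormula.Realize, Forces, classCons]
  | _, _, .neg φ, he, a, ha => by
    have hF : ∀ f [Tm M {S₀} f], Df M {S₀} fun S e => Forces M S₀ φ a (f S e) := fun f hf =>
      df_forces φ (t := fun i _ _ => a i) (fun i => Tm.const (ha i)) hf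
    refine (not_congr (hP.truth (φ := φ) he ha)).trans ⟨fun h => ?_, ?_⟩
    · obtain ⟨l, hl⟩ := hP.generic
        (fun q => Forces M S₀ φ a q ∨ ∀ r ∈ M, IsCond M r → q ⊆ r → ¬ Forces M S₀ φ a r)
        inferInstance
        (fun p hp => by
          by_cases h : ∃ r ∈ M, IsCond M r ∧ p ⊆ r ∧ Forces M S₀ φ a r
          · obtain ⟨r, _, hrc, hpr, hr⟩ := h
            exact ⟨r, hrc, hpr, .inl hr⟩
          · push Not at h
            exact ⟨p, hp, fun _ hz => hz, .inr h⟩)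
        (fun p q _ _ hpq h => h.imp (fun h => h.mono hpq) fun h r hr hrc hqr =>
          h r hr hrc fun _ hz => hqr (hpq hz))
      exact ⟨l, hl.resolve_left fun hl => h ⟨l, hl⟩⟩
    · rintro ⟨m, hm⟩ ⟨l, hl⟩
      exact hm (P (max l m)) (hP.cond _).mem (hP.cond _) (hP.mono _ _ (le_max_right _ _))
        (hl.mono (hP.mono _ _ (le_max_left _ _)))
  | _, _, .and φ ψ, he, a, ha => by
    refine (and_congr (hP.truth (φ := φ) he.1 ha) (hP.truth (φ := ψ) he.2 ha)).trans ⟨?_, ?_⟩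
    · rintro ⟨⟨l, hl⟩, m, hm⟩
      exact ⟨max l m, hl.mono (hP.mono _ _ (le_max_left _ _)),
        hm.mono (hP.mono _ _ (le_max_right _ _))⟩
    · rintro ⟨m, hl, hm⟩
      exact ⟨⟨m, hl⟩, m, hm⟩
  | n, _, .all φ, he, a, ha => by
    have hF : ∀ f g [Tm M {S₀} f] [Tm M {S₀} g], Df M {S₀} fun S e =>
        Forces M S₀ φ (Fin.snoc (α := fun _ => ZFSet.{u}) a (g S e)) (f S e) := by
      intro f g hf hg
      have ht : ∀ i, Tm M {S₀} (Fin.snoc (α := fun _ => (ℕ → Set ZFSet.{u}) → (ℕ → ZFSet.{u}) →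
          ZFSet.{u}) (fun i _ _ => a i) g i) :=
        Fin.lastCases (by simpa using hg) fun i => by simpa using Tm.const (ha i)
      refine (df_forces φ ht hf).congr fun S _ e _ => ?_
      refine iff_of_eq (congrArg (Forces M S₀ φ · _) (funext fun i => ?_))
      refine Fin.lastCases ?_ (fun i => ?_) i <;> simp
    have ha' : ∀ x ∈ M, ∀ i, Fin.snoc (α := fun _ => ZFSet.{u}) a x i ∈ M := fun x hx =>
      Fin.lastCases (by simpa using hx) fun i => by simpa using ha i
    refine (forall₂_congr fun x hx => hP.truth (φ := φ) he (ha' x hx)).trans ⟨fun h => ?_, ?_⟩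
    · obtain ⟨l, hl⟩ := hP.generic
        (fun q => (∀ x ∈ M, Forces M S₀ φ (Fin.snoc (α := fun _ => ZFSet.{u}) a x) q) ∨
          ∃ x ∈ M, ∀ r ∈ M, IsCond M r → q ⊆ r →
            ¬ Forces M S₀ φ (Fin.snoc (α := fun _ => ZFSet.{u}) a x) r)
        inferInstance
        (fun p hp => by
          by_cases h : ∃ q ∈ M, IsCond M q ∧ p ⊆ q ∧ ∃ x ∈ M, ∀ r ∈ M, IsCond M r → q ⊆ r →
            ¬ Forces M S₀ φ (Fin.snoc (α := fun _ => ZFSet.{u}) a x) r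
          · obtain ⟨q, _, hqc, hpq, hq⟩ := h
            exact ⟨q, hqc, hpq, .inr hq⟩
          · push Not at h
            exact ⟨p, hp, fun _ hz => hz, .inl fun x hx => Forces.of_dense (φ := φ) he hp
              fun q hq hqc hpq => h q hq hqc hpq x hx⟩)
        (fun p q _ _ hpq h => h.imp (fun h x hx => (h x hx).mono hpq)
          fun ⟨x, hx, h⟩ => ⟨x, hx, fun r hr hrc hqr => h r hr hrc fun _ hz => hqr (hpq hz)⟩)
      refine ⟨l, hl.resolve_right ?_⟩
      rintro ⟨x, hx, hl⟩
      obtain ⟨m, hm⟩ := h x hx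
      exact hl (P (max l m)) (hP.cond _).mem (hP.cond _) (hP.mono _ _ (le_max_left _ _))
        (hm.mono (hP.mono _ _ (le_max_right _ _)))
    · rintro ⟨m, hm⟩ x hx
      exact ⟨m, hm x hx⟩
  | _, _, .allC _, h, _, _ => h.elim

end World

/-! ### Adjoining a class -/

/-- The classes that are definable over `M` from the classes `S` and the sets `E`. -/
def adjoin (M : ZFSet.{u}) (S : ℕ → Set ZFSet.{u}) (E : ℕ → ZFSet.{u}) : Set (Set ZFSet.{u}) :=
  {B | ∃ B' : (ℕ → Set ZFSet.{u}) → (ℕ → ZFSet.{u}) → Set ZFSet.{u}, Cl M {S} B' ∧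
    B = {z | z ∈ M ∧ z ∈ B' S E}}

section Adjoin

variable {M : ZFSet.{u}} [hM : TransModel M] {S : ℕ → Set ZFSet.{u}} {E : ℕ → ZFSet.{u}}

omit hM in
theorem mem_adjoin {j : ℕ} (hj : ∀ z ∈ S j, z ∈ M) : S j ∈ adjoin M S E :=
  ⟨fun S _ => S j, Cl.var j, by
    ext z
    exact ⟨fun h => ⟨hj z h, h⟩, fun h => h.2⟩⟩

/-- The class `B' S E` depends only on a defining formula evaluated at the fixed environments, and
there are countably many formulas because their codes lie in the countable `M`. -/
theorem countable_adjoin (hMc : (M : Set ZFSet.{u}).Countable) (hE : ∀ i, E i ∈ M) :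
    (adjoin M S E).Countable := by
  have : Countable (M : Set ZFSet.{u}) := hMc.to_subtype
  have hc : ∀ n k, Countable (ClassFormula n k) := fun n k =>
    Function.Injective.countable
      (f := fun φ : ClassFormula n k => (⟨φ.code, φ.code_mem_model⟩ : (M : Set ZFSet.{u})))
      fun φ ψ h => ClassFormula.code_injective (congrArg Subtype.val h)
  refine (Set.countable_range fun x : Σ n, ClassFormula (n + 1) n => {z | z ∈ M ∧
    SatSet M x.2 (fun i => envCons z E (x.1 + 1 - 1 - i)) fun j => S j}).mono ?_
  rintro _ ⟨B', ⟨⟨N, h⟩⟩, rfl⟩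
  obtain ⟨φ, -, h⟩ := h (N + 1) (by omega) N le_rfl
  refine ⟨⟨N, φ⟩, ?_⟩
  ext z
  exact and_congr_right fun hz => (h S rfl (envCons z E) (envCons_mem hz hE)).symm

omit hM in
-- Definitions of the class parameters are substituted into `φ`, and each set parameter is read off
-- at its place in the enumeration `E`. Thus definability from definable classes is again
-- definability.
theorem adjoin_comprehension (hsurj : ∀ x ∈ M, ∃ i, E i = x) {n k : ℕ}
    {φ : ClassFormula (n + 1) k} (hφ : φ.IsElementary) {p : Fin n → ZFSet.{u}}
    (hp : ∀ i, p i ∈ M) {T : Fin k → Set ZFSet.{u}} (hT : ∀ i, T i ∈ adjoin M S E) :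
    {z | z ∈ M ∧ SatSet M φ (Fin.snoc (α := fun _ => ZFSet.{u}) p z) T} ∈ adjoin M S E := by
  choose r hr using fun i => hsurj (p i) (hp i)
  choose B hB hTB using hT
  refine ⟨fun S e => {z | SatSet M φ (Fin.snoc (α := fun _ => ZFSet.{u}) (fun i => e (r i)) z)
    fun i => {w | w ∈ M ∧ w ∈ B i S e}}, ⟨?_⟩, ?_⟩
  · have ht : ∀ i, Tm M {S} (Fin.snoc
        (α := fun _ => (ℕ → Set ZFSet.{u}) → (ℕ → ZFSet.{u}) → ZFSet.{u})
        (fun i _ e => e (r i + 1)) (fun _ e => e 0) i) :=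
      Fin.lastCases (by simpa using Tm.var 0) fun i => by simpa using Tm.var _
    have hC : ∀ i, Cl M {S} fun S e => {w | w ∈ M ∧ w ∈ B i S fun i => e (i + 1)} := by
      intro i
      have := (hB i).rename fun i => i + 1 + 1
      exact Cl.setOf
    refine (Df.satSet_subst hφ ht hC).congr fun S _ e _ => ?_
    refine iff_of_eq (congrArg (SatSet M φ · _) (funext fun i => ?_))
    refine Fin.lastCases ?_ (fun i => ?_) i <;> simp
  · ext z
    simp only [hr, ← hTB, Set.mem_ofPred_eq]

end Adjoin

/-! ### The generic extension as a world -/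

section World

variable {M : ZFSet.{u}} [hM : TransModel M] {S₀ : ℕ → Set ZFSet.{u}} [hW : GBWorld M S₀]
  {E : ℕ → ZFSet.{u}} {P : ℕ → ZFSet.{u}}

/-- By distributivity a single `P m` decides, for all `x ∈ a` at once, whether `F` has a value at
`x` and which one. The image of `a` is then computed from the forcing relation below `P m`, by
replacement in the ground world. -/
theorem IsGenericSeq.class_replacement (hP : IsGenericSeq M S₀ P) (hE : ∀ i, E i ∈ M)
    {F : Set ZFSet.{u}} (hF : F ∈ adjoin M (classCons (genericClass P) S₀) E)
    (hFf : IsClassFunction F) {a : ZFSet.{u}} (ha : a ∈ M) :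
    ∃ b ∈ M, ∀ y, y ∈ b ↔ ∃ x, x ∈ a ∧ pair x y ∈ F := by
  obtain ⟨B, hB, rfl⟩ := hF
  have hB' := hB.rename fun i => i + 2
  obtain ⟨N, h⟩ : Df M {classCons (genericClass P) S₀} fun S e =>
    pair (e 0) (e 1) ∈ B S fun i => e (i + 2) := inferInstance
  obtain ⟨θ, hθ, h⟩ := h N le_rfl N le_rfl
  set Q : ZFSet.{u} → ZFSet.{u} → ZFSet.{u} → Prop := fun x y q =>
    Forces M S₀ θ (fun i => envCons x (envCons y E) (N - 1 - i)) q with hQdef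
  have henv : ∀ {x y}, x ∈ M → y ∈ M → ∀ i, envCons x (envCons y E) i ∈ M := fun hx hy =>
    envCons_mem hx (envCons_mem hy hE)
  have htruth : ∀ x ∈ M, ∀ y ∈ M,
      (pair x y ∈ B (classCons (genericClass P) S₀) E ↔ ∃ m, Q x y (P m)) := fun x hx y hy =>
    (h _ rfl _ (henv hx hy)).trans (hP.truth hθ fun i => henv hx hy _)
  -- Anything forced along the generic sequence is true, so forced values inherit uniqueness from
  -- `F`; no condition need force that `F` is a function.
  have hfun : ∀ x ∈ M, ∀ y ∈ M, ∀ y' ∈ M, ∀ m m', Q x y (P m) → Q x y' (P m') → y = y' :=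
    fun x hx y hy y' hy' m m' h h' => hFf.2 x y y'
      ⟨pair_mem_model hx hy, (htruth x hx y hy).2 ⟨m, h⟩⟩
      ⟨pair_mem_model hx hy', (htruth x hx y' hy').2 ⟨m', h'⟩⟩
  have hQ : ∀ f g q [Tm M {S₀} f] [Tm M {S₀} g] [Tm M {S₀} q], Df M {S₀} fun S e =>
      Q (f S e) (g S e) (q S e) := by
    intro f g q hf hg hq
    refine df_forces θ (t := fun i S e => envCons (f S e) (envCons (g S e) E) (N - 1 - i))
      (fun i => ?_) hq
    rcases N - 1 - (i : ℕ) with _ | _ | j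
    exacts [hf, hg, Tm.const (hE j)]
  obtain ⟨m, hm⟩ := hP.generic (fun q => ∀ x ∈ a, (∃ y ∈ M, Q x y q) ∨
      ∀ y ∈ M, ∀ r ∈ M, IsCond M r → q ⊆ r → ¬ Q x y r)
    (have := Tm.const (S₀ := S₀) ha; inferInstance)
    (isDense_forall (S₀ := S₀) (D := fun x q => (∃ y ∈ M, Q x y q) ∨
      ∀ y ∈ M, ∀ r ∈ M, IsCond M r → q ⊆ r → ¬ Q x y r) ha inferInstance
      (fun x _ p q _ _ hpq h => h.imp (fun ⟨y, hy, h⟩ => ⟨y, hy, h.mono hpq⟩)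
        fun h y hy r hr hrc hqr => h y hy r hr hrc fun _ hz => hqr (hpq hz))
      fun x _ p hp => by
        by_cases h : ∃ y ∈ M, ∃ r ∈ M, IsCond M r ∧ p ⊆ r ∧ Q x y r
        · obtain ⟨y, hy, r, _, hrc, hpr, hr⟩ := h
          exact ⟨r, hrc, hpr, .inl ⟨y, hy, hr⟩⟩
        · push Not at h
          exact ⟨p, hp, fun _ hz => hz, .inr h⟩)
    (fun p q _ _ hpq h x hx => (h x hx).imp (fun ⟨y, hy, h⟩ => ⟨y, hy, h.mono hpq⟩)
        fun h y hy r hr hrc hqr => h y hy r hr hrc fun _ hz => hqr (hpq hz))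
  have hPm := Tm.const (S₀ := S₀) (hP.cond m).mem
  obtain ⟨b, hb, hb'⟩ := replacement_rel S₀ (Q := fun x y => Q x y (P m)) ha inferInstance
    fun x hx y hy y' hy' => hfun x (mem_of_mem_model hx ha) y hy y' hy' m m
  refine ⟨b, hb, fun y => (hb' y).trans ⟨?_, ?_⟩⟩
  · rintro ⟨hy, x, hx, h⟩
    have hxM := mem_of_mem_model hx ha
    exact ⟨x, hx, pair_mem_model hxM hy, (htruth x hxM y hy).2 ⟨m, h⟩⟩
  · rintro ⟨x, hx, hxyM, h⟩
    obtain ⟨hxM, hy⟩ := of_pair_mem_model hxyM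
    obtain ⟨l, hl⟩ := (htruth x hxM y hy).1 h
    refine ⟨hy, x, hx, ?_⟩
    -- A true value `y` is forced by some `P l`. Either `P m` already forces a value, which must be
    -- `y`, or it excludes all values, contradicting a common later condition.
    rcases hm x hx with ⟨y', hy', h'⟩ | h'
    · rwa [hfun x hxM y hy y' hy' l m hl h']
    · exact (h' y hy (P (max l m)) (hP.cond _).mem (hP.cond _) (hP.mono _ _ (le_max_right _ _))
        (hl.mono (hP.mono _ _ (le_max_left _ _)))).elim

/-- The generic extension is a world. -/
theorem IsGenericSeq.adjoin_mem_topDown (hP : IsGenericSeq M S₀ P)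
    (hMc : (M : Set ZFSet.{u}).Countable) (hE : ∀ i, E i ∈ M) (hsurj : ∀ x ∈ M, ∃ i, E i = x) :
    adjoin M (classCons (genericClass P) S₀) E ∈ topDown M := by
  refine ⟨countable_adjoin hMc hE, hM.zfc, ?_, fun n k φ hφ p hp T hT => ?_,
    fun F hF hFf a ha => hP.class_replacement hE hF hFf ha⟩
  · rintro _ ⟨B, -, rfl⟩ z hz
    exact hz.1
  · convert! adjoin_comprehension hsurj hφ hp hT using 1
    ext z
    exact and_congr_right fun _ => hφ.realize_iff_satSet _ _

omit hW in
theorem IsGenericSeq.genericClass_mem (hP : IsGenericSeq M S₀ P) :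
    genericClass P ∈ adjoin M (classCons (genericClass P) S₀) E :=
  mem_adjoin (S := classCons (genericClass P) S₀) (j := 0) fun _ ⟨n, hn⟩ =>
    mem_of_mem_model hn (hP.cond n).mem

omit hM in
theorem range_subset_adjoin {C : Set ZFSet.{u}} : Set.range S₀ ⊆ adjoin M (classCons C S₀) E := by
  rintro _ ⟨j, rfl⟩
  exact mem_adjoin (S := classCons C S₀) (j := j + 1) fun z hz =>
    hW.gb.classes_subset _ ⟨j, rfl⟩ z hz

end World

/-! ### Truth predicates of initial segments -/

section Rank

variable {β : ZFSet.{u}}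

theorem succ_lt_rank (hβ : β.IsOrdinal) (hlim : ∀ γ ∈ β, insert γ γ ∈ β) {o : Ordinal.{u}}
    (ho : o < rank β) : o + 1 < rank β := by
  have h1 : o.toZFSet ∈ β := by
    rwa [← IsOrdinal.rank_lt_iff_mem (isOrdinal_toZFSet _) hβ, Ordinal.rank_toZFSet]
  simpa using rank_lt_of_mem (hlim _ h1)

theorem rank_pair_lt (hβ : β.IsOrdinal) (hlim : ∀ γ ∈ β, insert γ γ ∈ β) {x y : ZFSet.{u}}
    (hx : rank x < rank β) (hy : rank y < rank β) : rank (pair x y) < rank β := by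
  have h := fun {o} => succ_lt_rank hβ hlim (o := o)
  have : max (rank x + 1) (rank y + 1) + 1 < rank β := h (max_lt (h hx) (h hy))
  simpa [pair, h hx] using this

theorem rank_insert_lt (hβ : β.IsOrdinal) (hlim : ∀ γ ∈ β, insert γ γ ∈ β) {x y : ZFSet.{u}}
    (hx : rank x < rank β) (hy : rank y < rank β) : rank (insert x y) < rank β := by
  have h := fun {o} => succ_lt_rank hβ hlim (o := o)
  simpa [hy] using h hx

theorem rank_natCode_lt (hβ : β.IsOrdinal) (hlim : ∀ γ ∈ β, insert γ γ ∈ β) (h0 : 0 < rank β) :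
    ∀ n, rank (natCode n) < rank β
  | 0 => by simpa [natCode] using h0
  | n + 1 => rank_insert_lt hβ hlim (rank_natCode_lt hβ hlim h0 n) (rank_natCode_lt hβ hlim h0 n)

theorem rank_code_lt (hβ : β.IsOrdinal) (hlim : ∀ γ ∈ β, insert γ γ ∈ β) (h0 : 0 < rank β) :
    ∀ {n k : ℕ} (φ : ClassFormula n k), rank φ.code < rank β
  | _, _, .mem _ _ | _, _, .eq _ _ | _, _, .memC _ _ =>
    rank_pair_lt hβ hlim (rank_natCode_lt hβ hlim h0 _) (rank_pair_lt hβ hlim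
      (rank_natCode_lt hβ hlim h0 _) (rank_natCode_lt hβ hlim h0 _))
  | _, _, .neg φ | _, _, .all φ | _, _, .allC φ =>
    rank_pair_lt hβ hlim (rank_natCode_lt hβ hlim h0 _) (rank_code_lt hβ hlim h0 φ)
  | _, _, .and φ ψ => rank_pair_lt hβ hlim (rank_natCode_lt hβ hlim h0 _)
      (rank_pair_lt hβ hlim (rank_code_lt hβ hlim h0 φ) (rank_code_lt hβ hlim h0 ψ))

theorem rank_seqCode_lt (hβ : β.IsOrdinal) (hlim : ∀ γ ∈ β, insert γ γ ∈ β) (h0 : 0 < rank β) :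
    ∀ {n : ℕ} {a : Fin n → ZFSet.{u}}, (∀ i, rank (a i) < rank β) → rank (seqCode a) < rank β
  | 0, a, _ => by
    have : seqCode a = ∅ := by
      ext z
      simp [seqCode]
    simpa [this] using h0
  | n + 1, a, h => by
    rw [← Fin.snoc_init_self a, seqCode_snoc]
    exact rank_insert_lt hβ hlim (rank_pair_lt hβ hlim (rank_natCode_lt hβ hlim h0 _) (h _))
      (rank_seqCode_lt hβ hlim h0 fun i => h _)

theorem rank_lt_rank_seqCode {n : ℕ} (a : Fin n → ZFSet.{u}) (i : Fin n) :
    rank (a i) < rank (seqCode a) :=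
  (rank_lt_rank_pair_right _ _).trans (rank_lt_of_mem (pair_fin_mem_seqCode.2 rfl))

end Rank

/-- The least rank of a counterexample to the universal statement about the predicate `T` that is
coded by `y`. -/
noncomputable def witnessRank (M : ZFSet.{u}) (T : Set ZFSet.{u}) (y : ZFSet.{u}) : ZFSet.{u} :=
  leastRank M fun x => ∃ d ∈ M, ∃ n ∈ M, ∃ s ∈ M, y = pair d (pair n s) ∧
    pair d (insert (pair n x) s) ∉ T

theorem tm_witnessRank {M : ZFSet.{u}} [TransModel M] {S₀ : ℕ → Set ZFSet.{u}} [GBWorld M S₀]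
    {T : Set ZFSet.{u}} (hT : T ∈ Set.range S₀) : Tm M {S₀} fun _ e => witnessRank M T (e 0) := by
  have := Cl.of_mem (M := M) hT
  unfold witnessRank
  infer_instance

section World

variable {M : ZFSet.{u}} [hM : TransModel M] {A : Set ZFSet.{u}} {G : ZFSet.{u} → ZFSet.{u}}

/-- If `G` bounds the ranks of counterexamples, then initial segments closed under `G` are
elementary. -/
theorem satSet_vM_iff
    (hG : ∀ y ∈ M, rank (witnessRank M (truthPredicate M A) y) ≤ rank (G y)) {β : ZFSet.{u}}
    (hβ : β.IsOrdinal) (hlim : ∀ γ ∈ β, insert γ γ ∈ β) (h0 : 0 < rank β)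
    (hcl : ∀ y ∈ vM M β, rank (G y) < rank β) {n : ℕ} (φ : ClassFormula n 1) :
    φ.IsElementary → ∀ {a : Fin n → ZFSet.{u}}, (∀ i, a i ∈ vM M β) →
      (SatSet (vM M β) φ a (fun _ => A) ↔ SatSet M φ a fun _ => A) := by
  suffices H : ∀ {n k : ℕ} (φ : ClassFormula n k), k = 1 → φ.IsElementary →
    ∀ {a : Fin n → ZFSet.{u}}, (∀ i, a i ∈ vM M β) →
      (SatSet (vM M β) φ a (fun _ => A) ↔ SatSet M φ a fun _ => A) from H φ rfl
  intro n k φ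
  induction φ with
  | mem i j | eq i j | memC i j => intros; rfl
  | neg φ ih => exact fun hk h a ha => not_congr (ih hk h ha)
  | and φ ψ ih ih' => exact fun hk h a ha => and_congr (ih hk h.1 ha) (ih' hk h.2 ha)
  | allC φ ih => exact fun _ h => h.elim
  | @all n k φ ih =>
    rintro rfl h a ha
    have hsnoc : ∀ x ∈ vM M β, ∀ i, Fin.snoc (α := fun _ => ZFSet.{u}) a x i ∈ vM M β :=
      fun x hx => Fin.lastCases (by simpa using hx) fun i => by simpa using ha i
    have ha' := fun i => (mem_vM hM.trans hβ).1 (ha i)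
    constructor
    · intro hs
      by_contra hno
      simp only [SatSet, ClassFormula.Realize] at hno
      push Not at hno
      -- This is the Tarski–Vaught test: `y` codes the failing universal statement with its
      -- parameters. It lies in `vM M β` because β is a limit, so `G y` places a counterexample of
      -- least rank below β.
      set y := pair φ.code (pair (natCode n) (seqCode a)) with hy
      have hsM : seqCode a ∈ M := seqCode_mem_model fun i => (ha' i).1
      have hyβ : y ∈ vM M β := (mem_vM hM.trans hβ).2
        ⟨pair_mem_model φ.code_mem_model (pair_mem_model (natCode_mem_model _) hsM),
          rank_pair_lt hβ hlim (rank_code_lt hβ hlim h0 _) (rank_pair_lt hβ hlim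
            (rank_natCode_lt hβ hlim h0 _) (rank_seqCode_lt hβ hlim h0 fun i => (ha' i).2))⟩
      have hyM := ((mem_vM hM.trans hβ).1 hyβ).1
      have hR : ∀ x ∈ M, (∃ d ∈ M, ∃ m ∈ M, ∃ s ∈ M, y = pair d (pair m s) ∧
          pair d (insert (pair m x) s) ∉ truthPredicate M A) ↔
          ¬ SatSet M φ (Fin.snoc (α := fun _ => ZFSet.{u}) a x) fun _ => A := by
        intro x hx
        have hx' : ∀ i, Fin.snoc (α := fun _ => ZFSet.{u}) a x i ∈ M :=
          Fin.lastCases (by simpa using hx) fun i => by simpa using (ha' i).1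
        have key : pair φ.code (insert (pair (natCode n) x) (seqCode a)) ∈ truthPredicate M A ↔
            SatSet M φ (Fin.snoc (α := fun _ => ZFSet.{u}) a x) fun _ => A := by
          rw [← seqCode_snoc, pair_mem_truthPredicate hx']
          constructor
          · rintro ⟨ψ, -, e, hψ⟩
            rwa [ClassFormula.code_injective e]
          · exact fun hφ => ⟨φ, h, rfl, hφ⟩
        rw [← key]
        constructor
        · rintro ⟨d, -, m, -, s, -, e, hn⟩
          obtain ⟨e1, e2⟩ := pair_inj.1 e
          obtain ⟨e2, e3⟩ := pair_inj.1 e2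
          rwa [e1, e2, e3]
        · exact fun hn => ⟨_, φ.code_mem_model, _, natCode_mem_model n, _, hsM, rfl, hn⟩
      obtain ⟨x0, hx0, hno⟩ := hno
      obtain ⟨x, hx, hxR, -, e⟩ := exists_leastRank (M := M)
        (R := fun x => ∃ d ∈ M, ∃ m ∈ M, ∃ s ∈ M, y = pair d (pair m s) ∧
          pair d (insert (pair m x) s) ∉ truthPredicate M A) ⟨x0, hx0, (hR x0 hx0).2 hno⟩
      have hxβ : x ∈ vM M β := by
        refine (mem_vM hM.trans hβ).2 ⟨hx, ?_⟩
        rw [← rank_rk x, ← e]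
        exact (hG y hyM).trans_lt (hcl y hyβ)
      exact (hR x hx).1 hxR ((ih rfl h (hsnoc x hxβ)).1 (hs x hxβ))
    · exact fun hs x hx => (ih rfl h (hsnoc x hx)).2 (hs x ((mem_vM hM.trans hβ).1 hx).1)

/-- By elementarity truth agrees on assignments from `vM M β`. Codes and finite sequences over this
set have rank below the limit β, and conversely a pair of rank below β has its assignment there. -/
theorem truthPredicate_vM
    (hG : ∀ y ∈ M, rank (witnessRank M (truthPredicate M A) y) ≤ rank (G y)) {β : ZFSet.{u}}
    (hβ : β.IsOrdinal) (hlim : ∀ γ ∈ β, insert γ γ ∈ β) (h0 : 0 < rank β)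
    (hcl : ∀ y ∈ vM M β, rank (G y) < rank β) :
    truthPredicate (vM M β) A = {z | z ∈ vM M β ∧ z ∈ truthPredicate M A} := by
  ext z
  constructor
  · rintro ⟨n, φ, a, hφ, ha, rfl, h⟩
    have ha' := fun i => (mem_vM hM.trans hβ).1 (ha i)
    refine ⟨(mem_vM hM.trans hβ).2 ⟨pair_mem_model φ.code_mem_model
      (seqCode_mem_model fun i => (ha' i).1), rank_pair_lt hβ hlim (rank_code_lt hβ hlim h0 _)
        (rank_seqCode_lt hβ hlim h0 fun i => (ha' i).2)⟩,
      n, φ, a, hφ, fun i => (ha' i).1, rfl, (satSet_vM_iff hG hβ hlim h0 hcl φ hφ ha).1 h⟩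
  · rintro ⟨hz, n, φ, a, hφ, ha, rfl, h⟩
    have ha' : ∀ i, a i ∈ vM M β := fun i => (mem_vM hM.trans hβ).2 ⟨ha i,
      (rank_lt_rank_seqCode a i).trans ((rank_lt_rank_pair_right _ _).trans
        ((mem_vM hM.trans hβ).1 hz).2)⟩
    exact ⟨n, φ, a, hφ, ha', rfl, (satSet_vM_iff hG hβ hlim h0 hcl φ hφ ha').2 h⟩

/-- A world in which the ranks of counterexamples are bounded by a class function contains the
truth predicate, if the latter is amenable. -/
theorem truthPredicate_mem_of_bound {S₀ : ℕ → Set ZFSet.{u}} [GBWorld M S₀]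
    (hA : A ∈ Set.range S₀) (hT : ∀ a ∈ M, a.sep (· ∈ truthPredicate M A) ∈ M)
    (hGTm : Tm M {S₀} fun _ e => G (e 0))
    (hG : ∀ y ∈ M, rank (witnessRank M (truthPredicate M A) y) ≤ rank (G y)) :
    truthPredicate M A ∈ Set.range S₀ := by
  have hG' : ∀ f [Tm M {S₀} f], Tm M {S₀} fun S e => G (f S e) := fun _ hf => hGTm.subst₁ hf
  have hA' := Cl.of_mem (M := M) hA
  -- The predicate is assembled from set truth predicates of the closed initial segments. Its
  -- definition mentions only `A` and `G`, so it does not presuppose the class being constructed.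
  have key := comprehension (M := M) (S₀ := S₀) (R := fun z => ∃ β ∈ M, β.IsOrdinal ∧
    (∀ γ ∈ β, insert γ γ ∈ β) ∧ z ∈ vM M β ∧ (∀ y ∈ vM M β, rank (G y) < rank β) ∧
      ∃ t ∈ M, IsTruth M (vM M β) A t ∧ z ∈ t) inferInstance
  have hsub : ∀ {β : ZFSet.{u}}, β.IsOrdinal → vM M β ⊆ M := fun hβ z hz =>
    ((mem_vM hM.trans hβ).1 hz).1
  have h0 : ∀ {β z : ZFSet.{u}}, β.IsOrdinal → z ∈ vM M β → 0 < rank β := fun hβ hz =>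
    (zero_le).trans_lt ((mem_vM hM.trans hβ).1 hz).2
  convert! key using 1
  ext z
  constructor
  · intro hz
    have hzM := truthPredicate_subset (fun _ h => h) z hz
    obtain ⟨β, hβM, hβ, hlim, hzβ, hcl⟩ := exists_closed hGTm hzM
    have hzv : z ∈ vM M β := (mem_vM hM.trans hβ).2 ⟨hzM, hzβ⟩
    have hcl' : ∀ y ∈ vM M β, rank (G y) < rank β := fun y hy =>
      hcl y (hsub hβ hy) ((mem_vM hM.trans hβ).1 hy).2
    have hv : vM M β ∈ M := (inferInstance : Tm M {S₀} fun _ e => vM M (e 0)).apply_mem hβM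
    -- The set truth predicate of `vM M β` is the trace of Tr(A) on it, which is in `M` by
    -- amenability.
    refine ⟨hzM, β, hβM, hβ, hlim, hzv, hcl', _, hT _ hv, ?_, ZFSet.mem_sep.2 ⟨hzv, hz⟩⟩
    rw [isTruth_iff ⟨z, hzv⟩ (hsub hβ) fun w hw => mem_of_mem_model hw (hT _ hv),
      truthPredicate_vM hG hβ hlim (h0 hβ hzv) hcl']
    ext w
    exact ZFSet.mem_sep
  · rintro ⟨-, β, -, hβ, hlim, hzv, hcl, t, ht, htr, hzt⟩
    rw [isTruth_iff ⟨z, hzv⟩ (hsub hβ) fun w hw => mem_of_mem_model hw ht,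
      truthPredicate_vM hG hβ hlim (h0 hβ hzv) hcl] at htr
    have : z ∈ (t : Set ZFSet.{u}) := hzt
    rw [htr] at this
    exact this.2

end World

/-! ### Coding by generic classes -/

section World

variable {M : ZFSet.{u}} [hM : TransModel M]

/-- If `F` is not bounded by the functions of the world, then a condition can be prolonged into a
dense open class to a condition whose length is the value of `F` at the first new entry. -/
theorem IsCond.exists_coding {S₀ : ℕ → Set ZFSet.{u}} [GBWorld M S₀] {F : ZFSet.{u} → ZFSet.{u}}
    (hFM : ∀ y ∈ M, F y ∈ M) (hFo : ∀ y, (F y).IsOrdinal)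
    (hF : ∀ G : ZFSet.{u} → ZFSet.{u}, (Tm M {S₀} fun _ e => G (e 0)) →
      ∃ y ∈ M, rank (G y) < rank (F y))
    {D : ZFSet.{u} → Prop} (hDf : Df M {S₀} fun _ e => D (e 0)) (hD : IsDense M D)
    (hDo : IsOpenCond M D) {p : ZFSet.{u}} (hp : IsCond M p) :
    ∃ q, IsCond M q ∧ p ⊆ q ∧ D q ∧ ∃ y ∈ M, pair (dom p) y ∈ q ∧ dom q = F y := by
  have hpd := hp.dom_mem S₀
  have hD' : ∀ f [Tm M {S₀} f], Df M {S₀} fun S e => D (f S e) := fun _ hf =>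
    Df.subst₁ (Q := fun _ x => D x) hDf hf
  have hp' := Tm.const (S₀ := S₀) hp.mem
  -- The function compared with `F` gives the least length of an extension in `D` after the entry
  -- `y` has been appended to `p`. As it does not bound `F`, some `y` leaves room below `F y`.
  obtain ⟨y, hy, hlt⟩ := hF (fun y => leastRank M fun β => ∃ q ∈ M, IsCond M q ∧
    insert (pair (dom p) y) p ⊆ q ∧ D q ∧ β = dom q) inferInstance
  obtain ⟨q0, hq0, hpq0, hDq0⟩ := hD _ (hp.snoc hpd hy)
  obtain ⟨_, hβ, ⟨q, -, hq, hpq, hDq, rfl⟩, -, e⟩ := exists_leastRank (M := M)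
    (R := fun β => ∃ q ∈ M, IsCond M q ∧ insert (pair (dom p) y) p ⊆ q ∧ D q ∧ β = dom q)
    ⟨_, hq0.dom_mem S₀, q0, hq0.mem, hq0, hpq0, hDq0, rfl⟩
  rw [e, rank_rk] at hlt
  -- Padding to length exactly `F y` stays in `D` by openness and makes the next length recoverable
  -- from `y`.
  obtain ⟨r, hr, hqr, hdr⟩ := hq.exists_dom_eq S₀ (hFM y hy) (hFo y)
    ((IsOrdinal.rank_le_iff_subset hq.ordinal (hFo y)).1 hlt.le)
  exact ⟨r, hr, fun z hz => hqr (hpq (mem_insert_iff.2 (.inr hz))), hDo _ _ hq hr hqr hDq,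
    y, hy, hqr (hpq (mem_insert _ _)), hdr⟩

/-- A generic sequence that codes a short cofinal sequence, which can be recovered with `F`. -/
theorem exists_coding_genericSeq {S₀ : ℕ → Set ZFSet.{u}} [hW : GBWorld M S₀]
    {F : ZFSet.{u} → ZFSet.{u}} (hFM : ∀ y ∈ M, F y ∈ M) (hFo : ∀ y, (F y).IsOrdinal)
    (hF : ∀ G : ZFSet.{u} → ZFSet.{u}, (Tm M {S₀} fun _ e => G (e 0)) →
      ∃ y ∈ M, rank (G y) < rank (F y)) :
    ∃ P : ℕ → ZFSet.{u}, IsGenericSeq M S₀ P ∧ P 0 = ∅ ∧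
      ∀ n, ∃ y ∈ M, pair (dom (P n)) y ∈ P (n + 1) ∧ dom (P (n + 1)) = F y := by
  have hstep : ∀ (n : ℕ) (p : {p // IsCond M p}), ∃ q : {p // IsCond M p}, p.1 ⊆ q.1 ∧
      (IsDense M (· ∈ S₀ n) → IsOpenCond M (· ∈ S₀ n) → q.1 ∈ S₀ n) ∧
      ∃ y ∈ M, pair (dom p.1) y ∈ q.1 ∧ dom q.1 = F y := by
    rintro n ⟨p, hp⟩
    have := Cl.of_mem (M := M) (S₀ := S₀) ⟨n, rfl⟩
    -- Stage `n` treats the class `S₀ n`; if that class is not dense open, only the coding is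
    -- carried out.
    by_cases h : IsDense M (· ∈ S₀ n) ∧ IsOpenCond M (· ∈ S₀ n)
    · obtain ⟨q, hq, h1, h2, h3⟩ := hp.exists_coding hFM hFo hF (D := (· ∈ S₀ n)) inferInstance
        h.1 h.2
      exact ⟨⟨q, hq⟩, h1, fun _ _ => h2, h3⟩
    · obtain ⟨q, hq, h1, -, h3⟩ := hp.exists_coding hFM hFo hF (D := fun _ => True) inferInstance
        (fun p hp => ⟨p, hp, fun _ h => h, trivial⟩) (fun _ _ _ _ _ h => h)
      exact ⟨⟨q, hq⟩, h1, fun a b => (h ⟨a, b⟩).elim, h3⟩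
  choose next h1 h2 h3 using hstep
  let P : ℕ → {p // IsCond M p} := fun n => Nat.rec ⟨∅, isCond_empty⟩ next n
  refine ⟨fun n => (P n).1, ⟨fun n => (P n).2, fun m n hmn => ?_, fun D hD hd ho => ?_⟩, rfl,
    fun n => h3 n (P n)⟩
  · induction n, hmn using Nat.le_induction with
    | base => exact fun _ h => h
    | succ n _ ih => exact fun _ hz => h1 n (P n) (ih hz)
  -- Every definable `D` agrees on conditions with some enumerated class, so it is met at stage `n +
  -- 1`.
  · obtain ⟨n, hn⟩ := comprehension (S₀ := S₀) hD
    have hmem : ∀ {p}, IsCond M p → (p ∈ S₀ n ↔ D p) := fun hp => by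
      rw [hn]
      exact and_iff_right hp.mem
    refine ⟨n + 1, (hmem (P (n + 1)).2).1 (h2 n (P n) (fun p hp => ?_) fun p q hp hq hpq h => ?_)⟩
    · obtain ⟨q, hq, hpq, h⟩ := hd p hp
      exact ⟨q, hq, hpq, (hmem hq).2 h⟩
    · exact (hmem hq).2 (ho p q hp hq hpq ((hmem hp).1 h))

/-- Conditions defined at `β` are dense by padding. Thus the lengths of the generic sequence are
cofinal in the ordinals of `M`. -/
theorem IsGenericSeq.exists_mem_dom {S₀ : ℕ → Set ZFSet.{u}} [hW : GBWorld M S₀]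
    {P : ℕ → ZFSet.{u}} (hP : IsGenericSeq M S₀ P) {β : ZFSet.{u}} (hβM : β ∈ M)
    (hβ : β.IsOrdinal) : ∃ n, β ∈ dom (P n) := by
  have := Tm.const (S₀ := S₀) hβM
  refine hP.generic (fun p => β ∈ dom p) inferInstance (fun p hp => ?_)
    fun p q _ _ hpq h => dom_subset hpq h
  have hpd := hp.dom_mem S₀
  obtain ⟨q, hq, hpq, hd⟩ := hp.exists_dom_eq S₀
    (union_mem_model hpd (insert_mem_model hβM hβM)) (isOrdinal_union hp.ordinal (isOrdinal_succ hβ))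
    fun z hz => mem_union.2 (.inl hz)
  exact ⟨q, hq, hpq, by simp [hd]⟩

/-- No world contains both the generic class and the function that decodes it. -/
theorem IsGenericSeq.not_mem_world {S₀ : ℕ → Set ZFSet.{u}} [hW : GBWorld M S₀]
    {P : ℕ → ZFSet.{u}} (hP : IsGenericSeq M S₀ P) (hP0 : P 0 = ∅) {F : ZFSet.{u} → ZFSet.{u}}
    (hcode : ∀ n, ∃ y ∈ M, pair (dom (P n)) y ∈ P (n + 1) ∧ dom (P (n + 1)) = F y)
    {S₂ : ℕ → Set ZFSet.{u}} [GBWorld M S₂] (hF : Tm M {S₂} fun _ e => F (e 0)) :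
    genericClass P ∉ Set.range S₂ := by
  intro hC
  have hC' := Cl.of_mem (M := M) hC
  have hF' : ∀ f [Tm M {S₂} f], Tm M {S₂} fun S e => F (f S e) := fun _ hf => hF.subst₁ hf
  -- The function given here is, up to rank, α ↦ F(C(α)) made total, with C the generic class.
  -- Closure of β under it keeps the lengths of all `P n` below β.
  obtain ⟨β, hβM, hβ, -, h0, hcl⟩ := exists_closed (S₀ := S₂) (h := fun α => leastRank M fun γ =>
    ∃ y ∈ M, pair α y ∈ genericClass P ∧ γ = F y) inferInstance (empty_mem_model (M := M))
  have key : ∀ n, rank (dom (P n)) < rank β := by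
    intro n
    induction n with
    | zero =>
      have : dom (∅ : ZFSet.{u}) = ∅ := by ext; simp [mem_dom]
      rwa [hP0, this]
    | succ n ih =>
      obtain ⟨y, hy, hyP, hd⟩ := hcode n
      have huniq : ∀ γ ∈ M, (∃ y ∈ M, pair (dom (P n)) y ∈ genericClass P ∧ γ = F y) →
          rank (dom (P (n + 1))) ≤ rank γ := by
        rintro _ - ⟨y', -, ⟨m, hm⟩, rfl⟩
        have := (hP.cond (max m (n + 1))).func _ y y' (hP.mono _ _ (le_max_right _ _) hyP)
          (hP.mono _ _ (le_max_left _ _) hm)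
        rw [← this, hd]
      have hdM := (hP.cond (n + 1)).dom_mem S₀
      have := hcl _ ((hP.cond n).dom_mem S₀) ih
      rwa [leastRank_eq hdM ⟨y, hy, ⟨n + 1, hyP⟩, hd⟩ huniq, rank_rk] at this
  obtain ⟨n, hn⟩ := hP.exists_mem_dom hβM hβ
  exact lt_asymm (key n) (rank_lt_of_mem hn)

/-- If a world does not contain the truth predicate relative to one of its classes, but has an
extension that does, then it also has an extension all whose extensions lack this truth
predicate. -/
theorem exists_world_forever_without_truth (hMc : (M : Set ZFSet.{u}).Countable)
    {𝒳 𝒴 : Set (Set ZFSet.{u})} (h𝒳 : 𝒳 ∈ topDown M) (h𝒴 : 𝒴 ∈ topDown M) {A : Set ZFSet.{u}}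
    (hA : A ∈ 𝒳) (hTX : truthPredicate M A ∉ 𝒳) (hTY : truthPredicate M A ∈ 𝒴) :
    ∃ 𝒵 ∈ topDown M, 𝒳 ⊆ 𝒵 ∧ ∀ 𝒲 ∈ topDown M, 𝒵 ⊆ 𝒲 → truthPredicate M A ∉ 𝒲 := by
  obtain ⟨S₀, rfl⟩ := h𝒳.1.exists_eq_range ⟨A, hA⟩
  obtain ⟨S₁, rfl⟩ := h𝒴.1.exists_eq_range ⟨_, hTY⟩
  obtain ⟨E, hE⟩ := hMc.exists_eq_range ⟨∅, empty_mem_model⟩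
  have : GBWorld M S₀ := ⟨h𝒳.2⟩
  have : GBWorld M S₁ := ⟨h𝒴.2⟩
  have hF1 := tm_witnessRank (M := M) (S₀ := S₁) hTY
  have hTY' := Cl.of_mem (M := M) hTY
  obtain ⟨P, hP, hP0, hcode⟩ := exists_coding_genericSeq (S₀ := S₀)
    (F := witnessRank M (truthPredicate M A)) (fun y hy => hF1.apply_mem hy)
    (fun y => isOrdinal_leastRank _) fun G hG => by
      -- A bound `G` in the world of `S₀` would put the truth predicate there; the required
      -- amenability comes from the world of `S₁`, which contains it.
      by_contra! hno
      exact hTX (truthPredicate_mem_of_bound hA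
        (fun a ha => separation S₁ ha inferInstance) hG hno)
  have hEM : ∀ i, E i ∈ M := fun i => SetLike.mem_coe.1 (hE ▸ Set.mem_range_self i)
  refine ⟨_, hP.adjoin_mem_topDown hMc hEM fun x hx => ?_, range_subset_adjoin (E := E),
    fun 𝒲 h𝒲 hsub hT => ?_⟩
  · have : x ∈ (M : Set ZFSet.{u}) := hx
    rwa [hE] at this
  · obtain ⟨S₂, rfl⟩ := h𝒲.1.exists_eq_range ⟨_, hT⟩
    have : GBWorld M S₂ := ⟨h𝒲.2⟩
    exact hP.not_mem_world hP0 hcode (tm_witnessRank hT) (hsub hP.genericClass_mem)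

end World

/-! ### The assertion that there is a truth predicate -/

section Assertion

variable {M : ZFSet.{u}} [hM : TransModel M]

/-- Dummy set variables can be quantified away. -/
theorem exists_formula_without_sets {R : (ℕ → Set ZFSet.{u}) → Prop} {k : ℕ} :
    ∀ {n : ℕ} (φ : ClassFormula n k), (∀ (𝒲 : Set (Set ZFSet.{u})) (a : Fin n → ZFSet.{u}),
      (∀ i, a i ∈ M) → ∀ S : ℕ → Set ZFSet.{u}, φ.Realize M 𝒲 a (fun j => S j) ↔ R S) →
    ∃ ψ : ClassFormula 0 k, ∀ (𝒲 : Set (Set ZFSet.{u})) (S : ℕ → Set ZFSet.{u}),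
      ψ.Realize M 𝒲 Fin.elim0 (fun j => S j) ↔ R S
  | 0, φ, h => ⟨φ, fun 𝒲 S => h 𝒲 _ (fun i => i.elim0) S⟩
  | n + 1, φ, h => by
    refine exists_formula_without_sets (.all φ) fun 𝒲 a ha S => ?_
    have ha' : ∀ x ∈ M, ∀ i, Fin.snoc (α := fun _ => ZFSet.{u}) a x i ∈ M := fun x hx =>
      Fin.lastCases (by simpa using hx) fun i => by simpa using ha i
    exact ⟨fun hall => (h 𝒲 _ (ha' _ empty_mem_model) S).1 (hall _ empty_mem_model),
      fun hR x hx => (h 𝒲 _ (ha' x hx) S).2 hR⟩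

omit hM in
/-- Dummy class variables can be quantified away. -/
theorem exists_formula_without_classes {R : (ℕ → Set ZFSet.{u}) → Prop} {k : ℕ}
    (hR : ∀ S S', (∀ j < k, S j = S' j) → (R S ↔ R S')) : ∀ {m : ℕ} (φ : ClassFormula 0 (k + m)),
    (∀ 𝒲 : Set (Set ZFSet.{u}), 𝒲.Nonempty → ∀ S : ℕ → Set ZFSet.{u},
      φ.Realize M 𝒲 Fin.elim0 (fun j => S j) ↔ R S) →
    ∃ ψ : ClassFormula 0 k, ∀ 𝒲 : Set (Set ZFSet.{u}), 𝒲.Nonempty → ∀ S : ℕ → Set ZFSet.{u},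
      ψ.Realize M 𝒲 Fin.elim0 (fun j => S j) ↔ R S
  | 0, φ, h => ⟨φ, h⟩
  | m + 1, φ, h => by
    refine exists_formula_without_classes hR (m := m) (.allC φ) fun 𝒲 h𝒲 S => ?_
    have key : ∀ X, φ.Realize M 𝒲 Fin.elim0 (Fin.snoc (α := fun _ => Set ZFSet.{u})
        (fun j : Fin (k + m) => S j) X) ↔ R S := by
      intro X
      refine (iff_of_eq (congrArg (φ.Realize M 𝒲 Fin.elim0) (funext fun j => ?_))).trans
        ((h 𝒲 h𝒲 (Function.update S (k + m) X)).trans (hR _ _ fun j hj => ?_))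
      · refine Fin.lastCases ?_ (fun j => ?_) j
        · simp
        · rw [Fin.snoc_castSucc]
          exact (Function.update_of_ne (show (j : ℕ) ≠ k + m from ne_of_lt j.2) _ _).symm
      · rw [Function.update_of_ne (by omega)]
    obtain ⟨X, hX⟩ := h𝒲
    exact ⟨fun hall => (key X).1 (hall X hX), fun hR Y _ => (key Y).2 hR⟩

/-- A definable relation between `k` classes is expressed by a formula with `k` class variables. -/
theorem exists_formula {R : (ℕ → Set ZFSet.{u}) → Prop} (k : ℕ)
    (hDf : Df M Set.univ fun S _ => R S)
    (hR : ∀ S S', (∀ j < k, S j = S' j) → (R S ↔ R S')) :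
    ∃ ψ : ClassFormula 0 k, ∀ 𝒲 : Set (Set ZFSet.{u}), 𝒲.Nonempty → ∀ S : ℕ → Set ZFSet.{u},
      ψ.Realize M 𝒲 Fin.elim0 (fun j => S j) ↔ R S := by
  obtain ⟨N, h⟩ := hDf
  -- The `N` set variables and the last `N` class variables are dummies. They are removed by
  -- universal quantification, which is harmless over nonempty domains.
  obtain ⟨φ, h1, h2⟩ := h N le_rfl (k + N) (by omega)
  obtain ⟨ψ, hψ⟩ := exists_formula_without_sets (M := M) (R := R) φ fun 𝒲 a ha S => by
    rw [h1.realize_iff_satSet]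
    rcases Nat.eq_zero_or_pos N with rfl | hN
    · rw [h2 S trivial (fun _ => ∅) fun _ => empty_mem_model]
      exact iff_of_eq (congrArg (SatSet M φ · _) (funext fun i => i.elim0))
    · rw [h2 S trivial (fun i => a ⟨N - 1 - i, by omega⟩) fun _ => ha _]
      refine iff_of_eq (congrArg (SatSet M φ · _) (funext fun i => congrArg a (Fin.ext ?_)))
      simp only
      omega
  exact exists_formula_without_classes hR ψ fun 𝒲 _ => hψ 𝒲

/-- The existence of a class with a definable property is expressed by a formula. -/
theorem exists_formula_exC {R : (ℕ → Set ZFSet.{u}) → Prop} (k : ℕ)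
    (hDf : Df M Set.univ fun S _ => R S)
    (hR : ∀ S S', (∀ j < k + 1, S j = S' j) → (R S ↔ R S')) :
    ∃ ψ : ClassFormula 0 k, ∀ 𝒲 : Set (Set ZFSet.{u}), 𝒲.Nonempty → ∀ S : ℕ → Set ZFSet.{u},
      ψ.Realize M 𝒲 Fin.elim0 (fun j => S j) ↔ ∃ X ∈ 𝒲, R (Function.update S k X) := by
  obtain ⟨φ, hφ⟩ := exists_formula (k + 1) hDf hR
  refine ⟨.neg (.allC (.neg φ)), fun 𝒲 h𝒲 S => ?_⟩
  have key : ∀ X, φ.Realize M 𝒲 Fin.elim0 (Fin.snoc (α := fun _ => Set ZFSet.{u})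
      (fun j : Fin k => S j) X) ↔ R (Function.update S k X) := by
    intro X
    rw [← hφ 𝒲 h𝒲]
    refine iff_of_eq (congrArg (φ.Realize M 𝒲 Fin.elim0) (funext fun j => ?_))
    refine Fin.lastCases ?_ (fun j => ?_) j
    · simp
    · simp [Function.update_of_ne (ne_of_lt j.2)]
  simp only [ClassFormula.Realize, key]
  push Not
  rfl

/-- The Tarskian conditions quantify only over sets, so they mean the same in every world and their
only solution is the actual truth predicate. -/
theorem exists_isTruth_iff {𝒲 : Set (Set ZFSet.{u})} (h𝒲 : 𝒲 ∈ topDown M) {A : Set ZFSet.{u}} :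
    (∃ T ∈ 𝒲, IsTruth M (M : Set ZFSet.{u}) A T) ↔ truthPredicate M A ∈ 𝒲 := by
  have h : ∀ T ∈ 𝒲, (IsTruth M (M : Set ZFSet.{u}) A T ↔ T = truthPredicate M A) := fun T hT =>
    isTruth_iff ⟨_, empty_mem_model⟩ (fun _ h => h) (h𝒲.2.classes_subset T hT)
  constructor
  · rintro ⟨T, hT, hTr⟩
    rwa [← (h T hT).1 hTr]
  · exact fun hT => ⟨_, hT, (h _ hT).2 rfl⟩

/-- The existence of the truth predicate relative to the class parameter. -/
theorem exists_truth_formula : ∃ ψ : ClassFormula 0 1, ∀ 𝒲 ∈ topDown M, 𝒲.Nonempty →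
    ∀ A : Set ZFSet.{u}, ψ.Realize M 𝒲 Fin.elim0 (fun _ => A) ↔ truthPredicate M A ∈ 𝒲 := by
  obtain ⟨ψ, hψ⟩ := exists_formula_exC (M := M)
    (R := fun S => IsTruth M (M : Set ZFSet.{u}) (S 0) (S 1)) 1 inferInstance
    fun S S' h => by rw [h 0 (by omega), h 1 (by omega)]
  refine ⟨ψ, fun 𝒲 h𝒲 hne A => ?_⟩
  rw [← exists_isTruth_iff h𝒲]
  simpa using hψ 𝒲 hne fun _ => A

/-- The existence of the truth predicate relative to a definable class. -/
theorem IsParameterFreeDefinable.exists_truth_formula {A : Set ZFSet.{u}}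
    (hA : IsParameterFreeDefinable M A) : ∃ ψ : ClassFormula 0 0, ∀ 𝒲 ∈ topDown M, 𝒲.Nonempty →
      (ψ.Realize M 𝒲 Fin.elim0 Fin.elim0 ↔ truthPredicate M A ∈ 𝒲) := by
  obtain ⟨φ, hφ, hAφ⟩ := hA
  -- The definition of `A` replaces the class parameter, uniformly in all class environments, so the
  -- resulting formula is a sentence.
  have hCl : Cl M Set.univ fun _ _ => A := by
    refine ⟨(inferInstance : Df M Set.univ fun S e => e 0 ∈ M).and (h' := Df.satSet_rename hφ
      fun _ => 0) |>.congr fun S _ e _ => ?_⟩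
    rw [hAφ]
    exact and_congr_right fun _ => iff_of_eq (congrArg (SatSet M φ _) (funext fun i => i.elim0))
  obtain ⟨ψ, hψ⟩ := exists_formula_exC (M := M)
    (R := fun S => IsTruth M (M : Set ZFSet.{u}) A (S 0)) 0 inferInstance
    fun S S' h => by rw [h 0 (by omega)]
  refine ⟨ψ, fun 𝒲 h𝒲 hne => ?_⟩
  rw [← exists_isTruth_iff h𝒲]
  refine (iff_of_eq (congrArg (ψ.Realize M 𝒲 Fin.elim0) (funext fun i => i.elim0))).trans
    ((hψ 𝒲 hne fun _ => ∅).trans ?_)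
  simp

end Assertion

/-- An assertion that is possibly necessary, but can also be made permanently false, refutes
the `.2` axiom. -/
theorem not_validAt_dotTwo {M : ZFSet.{u}} {𝔄 : Set (Set (Set ZFSet.{u}))}
    {P : Set (Set ZFSet.{u})} {𝒳 𝒴 𝒵 : Set (Set ZFSet.{u})} (ψ : Assertion P)
    {T : Set ZFSet.{u}} (hψ : ∀ 𝒲 ∈ 𝔄, 𝒳 ⊆ 𝒲 →
      (ψ.formula.Realize M 𝒲 Fin.elim0 ψ.param ↔ T ∈ 𝒲))
    (h𝒴 : 𝒴 ∈ 𝔄) (h𝒳𝒴 : 𝒳 ⊆ 𝒴) (hT : T ∈ 𝒴) (h𝒵 : 𝒵 ∈ 𝔄) (h𝒳𝒵 : 𝒳 ⊆ 𝒵)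
    (hno : ∀ 𝒲 ∈ 𝔄, 𝒵 ⊆ 𝒲 → T ∉ 𝒲) : ¬ ModalFormula.dotTwo.ValidAt M 𝔄 P 𝒳 := by
  intro h
  have h' := h fun _ => ψ
  simp only [ModalFormula.dotTwo, ModalFormula.dia, ModalFormula.HoldsAt] at h'
  -- Worlds grow by inclusion, so the assertion is necessary at 𝒴, while at 𝒵 it is not even
  -- possible.
  refine h' (fun hall => hall 𝒴 h𝒴 h𝒳𝒴 fun 𝒲 h𝒲 hs => ?_) 𝒵 h𝒵 h𝒳𝒵 fun 𝒲 h𝒲 hs hr => ?_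
  · exact (hψ 𝒲 h𝒲 (h𝒳𝒴.trans hs)).2 (hs hT)
  · exact hno 𝒲 h𝒲 hs ((hψ 𝒲 h𝒲 (h𝒳𝒵.trans hs)).1 hr)

end ClassPotentialism

theorem mainTheorem6 (M : ZFSet.{u}) (hMtrans : M.IsTransitive)
    (hMcount : (M : Set ZFSet.{u}).Countable) (hM : ClassPotentialism.ModelsZFC M)
    (𝒳 : Set (Set ZFSet.{u})) (h𝒳 : 𝒳 ∈ ClassPotentialism.topDown M)
    (A : Set ZFSet.{u}) (hA : A ∈ 𝒳)
    (hTr : ClassPotentialism.truthPredicate M A ∉ 𝒳)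
    (hExt : ∃ 𝒴 ∈ ClassPotentialism.topDown M,
      𝒳 ⊆ 𝒴 ∧ ClassPotentialism.truthPredicate M A ∈ 𝒴) :
    ¬ ClassPotentialism.ModalFormula.dotTwo.ValidAt M (ClassPotentialism.topDown M) {A} 𝒳 ∧
    (ClassPotentialism.IsParameterFreeDefinable M A →
      ¬ ClassPotentialism.ModalFormula.dotTwo.ValidAt M (ClassPotentialism.topDown M) ∅ 𝒳) := by
  have : ClassPotentialism.TransModel M := ⟨hMtrans, hM⟩
  obtain ⟨𝒴, h𝒴, h𝒳𝒴, hT⟩ := hExt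
  obtain ⟨𝒵, h𝒵, h𝒳𝒵, hno⟩ :=
    ClassPotentialism.exists_world_forever_without_truth hMcount h𝒳 h𝒴 hA hTr hT
  refine ⟨?_, fun hdef => ?_⟩
  · obtain ⟨ψ, hψ⟩ := ClassPotentialism.exists_truth_formula (M := M)
    exact ClassPotentialism.not_validAt_dotTwo ⟨1, ψ, fun _ => A, fun _ => rfl⟩
      (fun 𝒲 h𝒲 hs => hψ 𝒲 h𝒲 ⟨A, hs hA⟩ A) h𝒴 h𝒳𝒴 hT h𝒵 h𝒳𝒵 hno
  · obtain ⟨ψ, hψ⟩ := hdef.exists_truth_formula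
    exact ClassPotentialism.not_validAt_dotTwo ⟨0, ψ, Fin.elim0, fun i => i.elim0⟩
      (fun 𝒲 h𝒲 hs => hψ 𝒲 h𝒲 ⟨A, hs hA⟩) h𝒴 h𝒳𝒴 hT h𝒵 h𝒳𝒵 hno
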